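/- Let $\Bbbk$ be an algebraically closed field (of any characteristic) and let $\mathcal C$ be a modular fusion category over $\Bbbk$: a semisimple $\Bbbk$-linear abelian rigid monoidal category with bilinear tensor product, finite-dimensional Hom spaces, finitely many simple objects up to isomorphism and $\operatorname{End}(\mathbf 1)=\Bbbk$, equipped with a braiding $c$ and a spherical pivotal structure, whose $S$-matrix is non-degenerate. Here $V_i$ ($i\in I$) are representatives of the isomorphism classes of simple objects, $s_{ij}=\operatorname{tr}(c_{V_j,V_i^*}c_{V_i^*,V_j})$ is the $S$-matrix, $d_i=\dim V_i$ is the pivotal dimension, and $\dim\mathcal C=\sum_i \dim(V_i)\dim(V_i^*)$. Let $F:\mathcal Z(\mathcal C)\to\mathcal C$ be the forgetful functor of the Drinfeld center. It has a right adjoint $R$. Put $Z=FR$, with comultiplication $\delta$ and counit $\epsilon$, and $A=Z(\mathbf 1)=\int_X X\otimes X^*$, with universal maps $\pi_X:A\to X\otimes X^*$ and with the algebra structure $(m,u)$ determined by $\pi_X m=(\mathrm{id}_X\otimes \mathrm{ev}_X\otimes \mathrm{id}_{X^*})(\pi_X\otimes\pi_X)$ and $\pi_Xu=\mathrm{coev}_X$.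 Let $\mathrm{CF}=\operatorname{Hom}(A,\mathbf 1)$ and $\mathrm{CE}=\operatorname{Hom}(\mathbf 1,A)$, paired by $\langle f,a\rangle\,\mathrm{id}_{\mathbf 1}=f\circ a$. Then: * The canonical map $\mathrm{CE}\to\operatorname{End}(\mathrm{id}_{\mathcal C})$ is bijective. Let $\mathcal S$ be the operator on $\mathrm{CE}$ that corresponds to $\xi\mapsto\xi^!$, $(\xi^!)_V=(\xi_{{}^*V})^*$, and let $E_i\in\mathrm{CE}$ be the element acting as the identity on $V_i$ and as $0$ on $V_j$ for $j\ne i$. * There are a unique integral $\Lambda\in\mathrm{CE}$ with $m(\mathrm{id}_A\otimes\Lambda)=\epsilon_{\mathbf 1}\otimes\Lambda$ and $\epsilon_{\mathbf 1}\Lambda=\mathrm{id}_{\mathbf 1}$, and a unique cointegral $\lambda\in\mathrm{CF}$ with $Z(\lambda)\delta_{\mathbf 1}=u\lambda$ and $\langle\lambda,u\rangle=1$. The Fourier transform $\mathcal F_\lambda:\mathrm{CE}\to\mathrm{CF}$, $\mathcal F_\lambda(a)=\lambda\circ m\circ(\mathcal S(a)\otimes \mathrm{id}_A)$, is bijective.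 * There is a unique $Q:A^*\to A$ (the Drinfeld map) such that, for all $X,Y$, the map $\pi_X\circ Q\circ (\pi_{{}^*Y})^*:Y^*\otimes Y\to X\otimes X^*$ is the Hopf link map $(\mathrm{ev}_Y\otimes\mathrm{id})(\mathrm{id}\otimes c_{X,Y}c_{Y,X}\otimes\mathrm{id})(\mathrm{id}\otimes\mathrm{coev}_X)$. Let $f_Q:\mathrm{CF}\to\mathrm{CE}$, $f_Q(\chi)=Q\circ\chi^*$. * $R(\mathbf 1)$ is a finite direct sum of simple objects of $\mathcal Z(\mathcal C)$ (the conjugacy classes). For any such decomposition, let $F_j\in\mathrm{CF}$ correspond to the projection of $R(\mathbf 1)$ onto its $j$-th summand under $\mathrm{CF}\cong\operatorname{End}_{\mathcal Z(\mathcal C)}(R(\mathbf 1))$. There is exactly one labelling of the summands $\mathfrak C^i$ by $i\in I$ such that $f_Q(F_i)=E_i$ for all $i\in I$. Use this labelling. Let $\bar{\mathfrak C}_i=\mathcal F_\lambda^{-1}(F_i)$ be the conjugacy class sums, let $|\mathfrak C^i|$ be the pivotal dimension of $\mathfrak C^i$, let $n_i=1/\langle F_i,\Lambda\rangle$, and let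 $\chi_i:A\to\mathbf 1$ be the irreducible character of $V_i$, i.e. $\pi_{V_i}$ followed by the pivotal evaluation $V_i\otimes V_i^*\to\mathbf 1$. Then $\dim\mathcal C$, $\langle F_i,\Lambda\rangle$ and $|\mathfrak C^i|$ are non-zero, and for every $i\in I$ $$f_Q(\chi_i)=\frac{d_i\,n_i}{\dim\mathcal C}\,\bar{\mathfrak C}_i=\frac{d_i}{|\mathfrak C^i|}\,\bar{\mathfrak C}_i .$$ -/

import Mathlib

open CategoryTheory MonoidalCategory Limits

universe w v u

namespace ModularFusion

noncomputable section

/-! ### Duals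

The dual `X*` comes with `ev : X* ⊗ X ⟶ 𝟙` and `coev : 𝟙 ⟶ X ⊗ X*`; the other dual `*X` comes
with `*X ⊗ X` and `X ⊗ *X` instead. In Mathlib these are `Xᘁ` and `ᘁX`. The abbreviations below
always refer to the chosen duals of the rigid structure. -/

section Rigid

variable {C : Type u} [Category.{v} C] [MonoidalCategory C] [RigidCategory C]

/-- The dual object `X*`. -/
abbrev dual (X : C) : C := Xᘁ

/-- The evaluation `X* ⊗ X ⟶ 𝟙`. -/
abbrev ev (X : C) : dual X ⊗ X ⟶ 𝟙_ C := ε_ X (dual X)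

/-- The coevaluation `𝟙 ⟶ X ⊗ X*`. -/
abbrev coev (X : C) : 𝟙_ C ⟶ X ⊗ dual X := η_ X (dual X)

/-- The transpose `f* : Y* ⟶ X*` of `f : X ⟶ Y`. -/
abbrev dualMap {X Y : C} (f : X ⟶ Y) : dual Y ⟶ dual X := rightAdjointMate f

/-- The canonical isomorphism `(X ⊗ Y)* ≅ Y* ⊗ X*`. -/
abbrev dualTensor (X Y : C) : dual (X ⊗ Y) ≅ dual Y ⊗ dual X := rightDualTensorIso X Y

variable (C) in
/-- The canonical isomorphism `𝟙 ≅ 𝟙*`. -/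
def dualUnit : 𝟙_ C ≅ (RightRigidCategory.rightDual (𝟙_ C)).rightDual :=
  rightDualIso exactPairingUnit (RightRigidCategory.rightDual (𝟙_ C)).exact

/-- The transpose of an endomorphism of `*V`, read as an endomorphism of `V = (*V)*`. -/
def transposePredual {V : C} (f : (ᘁV : C) ⟶ (ᘁV : C)) : V ⟶ V :=
  @rightAdjointMate C _ _ (ᘁV) (ᘁV) hasRightDualLeftDual hasRightDualLeftDual f

theorem transpose_leftAdjointMate {X Y : C} (f : X ⟶ Y) :
    @rightAdjointMate C _ _ (ᘁY) (ᘁX) hasRightDualLeftDual hasRightDualLeftDual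
      (leftAdjointMate f) = f := by
  have h1 := @tensorRightHomEquiv_whiskerLeft_comp_evaluation C _ _ (ᘁY) (ᘁX)
    hasRightDualLeftDual hasRightDualLeftDual (leftAdjointMate f)
  have h2 := @tensorRightHomEquiv_whiskerRight_comp_evaluation C _ _ (ᘁY) X
    hasRightDualLeftDual f
  have h3 := leftAdjointMate_comp_evaluation f
  rw [← cancel_mono (λ_ _).inv]
  refine h1.symm.trans (Eq.trans ?_ h2)
  exact congrArg _ h3

variable (C) in
/-- A pivotal structure: an isomorphism of monoidal functors `id ≅ (-)**`. -/
class PivotalStructure where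
  /-- the component `X ≅ X**` -/
  piv : ∀ X : C, X ≅ dual (dual X)
  naturality : ∀ {X Y : C} (f : X ⟶ Y), f ≫ (piv Y).hom = (piv X).hom ≫ dualMap (dualMap f)
  tensor : ∀ X Y : C,
    (piv (X ⊗ Y)).hom ≫ dualMap (dualTensor X Y).inv =
      ((piv X).hom ⊗ₘ (piv Y).hom) ≫ (dualTensor (dual Y) (dual X)).inv
  unit : (piv (𝟙_ C)).hom ≫
      @rightAdjointMate C _ _ (𝟙_ C) _ (RightRigidCategory.rightDual _)
        (RightRigidCategory.rightDual _) (dualUnit C).hom = (dualUnit C).hom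

end Rigid

/-! ### Fusion categories -/

/-- A decomposition of an object into a finite direct sum of simple objects. -/
structure SimpleDecomposition {D : Type u} [Category.{v} D] [Preadditive D] (X : D)
    (J : Type*) [Fintype J] where
  /-- the simple summands -/
  obj : J → D
  simple : ∀ j, Simple (obj j)
  /-- the inclusions of the summands -/
  incl : ∀ j, obj j ⟶ X
  /-- the projections onto the summands -/
  proj : ∀ j, X ⟶ obj j
  incl_proj_self : ∀ j, incl j ≫ proj j = 𝟙 (obj j)
  incl_proj_ne : ∀ i j, i ≠ j → incl i ≫ proj j = 0
  sum_proj_incl : ∑ j, proj j ≫ incl j = 𝟙 X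

section Fusion

variable (k : Type w) [Field k]
variable (C : Type u) [Category.{v} C] [Abelian C] [Linear k C] [MonoidalCategory C]

/-- A (rigid, `k`-linear, abelian) monoidal category with bilinear tensor product is fusion if it
has finite-dimensional Hom spaces, finitely many simple objects up to isomorphism, every object is
a finite direct sum of simple objects, and `End(𝟙) = k`. -/
class IsFusion [RigidCategory C] [MonoidalPreadditive C] [MonoidalLinear k C] : Prop where
  finite_hom : ∀ X Y : C, Module.Finite k (X ⟶ Y)
  finite_simples : ∃ (n : ℕ) (S : Fin n → C), ∀ X : C, Simple X → ∃ i, Nonempty (X ≅ S i)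
  semisimple : ∀ X : C, ∃ n : ℕ, Nonempty (SimpleDecomposition X (Fin n))
  end_unit : Function.Bijective (fun c : k => c • 𝟙 (𝟙_ C))

variable {C} in
/-- A complete set of representatives of the isomorphism classes of simple objects. -/
structure IsSimpleSystem {ι : Type*} (V : ι → C) : Prop where
  simple : ∀ i, Simple (V i)
  eq_of_iso : ∀ i j, Nonempty (V i ≅ V j) → i = j
  exists_iso : ∀ X : C, Simple X → ∃ i, Nonempty (X ≅ V i)

end Fusion

section Trace

variable {C : Type u} [Category.{v} C] [MonoidalCategory C] [RigidCategory C] [PivotalStructure C]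

/-- The evaluation `X ⊗ X* ⟶ 𝟙` obtained from the pivotal structure. -/
def evPiv (X : C) : X ⊗ dual X ⟶ 𝟙_ C :=
  (PivotalStructure.piv X).hom ▷ dual X ≫ ev (dual X)

/-- The (right) pivotal trace of an endomorphism. -/
def pivTrace {X : C} (f : X ⟶ X) : 𝟙_ C ⟶ 𝟙_ C := coev X ≫ f ▷ dual X ≫ evPiv X

end Trace

section Dim

variable (k : Type w) [Field k]
variable {C : Type u} [Category.{v} C] [Abelian C] [Linear k C] [MonoidalCategory C]
  [RigidCategory C] [MonoidalPreadditive C] [MonoidalLinear k C] [IsFusion k C]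

/-- The scalar by which an endomorphism of `𝟙` acts. -/
def unitScalar (f : 𝟙_ C ⟶ 𝟙_ C) : k :=
  (Equiv.ofBijective _ (IsFusion.end_unit (k := k) (C := C))).symm f

variable [PivotalStructure C]

/-- The quantum (pivotal) dimension of an object. -/
def qdim (X : C) : k := unitScalar k (pivTrace (𝟙 X))

variable (C) in
/-- The pivotal structure is spherical. -/
def IsSpherical : Prop := ∀ X : C, qdim k X = qdim k (dual X)

/-- The global dimension of the category with simple objects `V i`. -/
def globalDim {ι : Type*} [Fintype ι] (V : ι → C) : k := ∑ i, qdim k (V i) * qdim k (dual (V i))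

/-- The `S`-matrix: `s i j` is the trace of the double braiding of `(V i)*` and `V j`. -/
def sMatrix [BraidedCategory C] {ι : Type*} (V : ι → C) : Matrix ι ι k :=
  Matrix.of fun i j =>
    unitScalar k (pivTrace ((β_ (dual (V i)) (V j)).hom ≫ (β_ (V j) (dual (V i))).hom))

end Dim

/-! ### The Drinfeld center is preadditive -/

section Center

variable {C : Type u} [Category.{v} C] [Preadditive C] [MonoidalCategory C] [MonoidalPreadditive C]

/-- Morphisms of the center as a subgroup of the morphisms of `C`. -/
def centerHom (X Y : Center C) : AddSubgroup (X.1 ⟶ Y.1) where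
  carrier := {f | ∀ U, (f ▷ U) ≫ (Y.2.β U).hom = (X.2.β U).hom ≫ (U ◁ f)}
  add_mem' := by
    intro f g hf hg U
    simp [Preadditive.add_comp, Preadditive.comp_add, hf U, hg U]
  zero_mem' := by
    intro U
    simp
  neg_mem' := by
    intro f hf U
    have h1 : (-f) ▷ U = -(f ▷ U) := (tensorRight U).map_neg
    have h2 : U ◁ (-f) = -(U ◁ f) := (tensorLeft U).map_neg
    rw [h1, h2, Preadditive.neg_comp, Preadditive.comp_neg, hf U]

/-- Morphisms of the center are the elements of `centerHom`. -/
def centerHomEquiv (X Y : Center C) : (X ⟶ Y) ≃ centerHom X Y where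
  toFun f := ⟨f.f, f.comm⟩
  invFun f := ⟨f.1, f.2⟩
  left_inv _ := rfl
  right_inv _ := rfl

instance centerPreadditive : Preadditive (Center C) where
  homGroup X Y := (centerHomEquiv X Y).addCommGroup
  add_comp _ _ _ _ _ _ := Center.ext _ _ (Preadditive.add_comp _ _ _ _ _ _)
  comp_add _ _ _ _ _ _ := Center.ext _ _ (Preadditive.comp_add _ _ _ _ _ _)

end Center

/-! ### The adjoint algebra

`R` is a right adjoint of the forgetful functor `F` of the center, and `A = F(R(𝟙))`. -/

section AdjointAlgebra

variable {C : Type u} [Category.{v} C] [MonoidalCategory C]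

/-- The adjoint algebra `A = Z(𝟙)`, where `Z = F R` is the central Hopf comonad. -/
abbrev adjAlg (R : C ⥤ Center C) : C := (Center.forget C).obj (R.obj (𝟙_ C))

variable {R : C ⥤ Center C} (adj : Center.forget C ⊣ R)

/-- The counit `A ⟶ 𝟙`. -/
def counit : adjAlg R ⟶ 𝟙_ C := adj.counit.app (𝟙_ C)

/-- The component `A ⟶ Z(A)` of the comultiplication of the comonad `Z`. -/
def comult : adjAlg R ⟶ (Center.forget C).obj (R.obj (adjAlg R)) :=
  (Center.forget C).map (adj.unit.app (R.obj (𝟙_ C)))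

/-- The unit `𝟙 ⟶ A`, which corresponds to the identity of `𝟙` under the adjunction. -/
def algUnit : 𝟙_ C ⟶ adjAlg R :=
  (Center.forget C).map (adj.homEquiv (𝟙_ (Center C)) (𝟙_ C) (𝟙 (𝟙_ C)))

/-- The multiplication `A ⊗ A ⟶ A`, which corresponds to `counit ⊗ counit` under the adjunction. -/
def algMul : adjAlg R ⊗ adjAlg R ⟶ adjAlg R :=
  (Center.forget C).map
    (adj.homEquiv (R.obj (𝟙_ C) ⊗ R.obj (𝟙_ C)) (𝟙_ C)
      ((counit adj ⊗ₘ counit adj) ≫ (λ_ (𝟙_ C)).hom))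

/-- The half-braiding of `A = F(R(𝟙))`. -/
def halfBraid (R : C ⥤ Center C) (X : C) : adjAlg R ⊗ X ≅ X ⊗ adjAlg R :=
  HalfBraiding.β (R.obj (𝟙_ C)).2 X

theorem halfBraid_naturality (R : C ⥤ Center C) {X Y : C} (f : X ⟶ Y) :
    adjAlg R ◁ f ≫ (halfBraid R Y).hom = (halfBraid R X).hom ≫ f ▷ adjAlg R :=
  HalfBraiding.naturality (R.obj (𝟙_ C)).2 f

/-- The canonical action `A ⊗ X ⟶ X`: the half-braiding of `A` followed by the counit. -/
def action (X : C) : adjAlg R ⊗ X ⟶ X :=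
  (halfBraid R X).hom ≫ X ◁ counit adj ≫ (ρ_ X).hom

/-- The universal dinatural transformation `A ⟶ X ⊗ X'` of the end `A = ∫ X ⊗ X*`, for any dual
`X'` of `X`: the transpose of the canonical action. -/
def univDinat (X X' : C) [ExactPairing X X'] : adjAlg R ⟶ X ⊗ X' :=
  (ρ_ _).inv ≫ adjAlg R ◁ η_ X X' ≫ (α_ _ _ _).inv ≫ action adj X ▷ X'

/-- The natural endomorphism of the identity functor defined by a central element `𝟙 ⟶ A`. -/
def centralToEnd (a : 𝟙_ C ⟶ adjAlg R) : 𝟭 C ⟶ 𝟭 C where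
  app X := (λ_ X).inv ≫ a ▷ X ≫ action adj X
  naturality X Y f := by
    simp only [Functor.id_obj, Functor.id_map, action, Category.assoc]
    rw [leftUnitor_inv_naturality_assoc, whisker_exchange_assoc,
      reassoc_of% (halfBraid_naturality R f), ← whisker_exchange_assoc,
      rightUnitor_naturality]

section Rigid

variable [RigidCategory C]

/-- The involution `ξ ↦ ξ!` of `End(id)`, with `(ξ!)_V = (ξ_{*V})*`. -/
def endDual (ξ : 𝟭 C ⟶ 𝟭 C) : 𝟭 C ⟶ 𝟭 C where
  app V := transposePredual (ξ.app (ᘁV : C))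
  naturality X Y f := by
    have h := congrArg (fun g => @rightAdjointMate C _ _ (ᘁY) (ᘁX) hasRightDualLeftDual
      hasRightDualLeftDual g) (ξ.naturality (leftAdjointMate f))
    simp only [Functor.id_obj, Functor.id_map] at h
    rw [@comp_rightAdjointMate C _ _ _ _ _ hasRightDualLeftDual hasRightDualLeftDual
        hasRightDualLeftDual,
      @comp_rightAdjointMate C _ _ _ _ _ hasRightDualLeftDual hasRightDualLeftDual
        hasRightDualLeftDual, transpose_leftAdjointMate] at h
    exact h.symm

/-- The internal character `ch(X) : A ⟶ 𝟙`: the partial pivotal trace of the canonical action. -/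
def character [PivotalStructure C] (X : C) : adjAlg R ⟶ 𝟙_ C :=
  univDinat adj X (dual X) ≫ evPiv X

/-- The Hopf link `Y* ⊗ Y ⟶ X ⊗ X*`. -/
def hopfLink [BraidedCategory C] (X Y : C) : dual Y ⊗ Y ⟶ X ⊗ dual X :=
  𝟙 _ ⊗≫ (dual Y ⊗ Y) ◁ coev X
    ⊗≫ dual Y ◁ ((β_ Y X).hom ≫ (β_ X Y).hom) ▷ dual X
    ⊗≫ ev Y ▷ (X ⊗ dual X) ⊗≫ 𝟙 _

/-- The universal dinatural transformation `Y* ⊗ Y ⟶ A*` of the coend `A* = ∫ Y* ⊗ Y`: the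
transpose of `A ⟶ *Y ⊗ Y`. -/
def univCodinat (Y : C) : dual Y ⊗ Y ⟶ dual (adjAlg R) :=
  @rightAdjointMate C _ _ (adjAlg R) ((ᘁY : C) ⊗ Y) (RightRigidCategory.rightDual _)
    (@hasRightDualTensor C _ _ (ᘁY : C) Y hasRightDualLeftDual (RightRigidCategory.rightDual Y))
    (univDinat adj (ᘁY : C) Y)

/-- `Q : A* ⟶ A` is the Drinfeld map: the Hopf links factor through it. -/
def IsDrinfeldMap [BraidedCategory C] (Q : dual (adjAlg R) ⟶ adjAlg R) : Prop :=
  ∀ X Y : C, univCodinat adj Y ≫ Q ≫ univDinat adj X (dual X) = hopfLink X Y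

/-- The map from class functions `A ⟶ 𝟙` to central elements `𝟙 ⟶ A` induced by `Q : A* ⟶ A`,
namely `f ↦ Q ∘ f*` (with `𝟙* = 𝟙`). -/
def drinfeld (Q : dual (adjAlg R) ⟶ adjAlg R) (f : adjAlg R ⟶ 𝟙_ C) : 𝟙_ C ⟶ adjAlg R :=
  @rightAdjointMate C _ _ (adjAlg R) (𝟙_ C) (RightRigidCategory.rightDual _) hasRightDualUnit f ≫ Q

end Rigid

/-- A normalized integral: `m ∘ (id ⊗ Λ) = ε ⊗ Λ` and `ε ∘ Λ = 1`. -/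
def IsNormalizedIntegral (Λ : 𝟙_ C ⟶ adjAlg R) : Prop :=
  (ρ_ _).inv ≫ adjAlg R ◁ Λ ≫ algMul adj = counit adj ≫ Λ ∧ Λ ≫ counit adj = 𝟙 (𝟙_ C)

/-- A normalized cointegral: `Z(l) ∘ δ = u ∘ l` and `l ∘ u = 1`. -/
def IsNormalizedCointegral (l : adjAlg R ⟶ 𝟙_ C) : Prop :=
  comult adj ≫ (Center.forget C).map (R.map l) = l ≫ algUnit adj ∧ algUnit adj ≫ l = 𝟙 (𝟙_ C)

/-- The right action `f ↼ b = f ∘ m ∘ (b ⊗ id)` of central elements on class functions. -/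
def actRight (f : adjAlg R ⟶ 𝟙_ C) (b : 𝟙_ C ⟶ adjAlg R) : adjAlg R ⟶ 𝟙_ C :=
  (λ_ _).inv ≫ b ▷ adjAlg R ≫ algMul adj ≫ f

variable [Preadditive C] [RigidCategory C]

/-- The antipodal operator on central elements: `ξ ↦ ξ!` transported along the bijection
`centralToEnd`. -/
def antipode (a : 𝟙_ C ⟶ adjAlg R) : 𝟙_ C ⟶ adjAlg R :=
  Function.invFun (centralToEnd adj) (endDual (centralToEnd adj a))

/-- The Fourier transform `a ↦ l ↼ S(a)` associated with a cointegral `l`. -/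
def fourier (l : adjAlg R ⟶ 𝟙_ C) (a : 𝟙_ C ⟶ adjAlg R) : adjAlg R ⟶ 𝟙_ C :=
  actRight adj l (antipode adj a)

/-- `e` is the central element `E_i`: it acts as the identity on `V i` and as zero on the other
simple objects. -/
def IsSimpleIdempotent {ι : Type*} (V : ι → C) (i : ι) (e : 𝟙_ C ⟶ adjAlg R) : Prop :=
  (centralToEnd adj e).app (V i) = 𝟙 (V i) ∧ ∀ j, j ≠ i → (centralToEnd adj e).app (V j) = 0

section Classes

variable [MonoidalPreadditive C] {J : Type*} [Fintype J]
  (D : SimpleDecomposition (R.obj (𝟙_ C)) J)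

/-- The idempotent class function which corresponds, under the adjunction isomorphism
`Hom(A, 𝟙) = End(R(𝟙))`, to the projection of `R(𝟙)` onto its `j`-th summand. -/
def classIdempotent (j : J) : adjAlg R ⟶ 𝟙_ C :=
  (Center.forget C).map (D.proj j ≫ D.incl j) ≫ counit adj

/-- The conjugacy class sum: the inverse Fourier transform of the `j`-th idempotent. -/
def classSum (l : adjAlg R ⟶ 𝟙_ C) (j : J) : 𝟙_ C ⟶ adjAlg R :=
  Function.invFun (fourier adj l) (classIdempotent adj D j)

end Classes

end AdjointAlgebra

section Numbers

variable (k : Type w) [Field k]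
variable {C : Type u} [Category.{v} C] [Abelian C] [Linear k C] [MonoidalCategory C]
  [RigidCategory C] [MonoidalPreadditive C] [MonoidalLinear k C] [IsFusion k C]
variable {R : C ⥤ Center C}

/-- The pairing `⟨f, a⟩ = f ∘ a` of class functions and central elements. -/
def pairing (f : adjAlg R ⟶ 𝟙_ C) (a : 𝟙_ C ⟶ adjAlg R) : k := unitScalar k (a ≫ f)

/-- The size of the `j`-th conjugacy class: its pivotal dimension. The pivotal structure, duals
and traces of the center are those of the underlying objects. -/
def classSize [PivotalStructure C] {J : Type*} [Fintype J]
    (D : SimpleDecomposition (R.obj (𝟙_ C)) J) (j : J) : k :=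
  qdim k ((Center.forget C).obj (D.obj j))

/-- The number `n_j = 1 / ⟨F_j, Λ⟩`. -/
def classNumber (adj : Center.forget C ⊣ R) {J : Type*} [Fintype J]
    (D : SimpleDecomposition (R.obj (𝟙_ C)) J) (Λ : 𝟙_ C ⟶ adjAlg R) (j : J) : k :=
  (pairing k (classIdempotent adj D j) Λ)⁻¹

end Numbers

end

end ModularFusion

/-! Write `d_i` for the dimension of `V_i`, `i*` for the index of the dual, `o` for the index of the
unit, and `r_ij` for the scalar by which a loop labelled `V_i` acts on a strand `V_j`
(`ringMatrix`). The S-matrix satisfies `s_ij = d_{i*} r_{j i*}`, so non-degeneracy gives `d_i ≠ 0`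
and `det r ≠ 0`. Hence some combination `K = ∑ y_i • ring (V i)` of loops is the projector onto the
unit component of every object. The proof rests on `K`, which cuts strands.

Closing `K` on `V_j* ⊗ V_l` in two ways gives an orthogonality relation for `r`
(`ringMatrix_orthogonality`). Linear algebra (`verlinde_identities`) then forces `dim C = ∑ d_i² ≠
0` in every characteristic, `y_i = d_i / dim C`, `r_{i* j} = r_{i j*}` and `(d_j² / dim C) ∑_i r_{i
j*} r_{i l} = δ_{jl}`.

The projector also identifies `R(𝟙)`. Let `V_l* ⊗ V_l` carry the inverse braiding on the first
factor and the braiding on the second. The sum of these objects, with the evaluations as counit, is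
universal: morphisms from `W` into it are the same as natural families `W ⊗ X ⟶ X`. Uniqueness
follows by cutting with `K` (`encircle_orthogonality`) and existence by a dimension count. So the
sum is `R(𝟙)`. The mirror argument with coevaluations shows that the summands are simple in the
center (`simple_classObj`), and there are no nonzero morphisms between different ones, so every
other decomposition has the same projectors.

What remains is computed with `r`. Let `F_l` be the projection to `V_l* ⊗ V_l` followed by
evaluation. Then `χ_i = ∑_l r_il F_l`, the cointegral is `F_o = ∑ (d_i / dim C) χ_i`, and the
integral acts as `K`. A central element `a` is a function on simple objects; its Fourier transform
is `∑_j (d_j / dim C) a(j*) χ_j`. The element `f_Q(χ_i)` acts as the loop `V_i*`, that is, by `m ↦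
r_{i* m}`. It follows that `f_Q(F_{i*}) = E_i`, which fixes the labelling, and that `d_i f_Q(χ_i)`
has Fourier transform `F_{i*}`, so it is the class sum. As `⟨F_{i*}, Λ⟩ = d_i² / dim C` and the
class has dimension `d_i²`, both coefficients of the theorem equal `1 / d_i`. -/

namespace ModularFusion
noncomputable section

/-! ### Semisimple objects, Schur's lemma and the projector onto the unit component. -/

section Semisimple

set_option linter.unusedSectionVars false

variable {k : Type w} [Field k] {C : Type u} [Category.{v} C] [Abelian C] [Linear k C]
  [MonoidalCategory C] [MonoidalPreadditive C] [MonoidalLinear k C] [RigidCategory C]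

variable (k) in
theorem exists_section_of_simple [IsFusion k C] {X S : C} [Simple S] (f : X ⟶ S) (hf : f ≠ 0) :
    ∃ g : S ⟶ X, g ≫ f = 𝟙 S := by
  obtain ⟨n, ⟨D⟩⟩ := IsFusion.semisimple (k := k) X
  have : ∃ j, D.incl j ≫ f ≠ 0 := by
    by_contra! h
    apply hf
    rw [← Category.id_comp f, ← D.sum_proj_incl, Preadditive.sum_comp]
    simp [h]
  obtain ⟨j, hj⟩ := this
  have := D.simple j
  have := isIso_of_hom_simple hj
  exact ⟨inv (D.incl j ≫ f) ≫ D.incl j, by simp⟩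

variable (k) in
-- Some summand has a nonzero projector, and this projector is a scalar; the projection onto that
-- summand is then an isomorphism.
theorem simple_of_end_scalar [IsFusion k C] (X : C) (h0 : 𝟙 X ≠ 0)
    (h : ∀ f : X ⟶ X, ∃ c : k, f = c • 𝟙 X) : Simple X := by
  obtain ⟨n, ⟨D⟩⟩ := IsFusion.semisimple (k := k) X
  have : ∃ j, D.proj j ≫ D.incl j ≠ 0 := by
    by_contra! hj
    apply h0
    rw [← D.sum_proj_incl]
    simp [hj]
  obtain ⟨j, hj⟩ := this
  obtain ⟨c, hc⟩ := h (D.proj j ≫ D.incl j)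
  have hc0 : c ≠ 0 := by
    rintro rfl
    exact hj (by simp [hc])
  have := D.simple j
  have e : X ≅ D.obj j :=
    { hom := D.proj j
      inv := c⁻¹ • D.incl j
      hom_inv_id := by simp [hc, smul_smul, inv_mul_cancel₀ hc0]
      inv_hom_id := by
        have h2 : D.incl j ≫ D.proj j ≫ D.incl j = c • D.incl j := by simp [hc]
        rw [reassoc_of% (D.incl_proj_self j)] at h2
        -- Idempotency of the projector forces `c` to act as the identity on the summand.
        have h3 : 𝟙 (D.obj j) = c • 𝟙 (D.obj j) := by
          rw [← D.incl_proj_self j, ← Linear.smul_comp, ← h2]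
        rw [Linear.smul_comp, D.incl_proj_self, h3, smul_smul, inv_mul_cancel₀ hc0, one_smul,
          ← h3] }
  exact Simple.of_iso e

variable (k C) in
theorem unit_id_ne_zero [IsFusion k C] : 𝟙 (𝟙_ C) ≠ 0 := by
  intro h
  have := (IsFusion.end_unit (k := k) (C := C)).1 (a₁ := 0) (a₂ := 1) (by simp [h])
  exact zero_ne_one this

variable (k C) in
theorem simple_unit [IsFusion k C] : Simple (𝟙_ C) :=
  simple_of_end_scalar k _ (unit_id_ne_zero k C) fun f => by
    obtain ⟨c, hc⟩ := (IsFusion.end_unit (k := k) (C := C)).2 f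
    exact ⟨c, hc.symm⟩

theorem unitScalar_smul_id [IsFusion k C] (f : 𝟙_ C ⟶ 𝟙_ C) : unitScalar k f • 𝟙 (𝟙_ C) = f :=
  (Equiv.ofBijective _ (IsFusion.end_unit (k := k) (C := C))).apply_symm_apply f

theorem unitScalar_eq [IsFusion k C] {f : 𝟙_ C ⟶ 𝟙_ C} {c : k} (h : f = c • 𝟙 _) :
    unitScalar k f = c := by
  apply (IsFusion.end_unit (k := k) (C := C)).1
  simp only [unitScalar_smul_id, h]

theorem unitScalar_smul [IsFusion k C] (c : k) (f : 𝟙_ C ⟶ 𝟙_ C) :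
    unitScalar k (c • f) = c * unitScalar k f :=
  unitScalar_eq (by rw [mul_smul, unitScalar_smul_id])

theorem unitScalar_sum [IsFusion k C] {J : Type*} (s : Finset J) (f : J → (𝟙_ C ⟶ 𝟙_ C)) :
    unitScalar k (∑ j ∈ s, f j) = ∑ j ∈ s, unitScalar k (f j) :=
  unitScalar_eq (by simp only [Finset.sum_smul, unitScalar_smul_id])

theorem unitScalar_zero [IsFusion k C] : unitScalar k (0 : 𝟙_ C ⟶ 𝟙_ C) = 0 :=
  unitScalar_eq (by simp)

theorem smul_id_injective {X : C} (h0 : 𝟙 X ≠ 0) {c d : k} (h : c • 𝟙 X = d • 𝟙 X) : c = d := by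
  rw [← sub_eq_zero, ← sub_smul] at h
  by_contra hcd
  exact h0 ((smul_eq_zero_iff_right (sub_ne_zero.2 hcd)).1 h)

/-- Morphisms into `𝟙` out of `X' ⊗ X` are determined by their transposes. -/
theorem whiskerLeft_comp_counit_injective {W X X' : C} [ExactPairing X X'] {f g : W ⟶ X}
    (h : X' ◁ f ≫ ε_ X X' = X' ◁ g ≫ ε_ X X') : f = g := by
  have := congrArg (tensorLeftHomEquiv W X X' (𝟙_ C)) h
  have key : ∀ f : W ⟶ X, tensorLeftHomEquiv W X X' (𝟙_ C) (X' ◁ f ≫ ε_ X X') =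
      f ≫ (ρ_ X).inv := fun f => by
    rw [← Equiv.eq_symm_apply]
    simp [tensorLeftHomEquiv, unitors_equal]
  rw [key, key] at this
  simpa using this

theorem whiskerRight_comp_counit_injective {W X X' : C} [ExactPairing X X'] {f g : W ⟶ X'}
    (h : f ▷ X ≫ ε_ X X' = g ▷ X ≫ ε_ X X') : f = g := by
  have := congrArg (tensorRightHomEquiv W X X' (𝟙_ C)) h
  have key : ∀ f : W ⟶ X', tensorRightHomEquiv W X X' (𝟙_ C) (f ▷ X ≫ ε_ X X') =
      f ≫ (λ_ X').inv := fun f => by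
    rw [← Equiv.eq_symm_apply]
    simp [tensorRightHomEquiv, unitors_inv_equal]
  rw [key, key] at this
  simpa using this

theorem exists_whiskerLeft_comp_counit {W X X' : C} [ExactPairing X X'] (f : X' ⊗ W ⟶ 𝟙_ C) :
    ∃ g : W ⟶ X, X' ◁ g ≫ ε_ X X' = f := by
  refine ⟨tensorLeftHomEquiv W X X' (𝟙_ C) f ≫ (ρ_ X).hom, ?_⟩
  have : (tensorLeftHomEquiv W X X' (𝟙_ C)).symm (tensorLeftHomEquiv W X X' (𝟙_ C) f) = f :=
    Equiv.symm_apply_apply _ _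
  conv_rhs => rw [← this]
  simp [tensorLeftHomEquiv, unitors_equal]

theorem exists_whiskerRight_comp_counit {W X X' : C} [ExactPairing X X'] (f : W ⊗ X ⟶ 𝟙_ C) :
    ∃ g : W ⟶ X', g ▷ X ≫ ε_ X X' = f := by
  refine ⟨tensorRightHomEquiv W X X' (𝟙_ C) f ≫ (λ_ X').hom, ?_⟩
  have : (tensorRightHomEquiv W X X' (𝟙_ C)).symm (tensorRightHomEquiv W X X' (𝟙_ C) f) = f :=
    Equiv.symm_apply_apply _ _
  conv_rhs => rw [← this]
  simp [tensorRightHomEquiv, unitors_inv_equal]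

theorem id_ne_zero_of_simple (X : C) [Simple X] : 𝟙 X ≠ 0 := id_nonzero X

variable (k) in
theorem exists_smul_id [IsFusion k C] [IsAlgClosed k] {X : C} [Simple X] (f : X ⟶ X) :
    ∃ c : k, f = c • 𝟙 X := by
  have := IsFusion.finite_hom (k := k) X X
  obtain ⟨c, hc⟩ := endomorphism_simple_eq_smul_id k f
  exact ⟨c, hc.symm⟩

theorem smul_whiskerRight {X Y : C} (c : k) (f : X ⟶ Y) (Z : C) :
    (c • f) ▷ Z = c • f ▷ Z := MonoidalLinear.smul_whiskerRight c f Z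

variable (k) in
-- Transposition turns an endomorphism of `X*` into one of `X`, which is a scalar by Schur's lemma.
theorem simple_dual [IsFusion k C] [IsAlgClosed k] (X : C) [Simple X] : Simple (dual X) := by
  apply simple_of_end_scalar k
  · intro h
    apply id_ne_zero_of_simple X
    apply whiskerLeft_comp_counit_injective (X' := dual X)
    have : ε_ X (dual X) = 0 := by
      rw [← Category.id_comp (ε_ X (dual X)), ← id_whiskerRight, h]
      simp
    simp [this]
  · intro g
    obtain ⟨f, hf⟩ := exists_whiskerLeft_comp_counit (X := X) (X' := dual X) (g ▷ X ≫ ev X)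
    obtain ⟨c, rfl⟩ := exists_smul_id k f
    refine ⟨c, whiskerRight_comp_counit_injective (X := X) ?_⟩
    rw [← hf]
    simp

variable (k) in
/-- Every object is a finite direct sum of objects of a simple system. -/
theorem exists_sum_comp_eq_id [IsFusion k C] {ι : Type*} {V : ι → C} (hV : IsSimpleSystem V)
    (X : C) : ∃ (n : ℕ) (i : Fin n → ι) (p : ∀ a, X ⟶ V (i a)) (q : ∀ a, V (i a) ⟶ X),
      ∑ a, p a ≫ q a = 𝟙 X := by
  obtain ⟨n, ⟨D⟩⟩ := IsFusion.semisimple (k := k) X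
  choose i hi using fun a => hV.exists_iso _ (D.simple a)
  refine ⟨n, i, fun a => D.proj a ≫ (hi a).some.hom, fun a => (hi a).some.inv ≫ D.incl a, ?_⟩
  simpa using D.sum_proj_incl

theorem IsSimpleSystem.hom_eq_zero {ι : Type*} {V : ι → C} (hV : IsSimpleSystem V) {i j : ι}
    (hij : i ≠ j) (f : V i ⟶ V j) : f = 0 := by
  by_contra hf
  have := hV.simple i
  have := hV.simple j
  have := isIso_of_hom_simple hf
  exact hij (hV.eq_of_iso i j ⟨asIso f⟩)

/-- A natural endomorphism of the identity functor which projects every object onto its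
isotypic component of the unit object. -/
structure IsUnitProjector (K : 𝟭 C ⟶ 𝟭 C) : Prop where
  app_unit : K.app (𝟙_ C) = 𝟙 (𝟙_ C)
  app_simple : ∀ X : C, Simple X → IsEmpty (X ≅ 𝟙_ C) → K.app X = 0

variable (k) in
-- In a decomposition of `W` into simple objects, `K` keeps exactly the summands isomorphic to `𝟙`;
-- the other indices contribute zero morphisms.
theorem IsUnitProjector.exists_eq_sum [IsFusion k C] {K : 𝟭 C ⟶ 𝟭 C} (hK : IsUnitProjector K)
    (W : C) : ∃ (n : ℕ) (p : Fin n → (W ⟶ 𝟙_ C)) (q : Fin n → (𝟙_ C ⟶ W)),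
      K.app W = ∑ a, p a ≫ q a := by
  classical
  obtain ⟨n, ⟨D⟩⟩ := IsFusion.semisimple (k := k) W
  refine ⟨n, fun a => if h : Nonempty (D.obj a ≅ 𝟙_ C) then D.proj a ≫ h.some.hom else 0,
    fun a => if h : Nonempty (D.obj a ≅ 𝟙_ C) then h.some.inv ≫ D.incl a else 0, ?_⟩
  have h1 : K.app W = (∑ a, D.proj a ≫ D.incl a) ≫ K.app W := by
    rw [D.sum_proj_incl]; exact (Category.id_comp _).symm
  rw [h1, Preadditive.sum_comp]
  refine Finset.sum_congr rfl fun a _ => ?_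
  have h2 := K.naturality (D.incl a)
  simp only [Functor.id_obj, Functor.id_map] at h2
  rw [Category.assoc, h2]
  dsimp only
  split_ifs with h
  · have h3 := K.naturality h.some.hom
    simp only [Functor.id_obj, Functor.id_map, hK.app_unit] at h3
    have h4 : K.app (D.obj a) = 𝟙 _ := by
      rw [← cancel_mono h.some.hom, ← h3]
      exact (Category.comp_id _).trans (Category.id_comp _).symm
    simp [h4]
  · have := hK.app_simple _ (D.simple a) (not_nonempty_iff.1 h)
    simp [this]

variable (k) in
theorem IsUnitProjector.app_eq_zero [IsFusion k C] {K : 𝟭 C ⟶ 𝟭 C} (hK : IsUnitProjector K)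
    {W : C} (h : ∀ f : W ⟶ 𝟙_ C, f = 0) : K.app W = 0 := by
  obtain ⟨n, p, q, hpq⟩ := hK.exists_eq_sum k W
  rw [hpq]
  exact Finset.sum_eq_zero fun a _ => by rw [h (p a), zero_comp]

/-- By `exists_eq_sum`, `K` on `W` has the form `p ≫ q'`; naturality along `q` together with `q ≫ p
= 𝟙` gives `q' = q`. This is the cutting of strands. -/
theorem IsUnitProjector.app_eq [IsFusion k C] {K : 𝟭 C ⟶ 𝟭 C} (hK : IsUnitProjector K)
    {W : C} {p : W ⟶ 𝟙_ C} {q : 𝟙_ C ⟶ W} (hqp : q ≫ p = 𝟙 _)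
    (h : ∀ f : W ⟶ 𝟙_ C, ∃ c : k, f = c • p) : K.app W = p ≫ q := by
  obtain ⟨n, f, g, hfg⟩ := hK.exists_eq_sum k W
  choose c hc using fun a => h (f a)
  have h1 : K.app W = p ≫ ∑ a, c a • g a := by
    rw [hfg, Preadditive.comp_sum]
    refine Finset.sum_congr rfl fun a _ => ?_
    rw [hc a, Linear.smul_comp, Linear.comp_smul]
  have h2 := K.naturality q
  simp only [Functor.id_obj, Functor.id_map, hK.app_unit] at h2
  have h3 : q ≫ K.app W = q := h2.trans (Category.id_comp _)
  rw [h1, reassoc_of% hqp] at h3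
  rw [h1, h3]

end Semisimple

/-! ### Exact pairings, pivotal traces and partial traces. -/

section Duals

variable {C : Type u} [Category.{v} C] [MonoidalCategory C]

theorem rightDualIso_hom_coevaluation {X Y₁ Y₂ : C} (p₁ : ExactPairing X Y₁)
    (p₂ : ExactPairing X Y₂) :
    @ExactPairing.coevaluation C _ _ X Y₁ p₁ ≫ X ◁ (rightDualIso p₁ p₂).hom =
      @ExactPairing.coevaluation C _ _ X Y₂ p₂ := by
  have := @coevaluation_comp_rightAdjointMate C _ _ X X ⟨Y₂⟩ ⟨Y₁⟩ (𝟙 X)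
  exact this.trans (by simp)

theorem rightDualIso_hom_evaluation {X Y₁ Y₂ : C} (p₁ : ExactPairing X Y₁)
    (p₂ : ExactPairing X Y₂) :
    (rightDualIso p₁ p₂).hom ▷ X ≫ @ExactPairing.evaluation C _ _ X Y₂ p₂ =
      @ExactPairing.evaluation C _ _ X Y₁ p₁ := by
  have := @rightAdjointMate_comp_evaluation C _ _ X X ⟨Y₂⟩ ⟨Y₁⟩ (𝟙 X)
  exact this.trans (by simp)

theorem rightDualIso_inv_evaluation {X Y₁ Y₂ : C} (p₁ : ExactPairing X Y₁)
    (p₂ : ExactPairing X Y₂) :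
    (rightDualIso p₁ p₂).inv ▷ X ≫ @ExactPairing.evaluation C _ _ X Y₁ p₁ =
      @ExactPairing.evaluation C _ _ X Y₂ p₂ :=
  rightDualIso_hom_evaluation p₂ p₁

end Duals

section Pivotal

set_option linter.unusedSectionVars false

variable {C : Type u} [Category.{v} C] [MonoidalCategory C] [RigidCategory C]

theorem coev_tensor (X Y : C) :
    coev (X ⊗ Y) ≫ (X ⊗ Y) ◁ (dualTensor X Y).hom =
      coev X ≫ X ◁ (λ_ _).inv ≫ X ◁ coev Y ▷ dual X ⊗≫ 𝟙 _ := by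
  refine (rightDualIso_hom_coevaluation _ _).trans ?_
  rw [ExactPairing.tensor_coevaluation]
  monoidal

theorem dualTensor_inv_ev (X Y : C) :
    (dualTensor X Y).inv ▷ (X ⊗ Y) ≫ ev (X ⊗ Y) =
      𝟙 _ ⊗≫ dual Y ◁ ev X ▷ Y ⊗≫ ev Y := by
  refine (rightDualIso_inv_evaluation _ _).trans ?_
  rw [ExactPairing.tensor_evaluation]

variable [PivotalStructure C]

theorem evPiv_naturality {X Y : C} (f : X ⟶ Y) :
    f ▷ dual Y ≫ evPiv Y = X ◁ dualMap f ≫ evPiv X := by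
  unfold evPiv
  rw [← comp_whiskerRight_assoc, PivotalStructure.naturality, comp_whiskerRight_assoc,
    whisker_exchange_assoc]
  congr 1
  exact rightAdjointMate_comp_evaluation (dualMap f)

theorem coev_naturality {X Y : C} (f : X ⟶ Y) :
    coev Y ≫ Y ◁ dualMap f = coev X ≫ f ▷ dual X :=
  coevaluation_comp_rightAdjointMate f

theorem pivTrace_comm {X Y : C} (f : X ⟶ Y) (g : Y ⟶ X) :
    pivTrace (f ≫ g) = pivTrace (g ≫ f) := by
  unfold pivTrace
  rw [comp_whiskerRight_assoc, ← reassoc_of% (coev_naturality f), whisker_exchange_assoc,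
    ← evPiv_naturality, comp_whiskerRight_assoc]

/-- The right partial pivotal trace. -/
def partialTrace {X X' : C} (Y : C) (f : X ⊗ Y ⟶ X' ⊗ Y) : X ⟶ X' :=
  𝟙 _ ⊗≫ X ◁ coev Y ⊗≫ f ▷ dual Y ⊗≫ X' ◁ evPiv Y ⊗≫ 𝟙 _

/-- Monoidality of the pivotal structure makes the pivotal evaluation of a tensor product the nested
one, so that a trace over `X ⊗ Y` can be taken one strand at a time. -/
theorem evPiv_tensor (X Y : C) :
    (X ⊗ Y) ◁ (dualTensor X Y).inv ≫ evPiv (X ⊗ Y) =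
      𝟙 _ ⊗≫ X ◁ evPiv Y ▷ dual X ⊗≫ evPiv X := by
  have h := PivotalStructure.tensor X Y
  have h1 := rightAdjointMate_comp_evaluation (dualTensor X Y).inv
  unfold evPiv
  rw [whisker_exchange_assoc]
  erw [← h1]
  rw [← comp_whiskerRight_assoc, h, comp_whiskerRight_assoc]
  erw [dualTensor_inv_ev]
  rw [MonoidalCategory.tensorHom_def]
  calc _ = 𝟙 _ ⊗≫ (PivotalStructure.piv X).hom ▷ (Y ⊗ dual Y ⊗ dual X) ⊗≫
        dual (dual X) ◁ ((PivotalStructure.piv Y).hom ▷ dual Y ≫ ev (dual Y)) ▷ dual X ⊗≫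
          ev (dual X) := by monoidal
    _ = 𝟙 _ ⊗≫ ((PivotalStructure.piv X).hom ▷ ((Y ⊗ dual Y) ⊗ dual X) ≫
        dual (dual X) ◁ ((PivotalStructure.piv Y).hom ▷ dual Y ≫ ev (dual Y)) ▷ dual X) ⊗≫
          ev (dual X) := by monoidal
    _ = _ := by rw [← whisker_exchange]; monoidal

theorem pivTrace_tensor {X Y : C} (f : X ⊗ Y ⟶ X ⊗ Y) :
    pivTrace f = pivTrace (partialTrace Y f) := by
  have h1 := coev_tensor X Y
  have h2 := evPiv_tensor X Y
  calc pivTrace f = coev (X ⊗ Y) ≫ f ▷ dual (X ⊗ Y) ≫ (X ⊗ Y) ◁ (dualTensor X Y).hom ≫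
        (X ⊗ Y) ◁ (dualTensor X Y).inv ≫ evPiv (X ⊗ Y) := by simp [pivTrace]
    _ = (coev (X ⊗ Y) ≫ (X ⊗ Y) ◁ (dualTensor X Y).hom) ≫ f ▷ (dual Y ⊗ dual X) ≫
        (X ⊗ Y) ◁ (dualTensor X Y).inv ≫ evPiv (X ⊗ Y) := by
      rw [Category.assoc, whisker_exchange_assoc]
    _ = _ := by
      rw [h1, h2, pivTrace, partialTrace]
      monoidal

/-- The left partial trace, closed with a given morphism `𝟙 ⟶ X* ⊗ X`. -/
def leftPartialTrace {X Y Y' : C} (q : 𝟙_ C ⟶ dual X ⊗ X) (f : X ⊗ Y ⟶ X ⊗ Y') : Y ⟶ Y' :=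
  𝟙 _ ⊗≫ q ▷ Y ⊗≫ dual X ◁ f ⊗≫ ev X ▷ Y' ⊗≫ 𝟙 _

/-- The strand `X` is closed on the left and `Y` on the right, so the two closings slide past each
other by the interchange law. -/
theorem pivTrace_leftPartialTrace {X Y : C} (q : 𝟙_ C ⟶ dual X ⊗ X) (f : X ⊗ Y ⟶ X ⊗ Y) :
    pivTrace (leftPartialTrace q f) = q ≫ dual X ◁ partialTrace Y f ≫ ev X := by
  unfold pivTrace leftPartialTrace partialTrace
  calc _ = 𝟙 _ ⊗≫ (𝟙_ C ◁ coev Y ≫ q ▷ (Y ⊗ dual Y)) ⊗≫ dual X ◁ f ▷ dual Y ⊗≫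
        (ev X ▷ (Y ⊗ dual Y) ≫ 𝟙_ C ◁ evPiv Y) ⊗≫ 𝟙 _ := by monoidal
    _ = _ := by
      rw [whisker_exchange, ← whisker_exchange (ev X) (evPiv Y)]; monoidal

theorem partialTrace_naturality {X X' Y Y' Z : C} (g : X ⟶ X') (g' : Y ⟶ Y')
    (f : X ⊗ Z ⟶ Y ⊗ Z) (f' : X' ⊗ Z ⟶ Y' ⊗ Z) (h : g ▷ Z ≫ f' = f ≫ g' ▷ Z) :
    g ≫ partialTrace Z f' = partialTrace Z f ≫ g' := by
  unfold partialTrace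
  calc _ = 𝟙 _ ⊗≫ (g ▷ 𝟙_ C ≫ X' ◁ coev Z) ⊗≫ f' ▷ dual Z ⊗≫ Y' ◁ evPiv Z ⊗≫ 𝟙 _ := by monoidal
    _ = 𝟙 _ ⊗≫ X ◁ coev Z ⊗≫ (g ▷ Z ≫ f') ▷ dual Z ⊗≫ Y' ◁ evPiv Z ⊗≫ 𝟙 _ := by
      rw [← whisker_exchange]; monoidal
    _ = 𝟙 _ ⊗≫ X ◁ coev Z ⊗≫ f ▷ dual Z ⊗≫ (g' ▷ (Z ⊗ dual Z) ≫ Y' ◁ evPiv Z) ⊗≫ 𝟙 _ := by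
      rw [h]; monoidal
    _ = _ := by rw [← whisker_exchange]; monoidal

theorem leftPartialTrace_naturality {X Y Y' Z Z' : C} (q : 𝟙_ C ⟶ dual X ⊗ X) (g : Y ⟶ Y')
    (g' : Z ⟶ Z') (f : X ⊗ Y ⟶ X ⊗ Z) (f' : X ⊗ Y' ⟶ X ⊗ Z') (h : X ◁ g ≫ f' = f ≫ X ◁ g') :
    g ≫ leftPartialTrace q f' = leftPartialTrace q f ≫ g' := by
  unfold leftPartialTrace
  calc _ = 𝟙 _ ⊗≫ (𝟙_ C ◁ g ≫ q ▷ Y') ⊗≫ dual X ◁ f' ⊗≫ ev X ▷ Z' ⊗≫ 𝟙 _ := by monoidal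
    _ = 𝟙 _ ⊗≫ q ▷ Y ⊗≫ dual X ◁ (X ◁ g ≫ f') ⊗≫ ev X ▷ Z' ⊗≫ 𝟙 _ := by
      rw [whisker_exchange]; monoidal
    _ = 𝟙 _ ⊗≫ q ▷ Y ⊗≫ dual X ◁ f ⊗≫ ((dual X ⊗ X) ◁ g' ≫ ev X ▷ Z') ⊗≫ 𝟙 _ := by
      rw [h]; monoidal
    _ = _ := by rw [whisker_exchange]; monoidal

end Pivotal

section Linear

set_option linter.unusedSectionVars false

variable {k : Type w} [Field k] {C : Type u} [Category.{v} C] [Abelian C] [Linear k C]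
  [MonoidalCategory C] [MonoidalPreadditive C] [MonoidalLinear k C] [RigidCategory C]
  [PivotalStructure C]

theorem pivTrace_smul {X : C} (c : k) (f : X ⟶ X) : pivTrace (c • f) = c • pivTrace f := by
  simp [pivTrace]

theorem pivTrace_zero (X : C) : pivTrace (0 : X ⟶ X) = 0 := by
  simp [pivTrace]

theorem leftPartialTrace_sum {X Y Y' : C} (q : 𝟙_ C ⟶ dual X ⊗ X) {J : Type*} (s : Finset J)
    (f : J → (X ⊗ Y ⟶ X ⊗ Y')) :
    leftPartialTrace q (∑ j ∈ s, f j) = ∑ j ∈ s, leftPartialTrace q (f j) := by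
  simp [leftPartialTrace, monoidalComp, whiskerLeft_sum, Preadditive.comp_sum,
    Preadditive.sum_comp]

theorem leftPartialTrace_smul {X Y Y' : C} (q : 𝟙_ C ⟶ dual X ⊗ X) (c : k)
    (f : X ⊗ Y ⟶ X ⊗ Y') : leftPartialTrace q (c • f) = c • leftPartialTrace q f := by
  simp [leftPartialTrace, monoidalComp]

theorem pivTrace_smul_id [IsFusion k C] (X : C) (c : k) :
    unitScalar k (pivTrace (c • 𝟙 X)) = c * qdim k X := by
  rw [pivTrace_smul, unitScalar_smul, qdim]

theorem partialTrace_id [IsFusion k C] (X Y : C) :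
    partialTrace Y (𝟙 (X ⊗ Y)) = qdim k Y • 𝟙 X := by
  have h : coev Y ≫ evPiv Y = qdim k Y • 𝟙 (𝟙_ C) := by
    rw [qdim, unitScalar_smul_id]
    simp [pivTrace]
  calc partialTrace Y (𝟙 (X ⊗ Y)) = 𝟙 _ ⊗≫ X ◁ (coev Y ≫ evPiv Y) ⊗≫ 𝟙 _ := by
        unfold partialTrace; monoidal
    _ = _ := by
      rw [h]
      simp [monoidalComp]

theorem qdim_tensor [IsFusion k C] (X Y : C) : qdim k (X ⊗ Y) = qdim k X * qdim k Y := by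
  rw [qdim, pivTrace_tensor, partialTrace_id (k := k), pivTrace_smul_id, mul_comm]

theorem qdim_congr [IsFusion k C] {X Y : C} (e : X ≅ Y) : qdim k X = qdim k Y := by
  rw [qdim, qdim, ← e.hom_inv_id, pivTrace_comm, e.inv_hom_id]

end Linear

/-! ### Double braidings and loops around a strand. -/

section Rings

set_option linter.unusedSectionVars false

variable {C : Type u} [Category.{v} C] [MonoidalCategory C] [BraidedCategory C]

/-- The double braiding. -/
def clasp (X Y : C) : X ⊗ Y ⟶ X ⊗ Y := (β_ X Y).hom ≫ (β_ Y X).hom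

theorem clasp_naturality_left {X X' : C} (f : X ⟶ X') (Y : C) :
    f ▷ Y ≫ clasp X' Y = clasp X Y ≫ f ▷ Y := by
  simp [clasp]

theorem clasp_naturality_right (X : C) {Y Y' : C} (f : Y ⟶ Y') :
    X ◁ f ≫ clasp X Y' = clasp X Y ≫ X ◁ f := by
  simp [clasp]

theorem clasp_tensor_left (X Y Z : C) :
    clasp (X ⊗ Y) Z = 𝟙 _ ⊗≫ X ◁ (β_ Y Z).hom ⊗≫ clasp X Z ▷ Y ⊗≫ X ◁ (β_ Z Y).hom ⊗≫ 𝟙 _ := by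
  rw [clasp, BraidedCategory.braiding_tensor_left_hom, BraidedCategory.braiding_tensor_right_hom,
    clasp]
  monoidal

variable [RigidCategory C] [PivotalStructure C]

/-- The natural endomorphism of the identity functor which encircles a strand by a loop
labelled `Z`. -/
def ring (Z : C) : 𝟭 C ⟶ 𝟭 C where
  app Y := partialTrace Z (clasp Y Z)
  naturality _ _ f := partialTrace_naturality f f _ _ (clasp_naturality_left f Z)

/-- The loop labelled `X`, closed on the left. -/
def leftRing {X : C} (q : 𝟙_ C ⟶ dual X ⊗ X) : 𝟭 C ⟶ 𝟭 C where
  app Y := leftPartialTrace q (clasp X Y)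
  naturality _ _ f := leftPartialTrace_naturality q f f _ _ (clasp_naturality_right X f)

/-- The loop `Z` encircles `X` and `Y` together. The hexagons separate the two, and after `X` is
closed on the left it is a small loop around the strand `Z` alone. -/
theorem leftPartialTrace_ring {X : C} (q : 𝟙_ C ⟶ dual X ⊗ X) (Y Z : C) :
    leftPartialTrace q ((ring Z).app (X ⊗ Y)) =
      𝟙 _ ⊗≫ Y ◁ coev Z ⊗≫ (β_ Y Z).hom ▷ dual Z ⊗≫
        leftPartialTrace q (clasp X Z) ▷ Y ▷ dual Z
        ⊗≫ (β_ Z Y).hom ▷ dual Z ⊗≫ Y ◁ evPiv Z ⊗≫ 𝟙 _ := by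
  dsimp only [ring, leftRing, leftPartialTrace, partialTrace, Functor.id_obj]
  rw [clasp_tensor_left]
  calc _ = 𝟙 _ ⊗≫ (q ▷ (Y ⊗ 𝟙_ C) ≫ (dual X ⊗ X) ◁ (Y ◁ coev Z)) ⊗≫
        dual X ◁ X ◁ (β_ Y Z).hom ▷ dual Z ⊗≫ dual X ◁ clasp X Z ▷ Y ▷ dual Z ⊗≫
        dual X ◁ X ◁ (β_ Z Y).hom ▷ dual Z ⊗≫
        ((dual X ⊗ X) ◁ (Y ◁ evPiv Z) ≫ ev X ▷ (Y ⊗ 𝟙_ C)) ⊗≫ 𝟙 _ := by monoidal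
    _ = 𝟙 _ ⊗≫ Y ◁ coev Z ⊗≫ (q ▷ ((Y ⊗ Z) ⊗ dual Z) ≫
        (dual X ⊗ X) ◁ ((β_ Y Z).hom ▷ dual Z)) ⊗≫ dual X ◁ clasp X Z ▷ Y ▷ dual Z ⊗≫
        ((dual X ⊗ X) ◁ ((β_ Z Y).hom ▷ dual Z) ≫ ev X ▷ ((Y ⊗ Z) ⊗ dual Z)) ⊗≫
        Y ◁ evPiv Z ⊗≫ 𝟙 _ := by
      rw [← whisker_exchange, whisker_exchange (ev X) (Y ◁ evPiv Z)]; monoidal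
    _ = _ := by
      rw [← whisker_exchange, whisker_exchange (ev X)]; monoidal

end Rings

/-! ### Scalars of loops on simple objects and the Verlinde identities. -/

section Scalars

set_option linter.unusedSectionVars false

variable {k : Type w} [Field k] [IsAlgClosed k] {C : Type u} [Category.{v} C] [Abelian C]
  [Linear k C] [MonoidalCategory C] [MonoidalPreadditive C] [MonoidalLinear k C]
  [RigidCategory C]

variable (k) in
/-- The scalar by which a natural endomorphism of the identity acts on a simple object. -/
def natScalar (ξ : 𝟭 C ⟶ 𝟭 C) (X : C) : k := Classical.epsilon fun c : k => ξ.app X = c • 𝟙 X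

theorem natScalar_spec [IsFusion k C] (ξ : 𝟭 C ⟶ 𝟭 C) (X : C) [Simple X] :
    ξ.app X = natScalar k ξ X • 𝟙 X :=
  Classical.epsilon_spec (p := fun c : k => ξ.app X = c • 𝟙 X) (exists_smul_id (X := X) k (ξ.app X))

theorem natScalar_eq [IsFusion k C] {ξ : 𝟭 C ⟶ 𝟭 C} {X : C} [Simple X] {c : k} (h : ξ.app X = c • 𝟙 X) :
    natScalar k ξ X = c :=
  smul_id_injective (id_ne_zero_of_simple X) ((natScalar_spec ξ X).symm.trans h)

theorem natScalar_congr [IsFusion k C] (ξ : 𝟭 C ⟶ 𝟭 C) {X Y : C} [Simple X] [Simple Y] (e : X ≅ Y) :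
    natScalar k ξ X = natScalar k ξ Y := by
  apply natScalar_eq
  have h := ξ.naturality e.hom
  simp only [Functor.id_obj, Functor.id_map] at h
  rw [← cancel_mono e.hom, ← h, natScalar_spec (k := k) ξ Y]
  simp

theorem natScalar_sum [IsFusion k C] {J : Type*} (s : Finset J) (c : J → k) (ξ : J → (𝟭 C ⟶ 𝟭 C)) (X : C)
    [Simple X] : natScalar k (∑ j ∈ s, c j • ξ j) X = ∑ j ∈ s, c j * natScalar k (ξ j) X := by
  apply natScalar_eq
  rw [NatTrans.app_sum, Finset.sum_smul]
  refine Finset.sum_congr rfl fun j _ => ?_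
  rw [NatTrans.app_smul, natScalar_spec (k := k) (ξ j) X, smul_smul]

variable (k) in
/-- Natural endomorphisms of the identity are determined by their values on a simple system. -/
theorem natTrans_ext [IsFusion k C] {ι : Type*} {V : ι → C} (hV : IsSimpleSystem V) {ξ ζ : 𝟭 C ⟶ 𝟭 C}
    (h : ∀ i, ξ.app (V i) = ζ.app (V i)) : ξ = ζ := by
  ext X
  obtain ⟨n, i, p, q, hpq⟩ := exists_sum_comp_eq_id k hV X
  have key : ∀ ξ : 𝟭 C ⟶ 𝟭 C, ξ.app X = ∑ a, p a ≫ ξ.app (V (i a)) ≫ q a := by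
    intro ξ
    have h1 : ξ.app X = (∑ a, p a ≫ q a) ≫ ξ.app X := by
      rw [hpq]; exact (Category.id_comp _).symm
    rw [h1, Preadditive.sum_comp]
    refine Finset.sum_congr rfl fun a _ => ?_
    have h2 := ξ.naturality (q a)
    simp only [Functor.id_obj, Functor.id_map] at h2
    rw [Category.assoc, h2]
  rw [key, key]
  simp [h]

variable [BraidedCategory C] [PivotalStructure C]

theorem pivTrace_ring (X Y : C) : pivTrace ((ring Y).app X) = pivTrace (clasp X Y) :=
  (pivTrace_tensor _).symm

variable (k) in
-- Both sides are the trace of a double braiding of `X` and `Y`, and the trace is cyclic.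
theorem ringScalar_symm [IsFusion k C] (X Y : C) [Simple X] [Simple Y] :
    natScalar k (ring X) Y * qdim k Y = natScalar k (ring Y) X * qdim k X := by
  rw [← pivTrace_smul_id, ← pivTrace_smul_id, ← natScalar_spec (k := k), ← natScalar_spec (k := k), pivTrace_ring,
    pivTrace_ring, clasp, pivTrace_comm]
  rfl

theorem sMatrix_apply [IsFusion k C] {ι : Type*} {V : ι → C} (hV : IsSimpleSystem V) (i j : ι) :
    sMatrix k V i j = natScalar k (ring (V j)) (dual (V i)) * qdim k (dual (V i)) := by
  have := hV.simple i
  have := simple_dual k (V i)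
  rw [← pivTrace_smul_id, ← natScalar_spec (k := k), pivTrace_ring]
  rfl

/-- On a simple `V i` of nonzero dimension the two scalars may be compared after taking traces, and
both traces are the same Hopf link. The normalization of `q` makes the left closure of `X` count
with its dimension. -/
theorem leftRing_eq_ring [IsFusion k C] {ι : Type*} {V : ι → C} (hV : IsSimpleSystem V)
    (hd : ∀ i, qdim k (V i) ≠ 0) {X : C} [Simple X] {q : 𝟙_ C ⟶ dual X ⊗ X}
    (hq : q ≫ ev X = qdim k X • 𝟙 _) : leftRing q = ring X := by
  refine natTrans_ext k hV fun i => ?_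
  have := hV.simple i
  rw [natScalar_spec (k := k) (leftRing q), natScalar_spec (k := k) (ring X)]
  congr 1
  apply mul_right_cancel₀ (hd i)
  rw [ringScalar_symm, ← pivTrace_smul_id, ← natScalar_spec (k := k)]
  refine (congrArg _ (pivTrace_leftPartialTrace q (clasp X (V i)))).trans ?_
  have h : partialTrace (V i) (clasp X (V i)) = natScalar k (ring (V i)) X • 𝟙 X :=
    natScalar_spec (ring (V i)) X
  rw [h]
  apply unitScalar_eq
  simp [hq, smul_smul]

/-- The small loop around the simple strand `Z` is a scalar by Schur's lemma. This is the
multiplicativity behind the Verlinde formula. -/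
theorem leftPartialTrace_ring_of_simple [IsFusion k C] {X : C} [Simple X] {q : 𝟙_ C ⟶ dual X ⊗ X}
    (Y Z : C) [Simple Z] :
    leftPartialTrace q ((ring Z).app (X ⊗ Y)) = natScalar k (leftRing q) Z • (ring Z).app Y := by
  rw [leftPartialTrace_ring]
  have h : leftPartialTrace q (clasp X Z) = natScalar k (leftRing q) Z • 𝟙 Z :=
    natScalar_spec (leftRing q) Z
  rw [h]
  simp [ring, partialTrace, clasp, monoidalComp]

variable (k) in
theorem IsUnitProjector.app_dual_tensor [IsFusion k C] {K : 𝟭 C ⟶ 𝟭 C} (hK : IsUnitProjector K)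
    {X : C} [Simple X] {q : 𝟙_ C ⟶ dual X ⊗ X} (hq : q ≫ ev X = 𝟙 _) :
    K.app (dual X ⊗ X) = ev X ≫ q := by
  refine hK.app_eq (k := k) hq fun f => ?_
  obtain ⟨g, rfl⟩ := exists_whiskerLeft_comp_counit (X := X) (X' := dual X) f
  obtain ⟨c, rfl⟩ := exists_smul_id k g
  exact ⟨c, by simp⟩

variable (k) in
theorem IsUnitProjector.app_dual_tensor_ne [IsFusion k C] {K : 𝟭 C ⟶ 𝟭 C} (hK : IsUnitProjector K)
    {X Y : C} [Simple X] [Simple Y] (h : IsEmpty (Y ≅ X)) : K.app (dual X ⊗ Y) = 0 := by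
  refine hK.app_eq_zero k fun f => ?_
  obtain ⟨g, rfl⟩ := exists_whiskerLeft_comp_counit (X := X) (X' := dual X) f
  have : g = 0 := by
    by_contra hg
    have := isIso_of_hom_simple hg
    exact h.false (asIso g)
  simp [this]

variable (k) in
theorem ev_ne_zero [IsFusion k C] (X : C) [Simple X] : ev X ≠ 0 := by
  intro h
  apply id_ne_zero_of_simple X
  apply whiskerLeft_comp_counit_injective (X' := dual X)
  have : ε_ X (dual X) = 0 := h
  simp [this]

variable (k) in
theorem exists_section_ev [IsFusion k C] (X : C) [Simple X] : ∃ q : 𝟙_ C ⟶ dual X ⊗ X, q ≫ ev X = 𝟙 _ := by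
  have := simple_unit k C
  exact exists_section_of_simple k _ (ev_ne_zero k X)

end Scalars

/-- The matrix identities behind the Verlinde formula. -/
theorem verlinde_identities {k ι : Type*} [Field k] [Fintype ι] [DecidableEq ι]
    (r : Matrix ι ι k) (d y : ι → k) (o : ι) (st : ι → ι) (hd : ∀ i, d i ≠ 0)
    (hsymm : ∀ i j, r i j * d j = r j i * d i) (ho : ∀ j, r o j = 1) (hdo : d o = 1)
    (hst : ∀ i, d (st i) = d i) (hinv : ∀ i, st (st i) = i)
    (hy : ∀ l, ∑ i, y i * r i l = if l = o then 1 else 0)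
    (horth : ∀ j l, ∑ i, y i * r (st j) i * r i l * d l = if j = l then 1 else 0) :
    ∑ i, d i * d i ≠ 0 ∧ (∀ i, y i = d i / ∑ i, d i * d i) ∧
      (∀ i j, r (st i) j = r i (st j)) ∧
      (∀ j l, d j * d j / (∑ i, d i * d i) * ∑ i, r i (st j) * r i l =
        if j = l then 1 else 0) := by
  have hr : ∀ j, r j o = d j := fun j => by
    have := hsymm j o
    rwa [hdo, ho, mul_one, one_mul] at this
  -- `horth` is the statement that this product is the identity. The factors are square, so their
  -- product in the other order is the identity too; its column `o` gives `h3`.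
  have h1 : (Matrix.of fun j i => y i * r (st j) i) * (Matrix.of fun i l => r i l * d l) = 1 := by
    ext j l
    rw [Matrix.mul_apply, Matrix.one_apply, ← horth j l]
    exact Finset.sum_congr rfl fun i _ => by simp only [Matrix.of_apply]; ring
  have h2 := mul_eq_one_comm.1 h1
  have h3 : ∀ j, y o * ∑ l, r j l * (d l * d l) = if j = o then 1 else 0 := fun j => by
    have := congrFun (congrFun h2 j) o
    rw [Matrix.mul_apply, Matrix.one_apply] at this
    rw [← this, Finset.mul_sum]
    refine Finset.sum_congr rfl fun l _ => ?_
    simp only [Matrix.of_apply, hr, hst]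
    ring
  have h4 : y o * ∑ i, d i * d i = 1 := by
    have := h3 o
    simpa [ho] using this
  have hdim : ∑ i, d i * d i ≠ 0 := right_ne_zero_of_mul_eq_one h4
  have hyo : y o ≠ 0 := left_ne_zero_of_mul_eq_one h4
  set N := ∑ i, d i * d i with hN
  have hyoN : y o = N⁻¹ := eq_inv_of_mul_eq_one_left h4
  have h5 : ∀ j, ∑ l, r j l * (y l * d l) = if j = o then 1 else 0 := fun j => by
    have h := hy j
    have : ∑ l, r j l * (y l * d l) = (∑ i, y i * r i j) * d j := by
      rw [Finset.sum_mul]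
      refine Finset.sum_congr rfl fun l _ => ?_
      linear_combination y l * hsymm j l
    rw [this, h]
    split_ifs with hj
    · rw [hj, hdo, one_mul]
    · rw [zero_mul]
  have hinj : ∀ a b : ι → k, (∀ j, ∑ l, r j l * a l = ∑ l, r j l * b l) → a = b := by
    intro a b hab
    have h6 : (Matrix.of fun j i => y i * r (st j) i).mulVec
        ((Matrix.of fun i l => r i l * d l).mulVec fun l => (d l)⁻¹ * a l) =
        (Matrix.of fun j i => y i * r (st j) i).mulVec
        ((Matrix.of fun i l => r i l * d l).mulVec fun l => (d l)⁻¹ * b l) := by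
      congr 1
      ext j
      have key : ∀ a : ι → k, (Matrix.of fun i l => r i l * d l).mulVec
          (fun l => (d l)⁻¹ * a l) j = ∑ l, r j l * a l := fun a => by
        simp only [Matrix.mulVec, dotProduct, Matrix.of_apply]
        refine Finset.sum_congr rfl fun l _ => ?_
        field_simp [hd l]
      rw [key, key, hab]
    rw [Matrix.mulVec_mulVec, Matrix.mulVec_mulVec, h1, Matrix.one_mulVec,
      Matrix.one_mulVec] at h6
    ext l
    exact mul_left_cancel₀ (inv_ne_zero (hd l)) (congrFun h6 l)
  -- By `h3` and `h5` the matrix `r` sends both vectors to the delta function at `o`, and `r` is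
  -- injective by `hinj`.
  have hyd : ∀ l, y l = d l / N := by
    have := hinj (fun l => y l * d l) (fun l => y o * (d l * d l)) fun j => by
      rw [h5, ← h3, Finset.mul_sum]
      exact Finset.sum_congr rfl fun l _ => by ring
    intro l
    have h6 := congrFun this l
    rw [hyoN] at h6
    apply mul_right_cancel₀ (hd l)
    rw [h6]
    ring
  -- The square of the matrix `r i l * d l` is `N` times the permutation matrix of `st`. Since the
  -- square commutes with the matrix itself, the symmetry of `r` under `st` follows.
  have hS : (Matrix.of fun i l => r i l * d l) * (Matrix.of fun i l => r i l * d l) =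
      Matrix.of fun j l => if st j = l then N else 0 := by
    ext j l
    have h6 := horth (st j) l
    rw [Matrix.mul_apply]
    simp only [Matrix.of_apply]
    rw [hinv] at h6
    have : ∑ i, r j i * d i * (r i l * d l) = N * ∑ i, y i * r j i * r i l * d l := by
      rw [Finset.mul_sum]
      refine Finset.sum_congr rfl fun i _ => ?_
      rw [hyd]
      field_simp
    rw [this, h6]
    simp
  refine ⟨hdim, hyd, fun i j => ?_, fun j l => ?_⟩
  · have h6 := congrFun (congrFun (mul_assoc (Matrix.of fun i l => r i l * d l)
      (Matrix.of fun i l => r i l * d l) (Matrix.of fun i l => r i l * d l)) i) j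
    rw [hS, Matrix.mul_apply, Matrix.mul_apply] at h6
    simp only [Matrix.of_apply, ite_mul, zero_mul, mul_ite, mul_zero, Finset.sum_ite_eq,
      Finset.mem_univ, if_true] at h6
    have h7 : ∀ x, (st x = j) ↔ (x = st j) := fun x =>
      ⟨fun h => by rw [← h, hinv], fun h => by rw [h, hinv]⟩
    simp only [h7, Finset.sum_ite_eq', Finset.mem_univ, if_true, hst] at h6
    apply mul_right_cancel₀ (hd j)
    apply mul_right_cancel₀ hdim
    linear_combination h6
  · have h6 : d j * d l / N * ∑ i, r i (st j) * r i l = if j = l then 1 else 0 := by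
      rw [← horth j l, Finset.mul_sum]
      refine Finset.sum_congr rfl fun i _ => ?_
      have h6 := hsymm i (st j)
      rw [hst] at h6
      rw [hyd]
      linear_combination (d l / N * r i l) * h6
    -- Off the diagonal the prefactor in `h6` is nonzero, so the sum itself vanishes and `d j * d l`
    -- may be replaced by `d j * d j`.
    split_ifs at h6 ⊢ with hjl
    · rw [← hjl] at h6 ⊢
      exact h6
    · rw [(mul_eq_zero.1 h6).resolve_left (div_ne_zero (mul_ne_zero (hd j) (hd l)) hdim), mul_zero]

/-! ### Modular data: the loop matrix, its inverse and its orthogonality. -/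

section ModularData

set_option linter.unusedSectionVars false

variable {k : Type w} [Field k] [IsAlgClosed k] {C : Type u} [Category.{v} C] [Abelian C]
  [Linear k C] [MonoidalCategory C] [MonoidalPreadditive C] [MonoidalLinear k C]
  [RigidCategory C]

variable (k) in
theorem exists_dualIndex [IsFusion k C] {ι : Type*} {V : ι → C} (hV : IsSimpleSystem V) (i : ι) :
    ∃ j, Nonempty (dual (V i) ≅ V j) :=
  have := hV.simple i
  hV.exists_iso _ (simple_dual k (V i))

variable (k) in
/-- The index of the dual of a simple object. -/
def dualIndex [IsFusion k C] {ι : Type*} {V : ι → C} (hV : IsSimpleSystem V) (i : ι) : ι :=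
  (exists_dualIndex k hV i).choose

variable (k) in
def dualIndexIso [IsFusion k C] {ι : Type*} {V : ι → C} (hV : IsSimpleSystem V) (i : ι) :
    dual (V i) ≅ V (dualIndex k hV i) :=
  (exists_dualIndex k hV i).choose_spec.some

variable (k) in
theorem exists_unitIndex [IsFusion k C] {ι : Type*} {V : ι → C} (hV : IsSimpleSystem V) :
    ∃ j, Nonempty (𝟙_ C ≅ V j) :=
  hV.exists_iso _ (simple_unit k C)

variable (k) in
/-- The index of the unit object. -/
def unitIndex [IsFusion k C] {ι : Type*} {V : ι → C} (hV : IsSimpleSystem V) : ι :=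
  (exists_unitIndex k hV).choose

variable (k) in
def unitIndexIso [IsFusion k C] {ι : Type*} {V : ι → C} (hV : IsSimpleSystem V) :
    𝟙_ C ≅ V (unitIndex k hV) :=
  (exists_unitIndex k hV).choose_spec.some

def dualIso {X Y : C} (e : X ≅ Y) : dual Y ≅ dual X where
  hom := dualMap e.hom
  inv := dualMap e.inv
  hom_inv_id := by
    rw [dualMap, dualMap, ← comp_rightAdjointMate, e.inv_hom_id, rightAdjointMate_id]
  inv_hom_id := by
    rw [dualMap, dualMap, ← comp_rightAdjointMate, e.hom_inv_id, rightAdjointMate_id]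

variable [BraidedCategory C] [PivotalStructure C]

variable (k) in
theorem dualIndex_dualIndex [IsFusion k C] {ι : Type*} {V : ι → C} (hV : IsSimpleSystem V)
    (i : ι) : dualIndex k hV (dualIndex k hV i) = i :=
  hV.eq_of_iso _ _ ⟨(dualIndexIso k hV _).symm ≪≫ dualIso (dualIndexIso k hV i) ≪≫
    (PivotalStructure.piv (V i)).symm⟩

variable (k) in
/-- The scalars by which the loops labelled by simple objects act on the simple objects. -/
def ringMatrix [IsFusion k C] {ι : Type*} (V : ι → C) : Matrix ι ι k :=
  Matrix.of fun i j => natScalar k (ring (V i)) (V j)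

variable {ι : Type*} [Fintype ι] [DecidableEq ι] {V : ι → C}

theorem ringMatrix_symm [IsFusion k C] (hV : IsSimpleSystem V) (i j : ι) :
    ringMatrix k V i j * qdim k (V j) = ringMatrix k V j i * qdim k (V i) :=
  have := hV.simple i
  have := hV.simple j
  ringScalar_symm k (V i) (V j)

/-- Through this relation non-degeneracy is used: a vanishing dimension would kill a row of the
S-matrix, and a singular loop matrix would make the S-matrix singular. -/
theorem sMatrix_eq [IsFusion k C] (hV : IsSimpleSystem V) (i j : ι) :
    sMatrix k V i j = qdim k (dual (V i)) * ringMatrix k V j (dualIndex k hV i) := by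
  have := hV.simple i
  have := hV.simple (dualIndex k hV i)
  have := simple_dual k (V i)
  rw [sMatrix_apply hV, mul_comm, natScalar_congr _ (dualIndexIso k hV i)]
  rfl

theorem qdim_ne_zero [IsFusion k C] (hsph : IsSpherical k C) (hV : IsSimpleSystem V)
    (hS : (sMatrix k V).det ≠ 0) (i : ι) : qdim k (V i) ≠ 0 := by
  intro h
  apply hS
  apply Matrix.det_eq_zero_of_row_eq_zero i
  intro j
  rw [sMatrix_eq hV, ← hsph, h, zero_mul]

/-- Multiplicativity makes the dimension of `𝟙` idempotent, and non-degeneracy makes it nonzero. -/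
theorem qdim_unit [IsFusion k C] (hsph : IsSpherical k C) (hV : IsSimpleSystem V)
    (hS : (sMatrix k V).det ≠ 0) : qdim k (𝟙_ C) = 1 := by
  have h1 := qdim_tensor (k := k) (𝟙_ C) (𝟙_ C)
  rw [qdim_congr (λ_ (𝟙_ C))] at h1
  have h2 := qdim_ne_zero hsph hV hS (unitIndex k hV)
  rw [← qdim_congr (unitIndexIso k hV)] at h2
  exact (mul_left_cancel₀ h2 (by rw [mul_one]; exact h1)).symm

theorem det_ringMatrix_ne_zero [IsFusion k C] (hV : IsSimpleSystem V)
    (hS : (sMatrix k V).det ≠ 0) : (ringMatrix k V).det ≠ 0 := by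
  intro h
  apply hS
  have : sMatrix k V = Matrix.diagonal (fun i => qdim k (dual (V i))) *
      ((ringMatrix k V).transpose.submatrix (Equiv.ofBijective (dualIndex k hV)
        (Function.Involutive.bijective (dualIndex_dualIndex k hV))) id) := by
    ext i j
    rw [Matrix.diagonal_mul, sMatrix_eq hV]
    rfl
  rw [this, Matrix.det_mul, Matrix.det_permute, Matrix.det_transpose, h, mul_zero, mul_zero]

/-- The coefficients form the row of the inverse loop matrix at the unit index. Weighted with them,
the loops add up to the projector onto the unit component. -/
theorem exists_ring_combination [IsFusion k C] (hV : IsSimpleSystem V)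
    (hS : (sMatrix k V).det ≠ 0) : ∃ y : ι → k, ∀ l, ∑ i, y i * ringMatrix k V i l =
      if l = unitIndex k hV then 1 else 0 := by
  refine ⟨Matrix.vecMul (Pi.single (unitIndex k hV) 1) (ringMatrix k V)⁻¹, fun l => ?_⟩
  have h : IsUnit (ringMatrix k V).det := (det_ringMatrix_ne_zero hV hS).isUnit
  have h1 := congrFun (congrArg (Matrix.vecMul (Pi.single (unitIndex k hV) (1 : k)))
    (Matrix.nonsing_inv_mul _ h)) l
  rw [← Matrix.vecMul_vecMul, Matrix.vecMul_one] at h1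
  rw [Pi.single_apply] at h1
  exact h1

theorem isUnitProjector_of_app [IsFusion k C] (hV : IsSimpleSystem V) {K : 𝟭 C ⟶ 𝟭 C}
    (h : ∀ l, K.app (V l) = (if l = unitIndex k hV then 1 else 0 : k) • 𝟙 (V l)) :
    IsUnitProjector K := by
  have key : ∀ (X : C) (l : ι) (e : X ≅ V l),
      K.app X = (if l = unitIndex k hV then 1 else 0 : k) • 𝟙 X := by
    intro X l e
    have h1 := K.naturality e.hom
    simp only [Functor.id_obj, Functor.id_map] at h1
    rw [← cancel_mono e.hom, ← h1, h l, Linear.comp_smul, Linear.smul_comp]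
    exact congrArg _ ((Category.comp_id _).trans (Category.id_comp _).symm)
  refine ⟨?_, fun X hX hX' => ?_⟩
  · simpa using key _ _ (unitIndexIso k hV)
  · obtain ⟨l, ⟨e⟩⟩ := hV.exists_iso X hX
    have := key X l e
    rw [if_neg, zero_smul] at this
    · exact this
    · rintro rfl
      exact hX'.false (e ≪≫ (unitIndexIso k hV).symm)

theorem isUnitProjector_sum_ring [IsFusion k C] (hV : IsSimpleSystem V) {y : ι → k}
    (hy : ∀ l, ∑ i, y i * ringMatrix k V i l = if l = unitIndex k hV then 1 else 0) :
    IsUnitProjector (∑ i, y i • ring (V i)) := by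
  refine isUnitProjector_of_app (k := k) hV fun l => ?_
  have := hV.simple l
  refine (natScalar_spec (k := k) (∑ i, y i • ring (V i)) (V l)).trans ?_
  rw [natScalar_sum (k := k)]
  exact congrArg (fun c : k => c • 𝟙 (V l)) (hy l)

theorem clasp_unit_left (X : C) : clasp (𝟙_ C) X = 𝟙 _ := by
  simp [clasp, braiding_tensorUnit_left, braiding_tensorUnit_right]

theorem ring_app_unit [IsFusion k C] (X : C) :
    (ring X).app (𝟙_ C) = qdim k X • 𝟙 (𝟙_ C) := by
  rw [← partialTrace_id (k := k), ← clasp_unit_left]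
  rfl

theorem ringMatrix_unit_right [IsFusion k C] (hV : IsSimpleSystem V) (j : ι) :
    ringMatrix k V j (unitIndex k hV) = qdim k (V j) := by
  have := hV.simple (unitIndex k hV)
  have := simple_unit k C
  refine (natScalar_congr _ (unitIndexIso k hV)).symm.trans ?_
  exact natScalar_eq (ring_app_unit (V j))

theorem qdim_unitIndex [IsFusion k C] (hsph : IsSpherical k C) (hV : IsSimpleSystem V)
    (hS : (sMatrix k V).det ≠ 0) : qdim k (V (unitIndex k hV)) = 1 := by
  rw [← qdim_congr (unitIndexIso k hV), qdim_unit hsph hV hS]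

theorem ringMatrix_unit_left [IsFusion k C] (hsph : IsSpherical k C) (hV : IsSimpleSystem V)
    (hS : (sMatrix k V).det ≠ 0) (j : ι) : ringMatrix k V (unitIndex k hV) j = 1 := by
  have h := ringMatrix_symm (k := k) hV (unitIndex k hV) j
  rw [ringMatrix_unit_right, qdim_unitIndex hsph hV hS, mul_one] at h
  exact mul_right_cancel₀ (qdim_ne_zero hsph hV hS j) (by rw [one_mul]; exact h)

theorem qdim_dualIndex [IsFusion k C] (hsph : IsSpherical k C) (hV : IsSimpleSystem V) (i : ι) :
    qdim k (V (dualIndex k hV i)) = qdim k (V i) := by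
  rw [← qdim_congr (dualIndexIso k hV i), ← hsph]

theorem ringScalar_congr [IsFusion k C] (hsph : IsSpherical k C) (hV : IsSimpleSystem V)
    (hS : (sMatrix k V).det ≠ 0) {X Y : C} [Simple X] [Simple Y] (e : X ≅ Y) (i : ι) :
    natScalar k (ring X) (V i) = natScalar k (ring Y) (V i) := by
  have := hV.simple i
  apply mul_right_cancel₀ (qdim_ne_zero hsph hV hS i)
  rw [ringScalar_symm, ringScalar_symm k Y, natScalar_congr _ e, qdim_congr e]

variable (k) in
theorem exists_ev_eq_qdim [IsFusion k C] (X : C) [Simple X] :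
    ∃ q : 𝟙_ C ⟶ dual X ⊗ X, q ≫ ev X = qdim k X • 𝟙 _ := by
  obtain ⟨q, hq⟩ := exists_section_ev k X
  exact ⟨qdim k X • q, by rw [Linear.smul_comp, hq]⟩

theorem pivTrace_leftPartialTrace_of_simple [IsFusion k C] {X : C} [Simple X]
    {q : 𝟙_ C ⟶ dual X ⊗ X} (hq : q ≫ ev X = qdim k X • 𝟙 _) {Y : C} (f : X ⊗ Y ⟶ X ⊗ Y) :
    unitScalar k (pivTrace (leftPartialTrace q f)) = unitScalar k (pivTrace f) := by
  obtain ⟨c, hc⟩ := exists_smul_id k (partialTrace Y f)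
  rw [pivTrace_leftPartialTrace, pivTrace_tensor, hc, pivTrace_smul_id]
  apply unitScalar_eq
  simp [hq, smul_smul]

/-- The trace of `K` on `V_j* ⊗ V_l` is computed twice. Closing `V_j*` on the left turns each loop
`V_i` into `r_{j* i}` times a loop around `V_l` alone. On the other hand `K` vanishes there for `j ≠
l`, and for `j = l` it is evaluation followed by a section, whose trace is the dimension of `𝟙`. -/
theorem ringMatrix_orthogonality [IsFusion k C] (hsph : IsSpherical k C) (hV : IsSimpleSystem V)
    (hS : (sMatrix k V).det ≠ 0) {y : ι → k}
    (hy : ∀ l, ∑ i, y i * ringMatrix k V i l = if l = unitIndex k hV then 1 else 0) (j l : ι) :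
    ∑ i, y i * ringMatrix k V (dualIndex k hV j) i * ringMatrix k V i l * qdim k (V l) =
      if j = l then 1 else 0 := by
  have hK := isUnitProjector_sum_ring hV hy
  have := hV.simple j
  have := hV.simple l
  have := hV.simple (dualIndex k hV j)
  have := simple_dual k (V j)
  obtain ⟨q, hq⟩ := exists_ev_eq_qdim k (dual (V j))
  have h1 := pivTrace_leftPartialTrace_of_simple hq ((∑ i, y i • ring (V i)).app (dual (V j) ⊗ V l))
  have h2 : leftPartialTrace q ((∑ i, y i • ring (V i)).app (dual (V j) ⊗ V l)) =
      (∑ i, y i * ringMatrix k V (dualIndex k hV j) i * ringMatrix k V i l) • 𝟙 (V l) := by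
    rw [NatTrans.app_sum]
    refine (leftPartialTrace_sum _ _ _).trans ?_
    rw [Finset.sum_smul]
    refine Finset.sum_congr rfl fun i _ => ?_
    have := hV.simple i
    rw [NatTrans.app_smul]
    refine (leftPartialTrace_smul _ _ _).trans ?_
    rw [leftPartialTrace_ring_of_simple (k := k), natScalar_spec (k := k) (ring (V i)) (V l),
      leftRing_eq_ring hV (qdim_ne_zero hsph hV hS) hq,
      ringScalar_congr hsph hV hS (dualIndexIso k hV j), smul_smul, smul_smul, mul_assoc,
      mul_assoc]
    rfl
  rw [h2, pivTrace_smul_id, Finset.sum_mul] at h1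
  rw [h1]
  split_ifs with hjl
  · subst hjl
    obtain ⟨q', hq'⟩ := exists_section_ev k (V j)
    rw [hK.app_dual_tensor k hq']
    refine (congrArg _ (pivTrace_comm _ _)).trans ?_
    rw [hq']
    exact qdim_unit hsph hV hS
  · rw [hK.app_dual_tensor_ne k ⟨fun e => hjl (hV.eq_of_iso _ _ ⟨e⟩).symm⟩]
    refine (congrArg _ (pivTrace_zero _)).trans unitScalar_zero

theorem globalDim_eq [IsFusion k C] (hsph : IsSpherical k C) :
    globalDim k V = ∑ i, qdim k (V i) * qdim k (V i) :=
  Finset.sum_congr rfl fun i _ => by rw [← hsph]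

/-- Non-vanishing comes from the equation `y_o * dim C = 1` in `verlinde_identities`, so no
assumption on the characteristic enters. The other three conclusions are the relations used in all
later computations. -/
theorem globalDim_ne_zero [IsFusion k C] (hsph : IsSpherical k C) (hV : IsSimpleSystem V)
    (hS : (sMatrix k V).det ≠ 0) : globalDim k V ≠ 0 ∧
      (∀ i j, ringMatrix k V (dualIndex k hV i) j = ringMatrix k V i (dualIndex k hV j)) ∧
      (∀ l, ∑ i, qdim k (V i) / globalDim k V * ringMatrix k V i l =
        if l = unitIndex k hV then 1 else 0) ∧
      (∀ j l, qdim k (V j) * qdim k (V j) / globalDim k V *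
        ∑ i, ringMatrix k V i (dualIndex k hV j) * ringMatrix k V i l =
        if j = l then 1 else 0) := by
  obtain ⟨y, hy⟩ := exists_ring_combination hV hS
  obtain ⟨h1, h2, h3, h4⟩ := verlinde_identities (ringMatrix k V) (fun i => qdim k (V i)) y
    (unitIndex k hV) (dualIndex k hV) (qdim_ne_zero hsph hV hS) (ringMatrix_symm hV)
    (ringMatrix_unit_left hsph hV hS) (qdim_unitIndex hsph hV hS) (qdim_dualIndex hsph hV)
    (dualIndex_dualIndex k hV) hy (ringMatrix_orthogonality hsph hV hS hy)
  rw [globalDim_eq hsph]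
  refine ⟨h1, h3, fun l => ?_, h4⟩
  rw [← hy l]
  exact Finset.sum_congr rfl fun i _ => by rw [h2 i]

end ModularData

/-! ### Universal actions of half-braided objects. -/

section UniversalActions

variable {C : Type u} [Category.{v} C] [MonoidalCategory C]

/-- The natural family `A ⊗ X ⟶ X ⊗ V` defined by a half-braided object `A` and a
morphism `A ⟶ V`. -/
def halfAct {A V : C} (b : HalfBraiding A) (m : A ⟶ V) (X : C) : A ⊗ X ⟶ X ⊗ V :=
  (b.β X).hom ≫ X ◁ m

theorem halfAct_naturality {A V : C} (b : HalfBraiding A) (m : A ⟶ V) {X Y : C} (f : X ⟶ Y) :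
    A ◁ f ≫ halfAct b m Y = halfAct b m X ≫ f ▷ V := by
  simp only [halfAct, Category.assoc]
  rw [HalfBraiding.naturality_assoc, whisker_exchange]

theorem halfAct_tensor {A V : C} (b : HalfBraiding A) (m : A ⟶ V) (X Y : C) :
    halfAct b m (X ⊗ Y) =
      (α_ _ _ _).inv ≫ (b.β X).hom ▷ Y ≫ (α_ _ _ _).hom ≫ X ◁ halfAct b m Y ≫
        (α_ _ _ _).inv := by
  rw [halfAct, HalfBraiding.monoidal, halfAct]
  monoidal

theorem comp_halfAct {A B V : C} (a : HalfBraiding A) (b : HalfBraiding B) {f : B ⟶ A}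
    (hf : ∀ X, f ▷ X ≫ (a.β X).hom = (b.β X).hom ≫ X ◁ f) (m : A ⟶ V) (X : C) :
    f ▷ X ≫ halfAct a m X = halfAct b (f ≫ m) X := by
  simp [halfAct, reassoc_of% hf]

/-- The hexagon and naturality along `𝟙 ⊗ 𝟙 ≅ 𝟙` make the half-braiding at `𝟙` idempotent up to
unitors; being invertible, it is canonical. -/
theorem halfBraiding_unit {A : C} (b : HalfBraiding A) :
    (b.β (𝟙_ C)).hom = (ρ_ A).hom ≫ (λ_ A).inv := by
  have h1 := b.naturality (λ_ (𝟙_ C)).hom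
  rw [HalfBraiding.monoidal] at h1
  generalize b.β (𝟙_ C) = c at h1
  have h2 : c.hom ≫ (λ_ A).hom ≫ (ρ_ A).inv ≫ c.hom = c.hom := by
    calc _ = (𝟙 _ ⊗≫ c.hom ⊗≫ c.hom ⊗≫ 𝟙 _) := by monoidal
      _ = (A ◁ (λ_ (𝟙_ C)).inv) ≫ ((α_ A (𝟙_ C) (𝟙_ C)).inv ≫
          c.hom ▷ _ ≫ (α_ _ _ _).hom ≫ 𝟙_ C ◁ c.hom ≫ (α_ _ _ _).inv) ≫
          (λ_ (𝟙_ C)).hom ▷ A := by monoidal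
      _ = _ := by rw [← h1]; simp
  have h3 : (λ_ A).hom ≫ (ρ_ A).inv ≫ c.hom = 𝟙 _ := by
    rw [← cancel_epi c.hom, h2, Category.comp_id]
  rw [← cancel_epi (ρ_ A).inv, ← cancel_epi (λ_ A).hom, h3]
  simp

theorem halfAct_unit {A V : C} (b : HalfBraiding A) (m : A ⟶ V) :
    halfAct b m (𝟙_ C) = (ρ_ A).hom ≫ m ≫ (λ_ V).inv := by
  simp [halfAct, halfBraiding_unit]

/-- `m : A ⟶ V` induces a bijection between morphisms `W ⟶ A` and natural families
`W ⊗ X ⟶ X ⊗ V`. -/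
def IsUniversalAction {A V : C} (b : HalfBraiding A) (m : A ⟶ V) : Prop :=
  ∀ (W : C) (φ : ∀ X, W ⊗ X ⟶ X ⊗ V), (∀ {X Y : C} (f : X ⟶ Y), W ◁ f ≫ φ Y = φ X ≫ f ▷ V) →
    ∃! f : W ⟶ A, ∀ X, f ▷ X ≫ halfAct b m X = φ X

variable {A V : C} {b : HalfBraiding A} {m : A ⟶ V}

theorem IsUniversalAction.hom_ext (h : IsUniversalAction b m) {W : C} {f g : W ⟶ A}
    (hfg : ∀ X, f ▷ X ≫ halfAct b m X = g ▷ X ≫ halfAct b m X) : f = g := by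
  refine (h W (fun X => g ▷ X ≫ halfAct b m X) ?_).unique hfg fun _ => rfl
  intro X Y f
  rw [whisker_exchange_assoc, halfAct_naturality, Category.assoc]

variable [RigidCategory C]

theorem tensorLeftHomEquiv_symm_halfAct (b : HalfBraiding A) (m : A ⟶ V) {W X : C}
    (f : W ⟶ X ⊗ A) (Y : C) :
    (tensorLeftHomEquiv W X (dual X) A).symm f ▷ Y ≫ halfAct b m Y =
      𝟙 _ ⊗≫ dual X ◁ (f ▷ Y ≫ (α_ _ _ _).hom ≫ X ◁ halfAct b m Y) ⊗≫
        ev X ▷ (Y ⊗ V) ⊗≫ 𝟙 _ := by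
  calc _ = 𝟙 _ ⊗≫ dual X ◁ f ▷ Y ⊗≫ (ev X ▷ (A ⊗ Y) ≫ 𝟙_ C ◁ halfAct b m Y) ⊗≫ 𝟙 _ := by
        dsimp [tensorLeftHomEquiv]; monoidal
    _ = _ := by rw [← whisker_exchange]; monoidal

/-- Duality moves `X` to the source: a morphism `W ⟶ X ⊗ A` is a morphism `X* ⊗ W ⟶ A`, to which
universality applies. -/
theorem IsUniversalAction.hom_ext_tensor (h : IsUniversalAction b m) {W X : C} {f g : W ⟶ X ⊗ A}
    (hfg : ∀ Y, f ▷ Y ≫ (α_ _ _ _).hom ≫ X ◁ halfAct b m Y =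
      g ▷ Y ≫ (α_ _ _ _).hom ≫ X ◁ halfAct b m Y) : f = g := by
  apply (tensorLeftHomEquiv W X (dual X) A).symm.injective
  apply h.hom_ext
  intro Y
  rw [tensorLeftHomEquiv_symm_halfAct, tensorLeftHomEquiv_symm_halfAct, hfg]

theorem IsUniversalAction.exists_hom_tensor (h : IsUniversalAction b m) {W X : C}
    (φ : ∀ Y, W ⊗ Y ⟶ X ⊗ Y ⊗ V)
    (hφ : ∀ {Y Z : C} (f : Y ⟶ Z), W ◁ f ≫ φ Z = φ Y ≫ X ◁ f ▷ V) :
    ∃ f : W ⟶ X ⊗ A, ∀ Y, f ▷ Y ≫ (α_ _ _ _).hom ≫ X ◁ halfAct b m Y = φ Y := by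
  obtain ⟨g, hg, -⟩ := h (dual X ⊗ W) (fun Y => (α_ _ _ _).hom ≫
    (tensorLeftHomEquiv (W ⊗ Y) X (dual X) (Y ⊗ V)).symm (φ Y)) (by
      intro Y Z f
      dsimp [tensorLeftHomEquiv]
      have : (dual X ⊗ W) ◁ f = (α_ _ _ _).hom ≫ dual X ◁ W ◁ f ≫ (α_ _ _ _).inv := by simp
      rw [this]
      simp only [Category.assoc, Iso.inv_hom_id_assoc]
      rw [← whiskerLeft_comp_assoc, hφ]
      simp only [MonoidalCategory.whiskerLeft_comp, Category.assoc]
      congr 2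
      calc _ = 𝟙 _ ⊗≫ ((dual X ⊗ X) ◁ (f ▷ V) ≫ ε_ X (dual X) ▷ (Z ⊗ V)) ⊗≫ 𝟙 _ := by monoidal
        _ = _ := by rw [whisker_exchange]; monoidal)
  refine ⟨tensorLeftHomEquiv W X (dual X) A g, fun Y => ?_⟩
  apply (tensorLeftHomEquiv (W ⊗ Y) X (dual X) (Y ⊗ V)).symm.injective
  rw [← cancel_epi (α_ _ _ _).hom]
  refine Eq.trans ?_ (hg Y)
  have := tensorLeftHomEquiv_symm_halfAct b m (tensorLeftHomEquiv W X (dual X) A g) Y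
  rw [Equiv.symm_apply_apply] at this
  rw [this]
  dsimp [tensorLeftHomEquiv]
  monoidal

/-- A universal action is a universal arrow from the forgetful functor. -/
theorem IsUniversalAction.existsUnique_hom (h : IsUniversalAction b m) {N : C}
    (c : HalfBraiding N) (n : N ⟶ V) :
    ∃! f : N ⟶ A, (∀ X, f ▷ X ≫ (b.β X).hom = (c.β X).hom ≫ X ◁ f) ∧ f ≫ m = n := by
  obtain ⟨f, hf, -⟩ := h N (halfAct c n) (fun f => halfAct_naturality c n f)
  -- Compatibility with the half-braidings is tested by acting on a further object `Y`; by the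
  -- hexagon both sides then come from the action on `X ⊗ Y`, where `f` is already known to match.
  have hcomm : ∀ X, f ▷ X ≫ (b.β X).hom = (c.β X).hom ≫ X ◁ f := by
    intro X
    apply h.hom_ext_tensor
    intro Y
    calc _ = (α_ _ _ _).hom ≫ (f ▷ (X ⊗ Y) ≫ halfAct b m (X ⊗ Y)) ≫ (α_ _ _ _).hom := by
          rw [halfAct_tensor]; monoidal
      _ = (c.β X).hom ▷ Y ≫ (α_ _ _ _).hom ≫ X ◁ halfAct c n Y := by
        rw [hf, halfAct_tensor]; monoidal
      _ = _ := by rw [← hf]; monoidal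
  refine ⟨f, ⟨hcomm, ?_⟩, fun g hg => ?_⟩
  -- The action on `𝟙` is `m` itself, up to unitors.
  · have := hf (𝟙_ C)
    rw [halfAct_unit, halfAct_unit, rightUnitor_naturality_assoc, cancel_epi] at this
    simpa [← Category.assoc] using this
  · refine h.hom_ext fun X => ?_
    rw [comp_halfAct b c hg.1, hg.2, hf]

end UniversalActions

/-! ### The right adjoint of the forgetful functor, and mixed half-braidings. -/

section RightAdjoint

set_option linter.unusedSectionVars false

variable {C : Type u} [Category.{v} C] [MonoidalCategory C] [RigidCategory C]

/-- A universal action with target `V` is a terminal object of the comma category over `V`, and such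
terminal objects assemble to a right adjoint. -/
theorem forget_isLeftAdjoint_of_universalActions
    (h : ∀ V : C, ∃ (A : C) (b : HalfBraiding A) (m : A ⟶ V), IsUniversalAction b m) :
    (Center.forget C).IsLeftAdjoint := by
  have : ∀ V : C, HasTerminal (CostructuredArrow (Center.forget C) V) := by
    intro V
    obtain ⟨A, b, m, hm⟩ := h V
    have key : ∀ T : CostructuredArrow (Center.forget C) V, ∃! f : T.left.1 ⟶ A,
        (∀ X, f ▷ X ≫ (b.β X).hom = (T.left.2.β X).hom ≫ X ◁ f) ∧ f ≫ m = T.hom :=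
      fun T => hm.existsUnique_hom T.left.2 T.hom
    let M : Center C := ⟨A, b⟩
    let f : ∀ T : CostructuredArrow (Center.forget C) V, T.left ⟶ M := fun T =>
      ⟨(key T).choose, (key T).choose_spec.1.1⟩
    refine IsTerminal.hasTerminal (X := CostructuredArrow.mk (Y := M) m)
      (IsTerminal.ofUniqueHom (fun T => CostructuredArrow.homMk (f T) (key T).choose_spec.1.2) ?_)
    intro T g
    ext
    exact (key T).choose_spec.2 g.left.f ⟨g.left.comm, CostructuredArrow.w g⟩
  exact isLeftAdjoint_of_costructuredArrowTerminals _

variable [BraidedCategory C]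

/-- The half-braiding of `X ⊗ A` built from the braiding and a half-braiding of `A`. -/
def braidedTensor (X : C) {A : C} (b : HalfBraiding A) : HalfBraiding (X ⊗ A) :=
  (Center.tensorObj (Center.ofBraidedObj X) ⟨A, b⟩).2

theorem braidedTensor_hom (X : C) {A : C} (b : HalfBraiding A) (Y : C) :
    ((braidedTensor X b).β Y).hom = (α_ _ _ _).hom ≫ X ◁ (b.β Y).hom ≫ (α_ _ _ _).inv ≫
      (β_ X Y).hom ▷ A ≫ (α_ _ _ _).hom := rfl

theorem halfAct_braidedTensor (X : C) {A : C} (b : HalfBraiding A) (m : A ⟶ 𝟙_ C) (Y : C) :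
    halfAct (braidedTensor X b) (X ◁ m ≫ (ρ_ X).hom) Y =
      (α_ _ _ _).hom ≫ X ◁ halfAct b m Y ≫ X ◁ (ρ_ Y).hom ≫ (β_ X Y).hom := by
  rw [halfAct, braidedTensor_hom, halfAct]
  calc _ = 𝟙 _ ⊗≫ X ◁ (b.β Y).hom ⊗≫ ((β_ X Y).hom ▷ A ≫ (Y ⊗ X) ◁ m) ⊗≫ 𝟙 _ := by monoidal
    _ = _ := by rw [← whisker_exchange]; monoidal

/-- The braiding turns families `W ⊗ Y ⟶ Y ⊗ X` into families `W ⊗ Y ⟶ X ⊗ Y`, which are handled by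
duality. So only a universal action with target `𝟙` has to be constructed. -/
theorem IsUniversalAction.braidedTensor {A : C} {b : HalfBraiding A} {m : A ⟶ 𝟙_ C}
    (h : IsUniversalAction b m) (X : C) :
    IsUniversalAction (braidedTensor X b) (X ◁ m ≫ (ρ_ X).hom) := by
  intro W φ hφ
  obtain ⟨f, hf⟩ := h.exists_hom_tensor (W := W) (X := X)
    (fun Y => φ Y ≫ (β_ X Y).inv ≫ X ◁ (ρ_ Y).inv) (by
      intro Y Z f
      rw [reassoc_of% (hφ f), BraidedCategory.braiding_inv_naturality_left_assoc]
      simp)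
  refine ⟨f, fun Y => ?_, fun g hg => h.hom_ext_tensor fun Y => ?_⟩
  · rw [halfAct_braidedTensor, reassoc_of% (hf Y)]
    simp
  · rw [hf, ← hg Y, halfAct_braidedTensor]
    simp

theorem forget_isLeftAdjoint {A : C} {b : HalfBraiding A} {m : A ⟶ 𝟙_ C}
    (h : IsUniversalAction b m) : (Center.forget C).IsLeftAdjoint :=
  forget_isLeftAdjoint_of_universalActions fun V => ⟨_, _, _, h.braidedTensor V⟩

/-- The half-braiding given by the inverse of the braiding. -/
def reverseHalfBraiding (X : C) : HalfBraiding X where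
  β U := (β_ U X).symm
  monoidal U U' := by
    simp only [Iso.symm_hom]
    rw [BraidedCategory.braiding_tensor_left_inv]
  naturality f := by simp

/-- The object of the center with underlying object `X ⊗ Y`, where `X` carries the inverse of the
braiding and `Y` the braiding. -/
def mixedTensor (X Y : C) : HalfBraiding (X ⊗ Y) :=
  (Center.tensorObj ⟨X, reverseHalfBraiding X⟩ (Center.ofBraidedObj Y)).2

theorem mixedTensor_hom (X Y Z : C) :
    ((mixedTensor X Y).β Z).hom = (α_ _ _ _).hom ≫ X ◁ (β_ Y Z).hom ≫ (α_ _ _ _).inv ≫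
      (β_ Z X).inv ▷ Y ≫ (α_ _ _ _).hom := rfl

/-- Pulling `m` through `Z` by naturality of the braiding cancels the inverse braiding with `X` and
leaves a full twist of `Z` around `Y`. -/
theorem halfAct_mixedTensor_of_comp {X Y : C} (m : X ⊗ Y ⟶ 𝟙_ C) (Z : C) :
    halfAct (mixedTensor X Y) m Z = (α_ _ _ _).hom ≫ X ◁ clasp Y Z ≫ (α_ _ _ _).inv ≫
      m ▷ Z ≫ (λ_ Z).hom ≫ (ρ_ Z).inv := by
  have h : Z ◁ m = (α_ _ _ _).inv ≫ (β_ Z X).hom ▷ Y ≫ (α_ _ _ _).hom ≫ X ◁ (β_ Z Y).hom ≫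
      (α_ _ _ _).inv ≫ m ▷ Z ≫ (λ_ Z).hom ≫ (ρ_ Z).inv := by
    have := BraidedCategory.braiding_naturality_right Z m
    rw [BraidedCategory.braiding_tensor_right_hom, braiding_tensorUnit_right] at this
    rw [← cancel_mono ((ρ_ Z).hom ≫ (λ_ Z).inv), this]
    simp
  rw [halfAct, mixedTensor_hom, h, clasp]
  simp

end RightAdjoint

/-! ### Half-braidings on direct sums. -/

section Sums

variable {C : Type u} [Category.{v} C] [Preadditive C] [MonoidalCategory C]
  [MonoidalPreadditive C]

/-- The half-braiding of a direct sum. -/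
def sumHalfBraiding {J : Type*} [Fintype J] {P : J → C}
    (b : ∀ j, HalfBraiding (P j))
    {B : C} (incl : ∀ j, P j ⟶ B) (proj : ∀ j, B ⟶ P j)
    (hself : ∀ j, incl j ≫ proj j = 𝟙 (P j)) (hne : ∀ i j, i ≠ j → incl i ≫ proj j = 0)
    (hsum : ∑ j, proj j ≫ incl j = 𝟙 B) : HalfBraiding B where
  β U :=
    { hom := ∑ j, proj j ▷ U ≫ ((b j).β U).hom ≫ U ◁ incl j
      inv := ∑ j, U ◁ proj j ≫ ((b j).β U).inv ≫ incl j ▷ U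
      hom_inv_id := by
        classical
        simp only [Preadditive.comp_sum, Preadditive.sum_comp, Category.assoc]
        have : ∀ i j, proj i ▷ U ≫ ((b i).β U).hom ≫ U ◁ incl i ≫ U ◁ proj j ≫
            ((b j).β U).inv ≫ incl j ▷ U = if i = j then (proj i ≫ incl i) ▷ U else 0 := by
          intro i j
          rw [← whiskerLeft_comp_assoc]
          split_ifs with hij
          · subst hij; simp [hself]
          · simp [hne i j hij]
        rw [← id_whiskerRight, ← hsum, sum_whiskerRight]
        refine Finset.sum_congr rfl fun j _ => ?_
        rw [Finset.sum_eq_single j]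
        · simpa using this j j
        · intro i _ hij
          simpa [hij] using this i j
        · simp
      inv_hom_id := by
        classical
        simp only [Preadditive.comp_sum, Preadditive.sum_comp, Category.assoc]
        have : ∀ i j, U ◁ proj i ≫ ((b i).β U).inv ≫ incl i ▷ U ≫ proj j ▷ U ≫
            ((b j).β U).hom ≫ U ◁ incl j = if i = j then U ◁ (proj i ≫ incl i) else 0 := by
          intro i j
          rw [← comp_whiskerRight_assoc]
          split_ifs with hij
          · subst hij; simp [hself]
          · simp [hne i j hij]
        rw [← MonoidalCategory.whiskerLeft_id, ← hsum, whiskerLeft_sum]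
        refine Finset.sum_congr rfl fun j _ => ?_
        rw [Finset.sum_eq_single j]
        · simpa using this j j
        · intro i _ hij
          simpa [hij] using this i j
        · simp }
  monoidal U U' := by
    simp only [sum_whiskerRight, whiskerLeft_sum, Preadditive.comp_sum, Preadditive.sum_comp]
    refine Finset.sum_congr rfl fun j _ => ?_
    have : ∀ i, (α_ B U U').inv ≫ (proj i ▷ U ≫ ((b i).β U).hom ≫ U ◁ incl i) ▷ U' ≫
        (α_ U B U').hom ≫ U ◁ (proj j ▷ U' ≫ ((b j).β U').hom ≫ U' ◁ incl j) ≫ (α_ U U' B).inv =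
        𝟙 _ ⊗≫ proj i ▷ (U ⊗ U') ⊗≫ ((b i).β U).hom ▷ U' ⊗≫ U ◁ (incl i ≫ proj j) ▷ U' ⊗≫
          U ◁ ((b j).β U').hom ⊗≫ (U ⊗ U') ◁ incl j := by
      intro i; monoidal
    rw [Finset.sum_eq_single j]
    · rw [this, hself, HalfBraiding.monoidal]; monoidal
    · intro i _ hij
      rw [this, hne i j hij]
      simp [monoidalComp]
    · simp
  naturality f := by
    simp only [Preadditive.comp_sum, Preadditive.sum_comp, Category.assoc]
    refine Finset.sum_congr rfl fun j _ => ?_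
    rw [whisker_exchange_assoc, (b j).naturality_assoc, whisker_exchange]

variable {J : Type*} [Fintype J] {P : J → C} (b : ∀ j, HalfBraiding (P j))
  {B : C} (incl : ∀ j, P j ⟶ B) (proj : ∀ j, B ⟶ P j)
  (hself : ∀ j, incl j ≫ proj j = 𝟙 (P j)) (hne : ∀ i j, i ≠ j → incl i ≫ proj j = 0)
  (hsum : ∑ j, proj j ≫ incl j = 𝟙 B)

theorem sumHalfBraiding_hom (U : C) :
    ((sumHalfBraiding b incl proj hself hne hsum).β U).hom =
      ∑ j, proj j ▷ U ≫ ((b j).β U).hom ≫ U ◁ incl j := rfl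

theorem incl_sumHalfBraiding (j : J) (U : C) :
    incl j ▷ U ≫ ((sumHalfBraiding b incl proj hself hne hsum).β U).hom =
      ((b j).β U).hom ≫ U ◁ incl j := by
  rw [sumHalfBraiding_hom, Preadditive.comp_sum, Finset.sum_eq_single j]
  · rw [← comp_whiskerRight_assoc, hself, id_whiskerRight, Category.id_comp]
  · intro i _ hij
    rw [← comp_whiskerRight_assoc, hne j i hij.symm]
    simp
  · simp

theorem sumHalfBraiding_proj (j : J) (U : C) :
    proj j ▷ U ≫ ((b j).β U).hom =
      ((sumHalfBraiding b incl proj hself hne hsum).β U).hom ≫ U ◁ proj j := by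
  rw [sumHalfBraiding_hom, Preadditive.sum_comp, Finset.sum_eq_single j]
  · simp [← MonoidalCategory.whiskerLeft_comp, hself]
  · intro i _ hij
    simp [← MonoidalCategory.whiskerLeft_comp, hne i j hij]
  · simp

end Sums

/-! ### Strands encircling the second factor of `X' ⊗ X`. -/

section Encircle

set_option linter.unusedSectionVars false

variable {C : Type u} [Category.{v} C] [MonoidalCategory C] [BraidedCategory C]

/-- A strand `Z` which passes around the second tensor factor of the middle term of
`W ⟶ X' ⊗ X ⟶ W'`. -/
def encircle {W W' X' X : C} (g : W ⟶ X' ⊗ X) (h : X' ⊗ X ⟶ W') (Z : C) : W ⊗ Z ⟶ W' ⊗ Z :=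
  g ▷ Z ≫ (α_ X' X Z).hom ≫ X' ◁ clasp X Z ≫ (α_ X' X Z).inv ≫ h ▷ Z

theorem encircle_naturality {W W' X' X : C} (g : W ⟶ X' ⊗ X) (h : X' ⊗ X ⟶ W') {Y Z : C}
    (f : Y ⟶ Z) : W ◁ f ≫ encircle g h Z = encircle g h Y ≫ W' ◁ f := by
  unfold encircle
  rw [whisker_exchange_assoc, associator_naturality_right_assoc, ← whiskerLeft_comp_assoc,
    clasp_naturality_right]
  simp only [MonoidalCategory.whiskerLeft_comp, Category.assoc]
  rw [associator_inv_naturality_right_assoc, whisker_exchange]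

variable [RigidCategory C] [PivotalStructure C]

/-- A loop `Z` around `X ⊗ T` is also a loop around `T` whose strand goes around `X` on the way.
Hence the loop depends on `g` and `h` only through `encircle g h Z`. -/
theorem whiskerLeft_ring_eq {W W' X' X : C} (g : W ⟶ X' ⊗ X) (h : X' ⊗ X ⟶ W') (Z T : C) :
    g ▷ T ≫ (α_ X' X T).hom ≫ X' ◁ (ring Z).app (X ⊗ T) ≫ (α_ X' X T).inv ≫ h ▷ T =
      𝟙 _ ⊗≫ W ◁ (T ◁ coev Z ⊗≫ (β_ T Z).hom ▷ dual Z) ⊗≫ encircle g h Z ▷ (T ⊗ dual Z) ⊗≫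
        W' ◁ ((β_ Z T).hom ▷ dual Z ⊗≫ T ◁ evPiv Z) ⊗≫ 𝟙 _ := by
  dsimp only [ring, partialTrace, Functor.id_obj, encircle]
  rw [clasp_tensor_left]
  calc _ = 𝟙 _ ⊗≫ (g ▷ (T ⊗ 𝟙_ C) ≫ (X' ⊗ X) ◁ (T ◁ coev Z)) ⊗≫
        X' ◁ X ◁ (β_ T Z).hom ▷ dual Z ⊗≫ X' ◁ clasp X Z ▷ T ▷ dual Z ⊗≫
        X' ◁ X ◁ (β_ Z T).hom ▷ dual Z ⊗≫
        ((X' ⊗ X) ◁ (T ◁ evPiv Z) ≫ h ▷ (T ⊗ 𝟙_ C)) ⊗≫ 𝟙 _ := by monoidal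
    _ = 𝟙 _ ⊗≫ W ◁ T ◁ coev Z ⊗≫ (g ▷ ((T ⊗ Z) ⊗ dual Z) ≫
        (X' ⊗ X) ◁ ((β_ T Z).hom ▷ dual Z)) ⊗≫ X' ◁ clasp X Z ▷ T ▷ dual Z ⊗≫
        ((X' ⊗ X) ◁ ((β_ Z T).hom ▷ dual Z) ≫ h ▷ ((T ⊗ Z) ⊗ dual Z)) ⊗≫
        W' ◁ T ◁ evPiv Z ⊗≫ 𝟙 _ := by
      rw [← whisker_exchange, whisker_exchange h (T ◁ evPiv Z)]; monoidal
    _ = _ := by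
      rw [← whisker_exchange, whisker_exchange h]; monoidal

theorem comp_evPiv_zigzag (X : C) :
    𝟙 _ ⊗≫ (coev (dual X) ≫ dual X ◁ (PivotalStructure.piv X).inv) ▷ dual X ⊗≫
      dual X ◁ evPiv X ⊗≫ 𝟙 _ = 𝟙 (dual X) := by
  calc _ = 𝟙 _ ⊗≫ coev (dual X) ▷ dual X ⊗≫
        dual X ◁ ((PivotalStructure.piv X).inv ▷ dual X ≫ evPiv X) ⊗≫ 𝟙 _ := by monoidal
    _ = (λ_ _).inv ≫ (coev (dual X) ▷ dual X ≫ (α_ _ _ _).hom ≫ dual X ◁ ev (dual X)) ≫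
        (ρ_ _).hom := by
      rw [evPiv, ← comp_whiskerRight_assoc]; simp [monoidalComp]
    _ = _ := by
      rw [ExactPairing.evaluation_coevaluation]; simp

theorem whiskerRight_evPiv_injective {W X : C} {g g' : W ⟶ dual X ⊗ X}
    (h : g ▷ dual X ≫ (α_ _ _ _).hom ≫ dual X ◁ evPiv X =
      g' ▷ dual X ≫ (α_ _ _ _).hom ≫ dual X ◁ evPiv X) : g = g' := by
  apply (cancel_mono (dual X ◁ (PivotalStructure.piv X).hom)).1
  apply (tensorRightHomEquiv W (dual X) (dual (dual X)) (dual X)).symm.injective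
  have key : ∀ g : W ⟶ dual X ⊗ X, (tensorRightHomEquiv W (dual X) (dual (dual X)) (dual X)).symm
      (g ≫ dual X ◁ (PivotalStructure.piv X).hom) =
      (g ▷ dual X ≫ (α_ _ _ _).hom ≫ dual X ◁ evPiv X) ≫ (ρ_ _).hom := fun g => by
    simp [tensorRightHomEquiv, evPiv]
  rw [key, key, h]

theorem whiskerLeft_coev_injective {W X : C} {h h' : dual X ⊗ X ⟶ W}
    (hh : dual X ◁ coev X ≫ (α_ _ _ _).inv ≫ h ▷ dual X =
      dual X ◁ coev X ≫ (α_ _ _ _).inv ≫ h' ▷ dual X) : h = h' := by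
  apply (tensorRightHomEquiv (dual X) X (dual X) W).injective
  simp only [tensorRightHomEquiv, Equiv.coe_fn_mk]
  rw [hh]

end Encircle

/-! ### Cutting strands: injectivity and surjectivity of encircling. -/

section Universal

set_option linter.unusedSectionVars false

variable {k : Type w} [Field k] [IsAlgClosed k] {C : Type u} [Category.{v} C] [Abelian C]
  [Linear k C] [MonoidalCategory C] [MonoidalPreadditive C] [MonoidalLinear k C]
  [RigidCategory C] [PivotalStructure C]

theorem exists_comp_evPiv {W X : C} (f : W ⊗ dual X ⟶ 𝟙_ C) :
    ∃ g : W ⟶ X, g ▷ dual X ≫ evPiv X = f := by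
  obtain ⟨g, hg⟩ := exists_whiskerRight_comp_counit (X := dual X) (X' := dual (dual X)) f
  refine ⟨g ≫ (PivotalStructure.piv X).inv, ?_⟩
  rw [← hg, evPiv, ← comp_whiskerRight_assoc]
  simp

variable (k) in
theorem IsUnitProjector.app_tensor_dual [IsFusion k C] {K : 𝟭 C ⟶ 𝟭 C} (hK : IsUnitProjector K)
    {X : C} [Simple X] (hX : qdim k X ≠ 0) :
    K.app (X ⊗ dual X) = ((qdim k X)⁻¹ • evPiv X) ≫ coev X := by
  have h1 : coev X ≫ evPiv X = qdim k X • 𝟙 (𝟙_ C) := by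
    rw [qdim, unitScalar_smul_id]; simp [pivTrace]
  refine hK.app_eq (k := k) ?_ fun f => ?_
  · rw [Linear.comp_smul, h1, smul_smul, inv_mul_cancel₀ hX, one_smul]
  · obtain ⟨g, rfl⟩ := exists_comp_evPiv f
    obtain ⟨c, rfl⟩ := exists_smul_id k g
    refine ⟨c * qdim k X, ?_⟩
    rw [smul_smul, mul_assoc, mul_inv_cancel₀ hX, mul_one, smul_whiskerRight]
    simp

variable (k) in
theorem IsUnitProjector.app_tensor_dual_ne [IsFusion k C] {K : 𝟭 C ⟶ 𝟭 C} (hK : IsUnitProjector K)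
    {X Y : C} [Simple X] [Simple Y] (h : IsEmpty (Y ≅ X)) : K.app (Y ⊗ dual X) = 0 := by
  refine hK.app_eq_zero k fun f => ?_
  obtain ⟨g, rfl⟩ := exists_comp_evPiv f
  have : g = 0 := by
    by_contra hg
    have := isIso_of_hom_simple hg
    exact h.false (asIso g)
  simp [this]

variable [BraidedCategory C] {ι : Type*} [Fintype ι] [DecidableEq ι] {V : ι → C}

/-- By `whiskerLeft_ring_eq`, vanishing of the encircling sum for all `V_i` passes to loops around
`V_l ⊗ T`, hence to `K`. For `T = V_m*` the projector kills all terms but `l = m`, and cuts that one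
into a product of a factor from `g m` and a factor from `h m`. -/
theorem encircle_orthogonality [IsFusion k C] (hsph : IsSpherical k C) (hV : IsSimpleSystem V)
    (hS : (sMatrix k V).det ≠ 0) {W W' : C} {g : ∀ l, W ⟶ dual (V l) ⊗ V l}
    {h : ∀ l, dual (V l) ⊗ V l ⟶ W'} (H : ∀ i, ∑ l, encircle (g l) (h l) (V i) = 0) (m : ι) :
    (g m ▷ dual (V m) ≫ (α_ _ _ _).hom ≫ dual (V m) ◁ evPiv (V m)) ≫
      dual (V m) ◁ coev (V m) ≫ (α_ _ _ _).inv ≫ h m ▷ dual (V m) = 0 := by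
  obtain ⟨y, hy⟩ := exists_ring_combination (k := k) hV hS
  have hK := isUnitProjector_sum_ring hV hy
  set K := ∑ i, y i • ring (V i) with hKdef
  have := hV.simple
  have h1 : ∀ T, ∑ l, g l ▷ T ≫ (α_ _ _ T).hom ≫ dual (V l) ◁ K.app (V l ⊗ T) ≫
      (α_ _ _ T).inv ≫ h l ▷ T = 0 := by
    intro T
    have h2 : ∀ i, ∑ l, g l ▷ T ≫ (α_ _ _ T).hom ≫ dual (V l) ◁ (ring (V i)).app (V l ⊗ T) ≫
      (α_ _ _ T).inv ≫ h l ▷ T = 0 := by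
      intro i
      simp only [whiskerLeft_ring_eq]
      simp only [monoidalComp, ← Preadditive.comp_sum, ← Preadditive.sum_comp,
        ← sum_whiskerRight, H]
      simp
    have h3 : ∀ l, K.app (V l ⊗ T) = ∑ i, y i • (ring (V i)).app (V l ⊗ T) := by
      intro l
      rw [hKdef, NatTrans.app_sum]
      simp only [NatTrans.app_smul]
    simp only [h3, whiskerLeft_sum, MonoidalLinear.whiskerLeft_smul, Preadditive.comp_sum,
      Preadditive.sum_comp, Linear.comp_smul, Linear.smul_comp]
    rw [Finset.sum_comm]
    simp only [← Finset.smul_sum, h2, smul_zero, Finset.sum_const_zero]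
  have h4 := h1 (dual (V m))
  rw [Finset.sum_eq_single m] at h4
  · rw [hK.app_tensor_dual k (qdim_ne_zero hsph hV hS m)] at h4
    simp only [Linear.smul_comp, Linear.comp_smul, MonoidalLinear.whiskerLeft_smul] at h4
    have h5 := inv_ne_zero (qdim_ne_zero hsph hV hS m)
    have h6 := (smul_eq_zero_iff_right h5).1 h4
    simpa using h6
  · intro l _ hl
    rw [hK.app_tensor_dual_ne k ⟨fun e => hl (hV.eq_of_iso _ _ ⟨e⟩)⟩]
    simp
  · simp

/-- For evaluations the second factor in `encircle_orthogonality` is invertible by the zigzag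
identity, so the first one vanishes. -/
theorem eq_zero_of_encircle_ev [IsFusion k C] (hsph : IsSpherical k C) (hV : IsSimpleSystem V)
    (hS : (sMatrix k V).det ≠ 0) {W : C} {g : ∀ l, W ⟶ dual (V l) ⊗ V l}
    (H : ∀ i, ∑ l, encircle (g l) (ev (V l)) (V i) = 0) (m : ι) : g m = 0 := by
  apply whiskerRight_evPiv_injective
  have h := encircle_orthogonality hsph hV hS H m
  rw [ExactPairing.coevaluation_evaluation] at h
  rw [← cancel_mono ((ρ_ (dual (V m))).hom ≫ (λ_ (dual (V m))).inv), h]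
  simp

/-- The coevaluation `𝟙 ⟶ X* ⊗ X` obtained from the pivotal structure. -/
def coevPiv (X : C) : 𝟙_ C ⟶ dual X ⊗ X :=
  coev (dual X) ≫ dual X ◁ (PivotalStructure.piv X).inv

theorem eq_zero_of_encircle_coevPiv [IsFusion k C] (hsph : IsSpherical k C)
    (hV : IsSimpleSystem V) (hS : (sMatrix k V).det ≠ 0) {W : C} {h : ∀ l, dual (V l) ⊗ V l ⟶ W}
    (H : ∀ i, ∑ l, encircle (coevPiv (V l)) (h l) (V i) = 0) (m : ι) : h m = 0 := by
  apply whiskerLeft_coev_injective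
  have h1 := encircle_orthogonality hsph hV hS H m
  have h2 := comp_evPiv_zigzag (V m)
  have h3 : coevPiv (V m) ▷ dual (V m) ≫ (α_ _ _ _).hom ≫ dual (V m) ◁ evPiv (V m) =
      (λ_ _).hom ≫ (ρ_ _).inv := by
    rw [← cancel_epi (λ_ (dual (V m))).inv, ← cancel_mono (ρ_ (dual (V m))).hom]
    simpa [monoidalComp, coevPiv] using h2
  rw [h3] at h1
  rw [← cancel_epi ((λ_ (dual (V m))).hom ≫ (ρ_ (dual (V m))).inv), h1]
  simp

end Universal

/-- Composing `Φ` with the product of the `Ψ i` gives an injective endomorphism of a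
finite-dimensional space, hence a surjective one. No dimension has to be computed. -/
theorem surjective_of_injective_of_injective {k ι : Type*} [Field k] [Finite ι] {A B : ι → Type*}
    [∀ i, AddCommGroup (A i)] [∀ i, Module k (A i)] [∀ i, AddCommGroup (B i)]
    [∀ i, Module k (B i)] [∀ i, Module.Finite k (B i)]
    (Ψ : ∀ i, B i →ₗ[k] A i) (hΨ : ∀ i, Function.Injective (Ψ i))
    (Φ : (∀ i, A i) →ₗ[k] (∀ i, B i)) (hΦ : Function.Injective Φ) : Function.Surjective Φ := by
  let Ψ' : (∀ i, B i) →ₗ[k] (∀ i, A i) := LinearMap.pi fun i => Ψ i ∘ₗ LinearMap.proj i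
  have hΨ' : Function.Injective Ψ' := fun a b h =>
    funext fun i => hΨ i (congrFun h i)
  have h : Function.Surjective (Φ ∘ₗ Ψ') :=
    LinearMap.injective_iff_surjective.1 (hΦ.comp hΨ')
  exact Function.Surjective.of_comp (f := Φ) (g := Ψ') h

section Universal

set_option linter.unusedSectionVars false

variable {k : Type w} [Field k] [IsAlgClosed k] {C : Type u} [Category.{v} C] [Abelian C]
  [Linear k C] [MonoidalCategory C] [MonoidalPreadditive C] [MonoidalLinear k C]
  [RigidCategory C] [PivotalStructure C]

variable (k) in
theorem natural_family_ext [IsFusion k C] {ι : Type*} {V : ι → C} (hV : IsSimpleSystem V)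
    {W W' : C} {φ ψ : ∀ X, W ⊗ X ⟶ W' ⊗ X}
    (hφ : ∀ {X Y : C} (f : X ⟶ Y), W ◁ f ≫ φ Y = φ X ≫ W' ◁ f)
    (hψ : ∀ {X Y : C} (f : X ⟶ Y), W ◁ f ≫ ψ Y = ψ X ≫ W' ◁ f)
    (h : ∀ i, φ (V i) = ψ (V i)) (X : C) : φ X = ψ X := by
  obtain ⟨n, i, p, q, hpq⟩ := exists_sum_comp_eq_id k hV X
  rw [← Category.id_comp (φ X), ← Category.id_comp (ψ X), ← MonoidalCategory.whiskerLeft_id,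
    ← hpq]
  simp only [whiskerLeft_sum, Preadditive.sum_comp, MonoidalCategory.whiskerLeft_comp,
    Category.assoc, hφ, hψ, h]

variable [BraidedCategory C] {ι : Type*} [Fintype ι] [DecidableEq ι] {V : ι → C}

theorem sum_encircle_naturality {W W' : C} (g : ∀ l, W ⟶ dual (V l) ⊗ V l)
    (h : ∀ l, dual (V l) ⊗ V l ⟶ W') {X Y : C} (f : X ⟶ Y) :
    W ◁ f ≫ ∑ l, encircle (g l) (h l) Y = (∑ l, encircle (g l) (h l) X) ≫ W' ◁ f := by
  simp only [Preadditive.comp_sum, Preadditive.sum_comp, encircle_naturality]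

theorem exists_sum_encircle_ev_simple [IsFusion k C] (hsph : IsSpherical k C) (hV : IsSimpleSystem V)
    (hS : (sMatrix k V).det ≠ 0) {W : C} (φ : ∀ i, W ⊗ V i ⟶ 𝟙_ C ⊗ V i) :
    ∃ g : ∀ l, W ⟶ dual (V l) ⊗ V l, ∀ i, ∑ l, encircle (g l) (ev (V l)) (V i) = φ i := by
  let Φ : (∀ l, W ⟶ dual (V l) ⊗ V l) →ₗ[k] (∀ i, W ⊗ V i ⟶ 𝟙_ C ⊗ V i) :=
    { toFun := fun g i => ∑ l, encircle (g l) (ev (V l)) (V i)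
      map_add' := fun a b => by
        ext i
        simp [encircle, Finset.sum_add_distrib]
      map_smul' := fun c a => by
        ext i
        simp [encircle, Finset.smul_sum] }
  have hΦ : Function.Injective Φ := by
    rw [← LinearMap.ker_eq_bot, LinearMap.ker_eq_bot']
    intro g hg
    funext m
    exact eq_zero_of_encircle_ev hsph hV hS (fun i => congrFun hg i) m
  -- Duality and the braiding embed each target space into the matching source space, which supplies
  -- the dimension bound.
  let Ψ : ∀ i, (W ⊗ V i ⟶ 𝟙_ C ⊗ V i) →ₗ[k] (W ⟶ dual (V i) ⊗ V i) := fun i =>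
    { toFun := fun f => tensorRightHomEquiv W (V i) (dual (V i)) (V i) (f ≫ (λ_ _).hom) ≫
        (β_ _ _).hom
      map_add' := fun a b => by simp [tensorRightHomEquiv]
      map_smul' := fun c a => by simp [tensorRightHomEquiv] }
  have hΨ : ∀ i, Function.Injective (Ψ i) := by
    intro i a b hab
    have h1 := (cancel_mono _).1 hab
    have h2 := (tensorRightHomEquiv W (V i) (dual (V i)) (V i)).injective h1
    exact (cancel_mono _).1 h2
  have := fun i => IsFusion.finite_hom (k := k) (W ⊗ V i) (𝟙_ C ⊗ V i)
  obtain ⟨g, hg⟩ := surjective_of_injective_of_injective Ψ hΨ Φ hΦ φ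
  exact ⟨g, congrFun hg⟩

theorem exists_sum_encircle_ev [IsFusion k C] (hsph : IsSpherical k C) (hV : IsSimpleSystem V)
    (hS : (sMatrix k V).det ≠ 0) {W : C} (φ : ∀ X, W ⊗ X ⟶ 𝟙_ C ⊗ X)
    (hφ : ∀ {X Y : C} (f : X ⟶ Y), W ◁ f ≫ φ Y = φ X ≫ 𝟙_ C ◁ f) :
    ∃ g : ∀ l, W ⟶ dual (V l) ⊗ V l, ∀ X, ∑ l, encircle (g l) (ev (V l)) X = φ X := by
  obtain ⟨g, hg⟩ := exists_sum_encircle_ev_simple hsph hV hS fun i => φ (V i)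
  exact ⟨g, natural_family_ext k hV (fun f => sum_encircle_naturality _ _ f) hφ hg⟩

theorem exists_sum_encircle_coevPiv [IsFusion k C] (hsph : IsSpherical k C)
    (hV : IsSimpleSystem V) (hS : (sMatrix k V).det ≠ 0) {W : C} (φ : ∀ X, 𝟙_ C ⊗ X ⟶ W ⊗ X)
    (hφ : ∀ {X Y : C} (f : X ⟶ Y), 𝟙_ C ◁ f ≫ φ Y = φ X ≫ W ◁ f) :
    ∃ h : ∀ l, dual (V l) ⊗ V l ⟶ W, ∀ X, ∑ l, encircle (coevPiv (V l)) (h l) X = φ X := by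
  let Φ : (∀ l, dual (V l) ⊗ V l ⟶ W) →ₗ[k] (∀ i, 𝟙_ C ⊗ V i ⟶ W ⊗ V i) :=
    { toFun := fun g i => ∑ l, encircle (coevPiv (V l)) (g l) (V i)
      map_add' := fun a b => by
        ext i
        simp [encircle, Finset.sum_add_distrib]
      map_smul' := fun c a => by
        ext i
        simp [encircle, Finset.smul_sum] }
  have hΦ : Function.Injective Φ := by
    rw [← LinearMap.ker_eq_bot, LinearMap.ker_eq_bot']
    intro g hg
    funext m
    exact eq_zero_of_encircle_coevPiv hsph hV hS (fun i => congrFun hg i) m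
  let Ψ : ∀ i, (𝟙_ C ⊗ V i ⟶ W ⊗ V i) →ₗ[k] (dual (V i) ⊗ V i ⟶ W) := fun i =>
    { toFun := fun f => (β_ _ _).hom ≫
        (tensorRightHomEquiv (V i) (dual (V i)) (dual (dual (V i))) W).symm
          ((λ_ _).inv ≫ f ≫ W ◁ (PivotalStructure.piv (V i)).hom)
      map_add' := fun a b => by simp [tensorRightHomEquiv]
      map_smul' := fun c a => by simp [tensorRightHomEquiv] }
  have hΨ : ∀ i, Function.Injective (Ψ i) := by
    intro i a b hab
    have h1 := (cancel_epi _).1 hab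
    have h2 := (tensorRightHomEquiv (V i) (dual (V i)) (dual (dual (V i))) W).symm.injective h1
    exact (cancel_mono _).1 ((cancel_epi _).1 h2)
  have := fun i => IsFusion.finite_hom (k := k) (𝟙_ C ⊗ V i) (W ⊗ V i)
  obtain ⟨g, hg⟩ := surjective_of_injective_of_injective Ψ hΨ Φ hΦ (fun i => φ (V i))
  exact ⟨g, natural_family_ext k hV (fun f => sum_encircle_naturality _ _ f) hφ
    fun i => congrFun hg i⟩

end Universal

/-! ### Decompositions into the objects `V_l* ⊗ V_l`. -/

section ClassDecomposition

set_option linter.unusedSectionVars false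

variable {C : Type u} [Category.{v} C] [Preadditive C] [MonoidalCategory C]
  [MonoidalPreadditive C] [RigidCategory C] [BraidedCategory C]

/-- A decomposition of a half-braided object `A` with a morphism `e : A ⟶ 𝟙` into the objects
`V l* ⊗ V l` with their evaluations. -/
structure ClassDecomposition {ι : Type*} [Fintype ι] (V : ι → C) {A : C} (b : HalfBraiding A)
    (e : A ⟶ 𝟙_ C) where
  /-- the inclusions -/
  incl : ∀ l, dual (V l) ⊗ V l ⟶ A
  /-- the projections -/
  proj : ∀ l, A ⟶ dual (V l) ⊗ V l
  incl_proj_self : ∀ l, incl l ≫ proj l = 𝟙 _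
  incl_proj_ne : ∀ i j, i ≠ j → incl i ≫ proj j = 0
  sum_proj_incl : ∑ l, proj l ≫ incl l = 𝟙 A
  incl_comm : ∀ l U, incl l ▷ U ≫ (b.β U).hom = ((mixedTensor (dual (V l)) (V l)).β U).hom ≫
    U ◁ incl l
  proj_comm : ∀ l U, proj l ▷ U ≫ ((mixedTensor (dual (V l)) (V l)).β U).hom = (b.β U).hom ≫
    U ◁ proj l
  incl_counit : ∀ l, incl l ≫ e = ev (V l)

variable {ι : Type*} [Fintype ι] {V : ι → C} {A : C} {b : HalfBraiding A} {e : A ⟶ 𝟙_ C}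

namespace ClassDecomposition

variable (D : ClassDecomposition V b e)

theorem counit_eq : e = ∑ l, D.proj l ≫ ev (V l) := by
  have h : (∑ l, D.proj l ≫ D.incl l) ≫ e = ∑ l, D.proj l ≫ ev (V l) := by
    simp only [Preadditive.sum_comp, Category.assoc, D.incl_counit]
  rw [← h, D.sum_proj_incl, Category.id_comp]

theorem halfAct_eq (X : C) : halfAct b e X =
    ∑ l, D.proj l ▷ X ≫ halfAct (mixedTensor (dual (V l)) (V l)) (ev (V l)) X := by
  simp only [comp_halfAct _ b (D.proj_comm _)]
  have h : ∀ f, f = (∑ l, D.proj l ≫ ev (V l)) → halfAct b f X =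
      ∑ l, halfAct b (D.proj l ≫ ev (V l)) X := by
    rintro _ rfl
    simp [halfAct, whiskerLeft_sum, Preadditive.comp_sum]
  exact h e D.counit_eq

/-- It translates universality of `A` into statements about encircling by the components of `f`. -/
theorem comp_halfAct_eq {W : C} (f : W ⟶ A) (X : C) : f ▷ X ≫ halfAct b e X =
    (∑ l, encircle (f ≫ D.proj l) (ev (V l)) X) ≫ (λ_ X).hom ≫ (ρ_ X).inv := by
  rw [D.halfAct_eq]
  simp [halfAct_mixedTensor_of_comp, encircle, Preadditive.comp_sum, Preadditive.sum_comp]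

theorem hom_ext {W : C} {f g : W ⟶ A} (h : ∀ l, f ≫ D.proj l = g ≫ D.proj l) : f = g := by
  rw [← Category.comp_id f, ← Category.comp_id g, ← D.sum_proj_incl]
  simp only [Preadditive.comp_sum, reassoc_of% h]

theorem hom_ext' {W : C} {f g : A ⟶ W} (h : ∀ l, D.incl l ≫ f = D.incl l ≫ g) : f = g := by
  rw [← Category.id_comp f, ← Category.id_comp g, ← D.sum_proj_incl]
  simp only [Preadditive.sum_comp, Category.assoc, h]

/-- Class decompositions are transported along isomorphisms of half-braided objects. -/
def ofIso {A' : C} {b' : HalfBraiding A'} {e' : A' ⟶ 𝟙_ C} (f : A ⟶ A') (g : A' ⟶ A)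
    (hfg : f ≫ g = 𝟙 A) (hgf : g ≫ f = 𝟙 A')
    (hf : ∀ U, f ▷ U ≫ (b'.β U).hom = (b.β U).hom ≫ U ◁ f)
    (hg : ∀ U, g ▷ U ≫ (b.β U).hom = (b'.β U).hom ≫ U ◁ g)
    (he : f ≫ e' = e) : ClassDecomposition V b' e' where
  incl l := D.incl l ≫ f
  proj l := g ≫ D.proj l
  incl_proj_self l := by simp [reassoc_of% hfg, D.incl_proj_self]
  incl_proj_ne i j hij := by simp [reassoc_of% hfg, D.incl_proj_ne i j hij]
  sum_proj_incl := by
    have : ∀ l, (g ≫ D.proj l) ≫ D.incl l ≫ f = g ≫ (D.proj l ≫ D.incl l) ≫ f := by simp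
    simp only [this, ← Preadditive.comp_sum, ← Preadditive.sum_comp, D.sum_proj_incl]
    simp [hgf]
  incl_comm l U := by
    rw [comp_whiskerRight_assoc, hf, reassoc_of% (D.incl_comm l U),
      ← MonoidalCategory.whiskerLeft_comp]
  proj_comm l U := by
    rw [comp_whiskerRight_assoc, D.proj_comm, reassoc_of% (hg U),
      ← MonoidalCategory.whiskerLeft_comp]
  incl_counit l := by rw [Category.assoc, he, D.incl_counit]

end ClassDecomposition

end ClassDecomposition

/-! ### Existence of class decompositions, and their transport to `R(𝟙)`. -/

section Existence

set_option linter.unusedSectionVars false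

variable {k : Type w} [Field k] [IsAlgClosed k] {C : Type u} [Category.{v} C] [Abelian C]
  [Linear k C] [MonoidalCategory C] [MonoidalPreadditive C] [MonoidalLinear k C]
  [RigidCategory C] [PivotalStructure C] [BraidedCategory C]
  {ι : Type*} [Fintype ι] [DecidableEq ι] {V : ι → C}

/-- Existence is surjectivity of the encircling map on families of components, and uniqueness is its
injectivity. -/
theorem ClassDecomposition.isUniversalAction [IsFusion k C] (hsph : IsSpherical k C)
    (hV : IsSimpleSystem V) (hS : (sMatrix k V).det ≠ 0) {A : C} {b : HalfBraiding A}
    {e : A ⟶ 𝟙_ C} (D : ClassDecomposition V b e) : IsUniversalAction b e := by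
  intro W φ hφ
  obtain ⟨g, hg⟩ := exists_sum_encircle_ev hsph hV hS (fun X => φ X ≫ (ρ_ X).hom ≫ (λ_ X).inv) (by
    intro X Y f
    rw [reassoc_of% (hφ f)]
    simp)
  have hcomp : ∀ l, (∑ j, g j ≫ D.incl j) ≫ D.proj l = g l := by
    intro l
    rw [Preadditive.sum_comp, Finset.sum_eq_single l]
    · simp [D.incl_proj_self]
    · intro j _ hj
      simp [D.incl_proj_ne j l hj]
    · simp
  refine ⟨∑ l, g l ≫ D.incl l, fun X => ?_, fun f hf => ?_⟩
  · rw [D.comp_halfAct_eq]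
    simp only [hcomp, hg]
    simp
  · apply D.hom_ext
    intro l
    rw [hcomp, ← sub_eq_zero]
    have : ∀ i, ∑ l, encircle (f ≫ D.proj l - g l) (ev (V l)) (V i) = 0 := by
      intro i
      have h1 := hf (V i)
      rw [D.comp_halfAct_eq] at h1
      have h2 : (∑ l, encircle (f ≫ D.proj l) (ev (V l)) (V i)) =
          ∑ l, encircle (g l) (ev (V l)) (V i) := by
        rw [hg, ← h1]; simp
      have h3 : ∀ l, encircle (f ≫ D.proj l - g l) (ev (V l)) (V i) =
          encircle (f ≫ D.proj l) (ev (V l)) (V i) - encircle (g l) (ev (V l)) (V i) := by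
        intro l
        have : (f ≫ D.proj l - g l) ▷ V i = (f ≫ D.proj l) ▷ V i - g l ▷ V i :=
          (tensorRight (V i)).map_sub
        rw [encircle, encircle, encircle, this, Preadditive.sub_comp]
      simp only [h3, Finset.sum_sub_distrib, h2, sub_self]
    exact eq_zero_of_encircle_ev hsph hV hS this l

variable (V) in
theorem exists_classDecomposition : ∃ (A : C) (b : HalfBraiding A) (e : A ⟶ 𝟙_ C),
    Nonempty (ClassDecomposition V b e) := by
  have := Abelian.hasFiniteBiproducts (C := C)
  let P : ι → C := fun l => dual (V l) ⊗ V l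
  have htotal : ∑ j, biproduct.π P j ≫ biproduct.ι P j = 𝟙 (⨁ P) := by
    refine biproduct.hom_ext' _ _ fun i => ?_
    rw [Preadditive.comp_sum, Finset.sum_eq_single i]
    · simp
    · intro j _ hj
      simp [biproduct.ι_π_ne_assoc P hj.symm]
    · simp
  refine ⟨⨁ P, sumHalfBraiding (fun l => mixedTensor (dual (V l)) (V l)) (biproduct.ι P)
    (biproduct.π P) (fun j => biproduct.ι_π_self P j) (fun i j hij => biproduct.ι_π_ne P hij)
    htotal, ∑ l, biproduct.π P l ≫ ev (V l), ⟨?_⟩⟩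
  exact
    { incl := biproduct.ι P
      proj := biproduct.π P
      incl_proj_self := fun j => biproduct.ι_π_self P j
      incl_proj_ne := fun i j hij => biproduct.ι_π_ne P hij
      sum_proj_incl := htotal
      incl_comm := fun l U => incl_sumHalfBraiding _ _ _ _ _ _ l U
      proj_comm := fun l U => sumHalfBraiding_proj
        (fun l => mixedTensor (dual (V l)) (V l)) _ _ _ _ _ l U
      incl_counit := fun l => by
        rw [Preadditive.comp_sum, Finset.sum_eq_single l]
        · simp [P]
        · intro j _ hj
          simp [P, biproduct.ι_π_ne_assoc P hj.symm]
        · simp }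

theorem forget_isLeftAdjoint_of_isFusion [IsFusion k C] (hsph : IsSpherical k C)
    (hV : IsSimpleSystem V) (hS : (sMatrix k V).det ≠ 0) : (Center.forget C).IsLeftAdjoint := by
  obtain ⟨A, b, e, ⟨D⟩⟩ := exists_classDecomposition V
  exact forget_isLeftAdjoint (D.isUniversalAction hsph hV hS)

/-- Universal arrows are unique up to isomorphism, so the decomposition of the explicit biproduct
carries over to any other one, in particular to `R(𝟙)` for an arbitrary right adjoint `R`. -/
theorem exists_classDecomposition_of_terminal [IsFusion k C] (hsph : IsSpherical k C)
    (hV : IsSimpleSystem V) (hS : (sMatrix k V).det ≠ 0) {A : C} {b : HalfBraiding A}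
    {e : A ⟶ 𝟙_ C} (h : ∀ (N : C) (c : HalfBraiding N) (n : N ⟶ 𝟙_ C), ∃! f : N ⟶ A,
      (∀ X, f ▷ X ≫ (b.β X).hom = (c.β X).hom ≫ X ◁ f) ∧ f ≫ e = n) :
    Nonempty (ClassDecomposition V b e) := by
  obtain ⟨A', b', e', ⟨D⟩⟩ := exists_classDecomposition V
  have hA := D.isUniversalAction hsph hV hS
  obtain ⟨f, ⟨hf, hfe⟩, -⟩ := h A' b' e'
  obtain ⟨g, ⟨hg, hge⟩, -⟩ := hA.existsUnique_hom b e
  refine ⟨D.ofIso f g ?_ ?_ hf hg hfe⟩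
  · refine (hA.existsUnique_hom b' e').unique ⟨fun X => ?_, by rw [Category.assoc, hge, hfe]⟩
      ⟨fun X => by simp, by simp⟩
    rw [comp_whiskerRight_assoc, hg, reassoc_of% (hf X), ← MonoidalCategory.whiskerLeft_comp]
  · refine (h A b e).unique ⟨fun X => ?_, by rw [Category.assoc, hfe, hge]⟩
      ⟨fun X => by simp, by simp⟩
    rw [comp_whiskerRight_assoc, hf, reassoc_of% (hg X), ← MonoidalCategory.whiskerLeft_comp]

/-- The half-braiding of the adjoint algebra. -/
def adjBraiding (R : C ⥤ Center C) : HalfBraiding (adjAlg R) := (R.obj (𝟙_ C)).2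

theorem existsUnique_hom_adjAlg {R : C ⥤ Center C} (adj : Center.forget C ⊣ R) (N : C)
    (c : HalfBraiding N) (n : N ⟶ 𝟙_ C) : ∃! f : N ⟶ adjAlg R,
      (∀ X, f ▷ X ≫ ((adjBraiding R).β X).hom = (c.β X).hom ≫ X ◁ f) ∧ f ≫ counit adj = n := by
  let M : Center C := ⟨N, c⟩
  let n' : (Center.forget C).obj M ⟶ 𝟙_ C := n
  refine ⟨(adj.homEquiv M (𝟙_ C) n').f, ⟨(adj.homEquiv M (𝟙_ C) n').comm, ?_⟩, ?_⟩
  · exact (adj.homEquiv_counit (X := M) (g := adj.homEquiv M (𝟙_ C) n')).symm.trans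
      (Equiv.symm_apply_apply _ _)
  · rintro f ⟨hf, hf'⟩
    let f' : M ⟶ R.obj (𝟙_ C) := ⟨f, hf⟩
    have : f' = adj.homEquiv M (𝟙_ C) n' := by
      rw [← Equiv.symm_apply_eq, adj.homEquiv_counit]
      exact hf'
    exact congrArg Center.Hom.f this

theorem exists_classDecomposition_adjAlg [IsFusion k C] (hsph : IsSpherical k C)
    (hV : IsSimpleSystem V) (hS : (sMatrix k V).det ≠ 0) {R : C ⥤ Center C}
    (adj : Center.forget C ⊣ R) :
    Nonempty (ClassDecomposition V (adjBraiding R) (counit adj)) :=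
  exists_classDecomposition_of_terminal hsph hV hS (existsUnique_hom_adjAlg adj)

end Existence

/-! ### Coactions defined by elements of half-braided objects. -/

section Coaction

set_option linter.unusedSectionVars false

variable {C : Type u} [Category.{v} C] [MonoidalCategory C] [RigidCategory C]
  [BraidedCategory C]

theorem mixedTensor_hom_eq (X Y Z : C) :
    ((mixedTensor X Y).β Z).hom =
      (α_ _ _ _).hom ≫ X ◁ clasp Y Z ≫ (α_ _ _ _).inv ≫ (β_ Z (X ⊗ Y)).inv := by
  rw [mixedTensor_hom, BraidedCategory.braiding_tensor_right_inv, clasp]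
  simp

/-- The family `X ⟶ X ⊗ B` defined by an element `𝟙 ⟶ B` of a half-braided object. -/
def halfCoact {B : C} (b : HalfBraiding B) (s : 𝟙_ C ⟶ B) (X : C) : 𝟙_ C ⊗ X ⟶ X ⊗ B :=
  s ▷ X ≫ (b.β X).hom

theorem halfCoact_mixedTensor {X Y W : C} (s : 𝟙_ C ⟶ X ⊗ Y) (h : X ⊗ Y ⟶ W) (Z : C) :
    halfCoact (mixedTensor X Y) s Z ≫ Z ◁ h = encircle s h Z ≫ (β_ Z W).inv := by
  rw [halfCoact, mixedTensor_hom_eq, encircle]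
  simp

theorem halfCoact_comp {A B : C} (a : HalfBraiding A) (b : HalfBraiding B) (s : 𝟙_ C ⟶ A)
    {f : A ⟶ B} (hf : ∀ X, f ▷ X ≫ (b.β X).hom = (a.β X).hom ≫ X ◁ f) (X : C) :
    halfCoact a s X ≫ X ◁ f = halfCoact b (s ≫ f) X := by
  simp [halfCoact, hf]

theorem halfCoact_naturality {B : C} (b : HalfBraiding B) (s : 𝟙_ C ⟶ B) {X Y : C} (f : X ⟶ Y) :
    𝟙_ C ◁ f ≫ halfCoact b s Y = halfCoact b s X ≫ f ▷ B := by
  rw [halfCoact, whisker_exchange_assoc, b.naturality, halfCoact, Category.assoc]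

theorem halfCoact_tensor {B : C} (b : HalfBraiding B) (s : 𝟙_ C ⟶ B) (X Y : C) :
    halfCoact b s (X ⊗ Y) = (α_ _ _ _).inv ≫ halfCoact b s X ▷ Y ≫ (α_ _ _ _).hom ≫
      X ◁ (b.β Y).hom ≫ (α_ _ _ _).inv := by
  rw [halfCoact, b.monoidal, halfCoact]
  monoidal

end Coaction

/-! ### The dual universal property, and simplicity of the summands in the center. -/

section Simplicity

set_option linter.unusedSectionVars false

variable {k : Type w} [Field k] [IsAlgClosed k] {C : Type u} [Category.{v} C] [Abelian C]
  [Linear k C] [MonoidalCategory C] [MonoidalPreadditive C] [MonoidalLinear k C]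
  [RigidCategory C] [PivotalStructure C] [BraidedCategory C]
  {ι : Type*} [Fintype ι] [DecidableEq ι] {V : ι → C}

theorem encircle_sub {W W' X' X : C} (g : W ⟶ X' ⊗ X) (h h' : X' ⊗ X ⟶ W') (Z : C) :
    encircle g (h - h') Z = encircle g h Z - encircle g h' Z := by
  have : (h - h') ▷ Z = h ▷ Z - h' ▷ Z := (tensorRight Z).map_sub
  simp [encircle, this, Preadditive.comp_sub]

theorem halfCoact_hom_ext [IsFusion k C] (hsph : IsSpherical k C) (hV : IsSimpleSystem V)
    (hS : (sMatrix k V).det ≠ 0) {W : C} {h h' : ∀ l, dual (V l) ⊗ V l ⟶ W}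
    (H : ∀ Z, ∑ l, halfCoact (mixedTensor (dual (V l)) (V l)) (coevPiv (V l)) Z ≫ Z ◁ h l =
      ∑ l, halfCoact (mixedTensor (dual (V l)) (V l)) (coevPiv (V l)) Z ≫ Z ◁ h' l) (m : ι) :
    h m = h' m := by
  rw [← sub_eq_zero]
  refine eq_zero_of_encircle_coevPiv (h := fun l => h l - h' l) hsph hV hS (fun i => ?_) m
  have h1 := H (V i)
  simp only [halfCoact_mixedTensor, ← Preadditive.sum_comp, cancel_mono] at h1
  simp only [encircle_sub, Finset.sum_sub_distrib, h1, sub_self]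

theorem halfCoact_hom_ext_tensor [IsFusion k C] (hsph : IsSpherical k C) (hV : IsSimpleSystem V)
    (hS : (sMatrix k V).det ≠ 0) {W U : C} {h h' : ∀ l, (dual (V l) ⊗ V l) ⊗ U ⟶ W}
    (H : ∀ Z, ∑ l, halfCoact (mixedTensor (dual (V l)) (V l)) (coevPiv (V l)) Z ▷ U ≫
        (α_ _ _ _).hom ≫ Z ◁ h l =
      ∑ l, halfCoact (mixedTensor (dual (V l)) (V l)) (coevPiv (V l)) Z ▷ U ≫
        (α_ _ _ _).hom ≫ Z ◁ h' l) (m : ι) :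
    h m = h' m := by
  apply (tensorRightHomEquiv _ U (dual U) W).injective
  refine halfCoact_hom_ext (h := fun l => tensorRightHomEquiv _ U (dual U) W (h l))
    (h' := fun l => tensorRightHomEquiv _ U (dual U) W (h' l)) hsph hV hS (fun Z => ?_) m
  have key : ∀ (l : ι) (h : (dual (V l) ⊗ V l) ⊗ U ⟶ W),
      halfCoact (mixedTensor (dual (V l)) (V l)) (coevPiv (V l)) Z ≫
        Z ◁ tensorRightHomEquiv _ U (dual U) W h =
      (ρ_ _).inv ≫ (𝟙_ C ⊗ Z) ◁ coev U ≫ (α_ _ _ _).inv ≫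
        (halfCoact (mixedTensor (dual (V l)) (V l)) (coevPiv (V l)) Z ▷ U ≫
        (α_ _ _ _).hom ≫ Z ◁ h) ▷ dual U ≫ (α_ _ _ _).hom := by
    intro l h
    simp only [tensorRightHomEquiv, Equiv.coe_fn_mk]
    calc _ = 𝟙 _ ⊗≫ (halfCoact (mixedTensor (dual (V l)) (V l)) (coevPiv (V l)) Z ▷ 𝟙_ C ≫
          (Z ⊗ dual (V l) ⊗ V l) ◁ coev U) ⊗≫ Z ◁ h ▷ dual U ⊗≫ 𝟙 _ := by monoidal
      _ = _ := by rw [← whisker_exchange]; monoidal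
  simp only [key, ← Preadditive.comp_sum, ← Preadditive.sum_comp, ← sum_whiskerRight, H]

/-- Mirror image of universality: the objects `V_l* ⊗ V_l` with their pivotal coevaluations generate
freely, so that an element of any half-braided object extends to half-braided morphisms out of them.
-/
theorem exists_halfCoact_hom [IsFusion k C] (hsph : IsSpherical k C) (hV : IsSimpleSystem V)
    (hS : (sMatrix k V).det ≠ 0) {N : C} (c : HalfBraiding N) (s : 𝟙_ C ⟶ N) :
    ∃ h : ∀ l, dual (V l) ⊗ V l ⟶ N,
      (∀ l U, h l ▷ U ≫ (c.β U).hom = ((mixedTensor (dual (V l)) (V l)).β U).hom ≫ U ◁ h l) ∧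
      ∑ l, coevPiv (V l) ≫ h l = s := by
  obtain ⟨h, hh⟩ := exists_sum_encircle_coevPiv hsph hV hS
    (fun X => halfCoact c s X ≫ (β_ X N).hom) (by
      intro X Y f
      rw [reassoc_of% (halfCoact_naturality c s f), BraidedCategory.braiding_naturality_left]
      simp)
  have key : ∀ Z, ∑ l, halfCoact (mixedTensor (dual (V l)) (V l)) (coevPiv (V l)) Z ≫ Z ◁ h l =
      halfCoact c s Z := by
    intro Z
    simp only [halfCoact_mixedTensor, ← Preadditive.sum_comp, hh]
    simp
  refine ⟨h, fun l U => ?_, ?_⟩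
  -- Compatibility with the half-braidings is tested by coacting on `Z`; by the hexagon both sides
  -- become the coaction on `Z ⊗ U`.
  · refine halfCoact_hom_ext_tensor (h := fun l => h l ▷ U ≫ (c.β U).hom)
      (h' := fun l => ((mixedTensor (dual (V l)) (V l)).β U).hom ≫ U ◁ h l) hsph hV hS
      (fun Z => ?_) l
    have h1 : ∀ l, halfCoact (mixedTensor (dual (V l)) (V l)) (coevPiv (V l)) Z ▷ U ≫
        (α_ _ _ _).hom ≫ Z ◁ (h l ▷ U ≫ (c.β U).hom) =
        (halfCoact (mixedTensor (dual (V l)) (V l)) (coevPiv (V l)) Z ≫ Z ◁ h l) ▷ U ≫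
          (α_ _ _ _).hom ≫ Z ◁ (c.β U).hom := by
      intro l; monoidal
    have h2 : ∀ l, halfCoact (mixedTensor (dual (V l)) (V l)) (coevPiv (V l)) Z ▷ U ≫
        (α_ _ _ _).hom ≫ Z ◁ (((mixedTensor (dual (V l)) (V l)).β U).hom ≫ U ◁ h l) =
        (α_ _ _ _).hom ≫ (halfCoact (mixedTensor (dual (V l)) (V l)) (coevPiv (V l)) (Z ⊗ U) ≫
          (Z ⊗ U) ◁ h l) ≫ (α_ _ _ _).hom := by
      intro l
      rw [halfCoact_tensor]; monoidal
    simp only [h1, h2, ← Preadditive.comp_sum, ← Preadditive.sum_comp, ← sum_whiskerRight, key]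
    rw [halfCoact_tensor]
    simp
  · have h1 := key (𝟙_ C)
    have h2 : ∀ {B : C} (b : HalfBraiding B) (s : 𝟙_ C ⟶ B),
        halfCoact b s (𝟙_ C) = (ρ_ _).hom ≫ s ≫ (λ_ _).inv := by
      intro B b s
      rw [halfCoact, halfBraiding_unit]
      simp
    simp only [h2] at h1
    rw [← cancel_epi (ρ_ (𝟙_ C)).hom, ← cancel_mono (λ_ N).inv, Category.assoc, Category.assoc,
      ← h1]
    simp [Preadditive.comp_sum, Preadditive.sum_comp]

/-- A half-braided morphism into the universal object is determined by its composite with the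
counit, which on the `l`-th summand is the evaluation. -/
theorem hom_eq_zero_of_comp_ev [IsFusion k C] (hsph : IsSpherical k C) (hV : IsSimpleSystem V)
    (hS : (sMatrix k V).det ≠ 0) {N : C} {c : HalfBraiding N} {l : ι} {f : N ⟶ dual (V l) ⊗ V l}
    (hf : ∀ X, f ▷ X ≫ ((mixedTensor (dual (V l)) (V l)).β X).hom = (c.β X).hom ≫ X ◁ f)
    (h : f ≫ ev (V l) = 0) : f = 0 := by
  obtain ⟨A, b, e, ⟨D⟩⟩ := exists_classDecomposition V
  have hA := D.isUniversalAction hsph hV hS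
  have h1 : f ≫ D.incl l = 0 := by
    refine hA.hom_ext fun X => ?_
    rw [comp_halfAct b c (f := f ≫ D.incl l), Category.assoc, D.incl_counit, h]
    · simp [halfAct]
    · intro X
      rw [comp_whiskerRight_assoc, D.incl_comm, reassoc_of% (hf X),
        ← MonoidalCategory.whiskerLeft_comp]
  rw [← Category.comp_id f, ← D.incl_proj_self, reassoc_of% h1, zero_comp]

variable (k) in
theorem exists_smul_coevPiv [IsFusion k C] {X : C} [Simple X] (s : 𝟙_ C ⟶ dual X ⊗ X) :
    ∃ c : k, s = c • coevPiv X := by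
  have := simple_dual k X
  obtain ⟨c, hc⟩ := exists_smul_id k ((λ_ _).inv ≫
    (s ▷ dual X ≫ (α_ _ _ _).hom ≫ dual X ◁ evPiv X) ≫ (ρ_ _).hom)
  refine ⟨c, whiskerRight_evPiv_injective ?_⟩
  have h2 := comp_evPiv_zigzag X
  have h3 : coevPiv X ▷ dual X ≫ (α_ _ _ _).hom ≫ dual X ◁ evPiv X =
      (λ_ _).hom ≫ (ρ_ _).inv := by
    rw [← cancel_epi (λ_ (dual X)).inv, ← cancel_mono (ρ_ (dual X)).hom]
    simpa [monoidalComp, coevPiv] using h2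
  rw [smul_whiskerRight, Linear.smul_comp, h3, ← cancel_mono (ρ_ (dual X)).hom,
    ← cancel_epi (λ_ (dual X)).inv]
  simp only [Category.assoc] at hc ⊢
  rw [hc]
  simp

/-- The object `X* ⊗ X` of the center, where `X*` carries the inverse of the braiding. -/
def classObj (X : C) : Center C := ⟨dual X ⊗ X, mixedTensor (dual X) X⟩

/-- Since `f ≫ ev` is nonzero, it has a section `s`, and `s ≫ f` is a nonzero multiple `a` of the
coevaluation. Extending `s` to half-braided morphisms `g m` and composing with `f` gives `a` times
the identity on the `l`-th object, by uniqueness of the extension. -/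
theorem exists_comp_eq_smul_id [IsFusion k C] (hsph : IsSpherical k C) (hV : IsSimpleSystem V)
    (hS : (sMatrix k V).det ≠ 0) {N : C} {c : HalfBraiding N} {l : ι} {f : N ⟶ dual (V l) ⊗ V l}
    (hf : ∀ X, f ▷ X ≫ ((mixedTensor (dual (V l)) (V l)).β X).hom = (c.β X).hom ≫ X ◁ f)
    (h : f ≠ 0) : ∃ g : dual (V l) ⊗ V l ⟶ N,
      (∀ X, g ▷ X ≫ (c.β X).hom = ((mixedTensor (dual (V l)) (V l)).β X).hom ≫ X ◁ g) ∧
      g ≫ f = 𝟙 _ := by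
  have := hV.simple l
  have := simple_unit k C
  obtain ⟨s, hs⟩ := exists_section_of_simple k (f ≫ ev (V l)) fun h0 =>
    h (hom_eq_zero_of_comp_ev hsph hV hS hf h0)
  obtain ⟨a, ha⟩ := exists_smul_coevPiv k (s ≫ f)
  have ha0 : a ≠ 0 := by
    rintro rfl
    rw [zero_smul] at ha
    rw [reassoc_of% ha, zero_comp] at hs
    exact unit_id_ne_zero k C hs.symm
  obtain ⟨g, hg, hgs⟩ := exists_halfCoact_hom hsph hV hS c s
  have key : g l ≫ f = a • 𝟙 _ := by
    -- The comparison family is `a` times the identity at `m = l` and zero elsewhere; it extends the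
    -- same element `a • coevPiv (V l)`.
    have h1 := halfCoact_hom_ext (h := fun m => g m ≫ f)
      (h' := fun m => if h : m = l then a • eqToHom (by rw [h]) else 0) hsph hV hS (fun Z => ?_) l
    · simpa using h1
    · have h2 : ∀ m, halfCoact (mixedTensor (dual (V m)) (V m)) (coevPiv (V m)) Z ≫
          Z ◁ (g m ≫ f) = halfCoact (mixedTensor (dual (V l)) (V l))
            ((coevPiv (V m) ≫ g m) ≫ f) Z := by
        intro m
        rw [halfCoact_comp (hf := fun X => ?_), Category.assoc]
        rw [comp_whiskerRight_assoc, hf, reassoc_of% (hg m X),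
          ← MonoidalCategory.whiskerLeft_comp]
      simp only [h2]
      have h3 : ∑ m, halfCoact (mixedTensor (dual (V l)) (V l)) ((coevPiv (V m) ≫ g m) ≫ f) Z =
          halfCoact (mixedTensor (dual (V l)) (V l)) ((∑ m, coevPiv (V m) ≫ g m) ≫ f) Z := by
        simp [halfCoact, Preadditive.sum_comp, sum_whiskerRight]
      rw [h3, hgs, ha, Finset.sum_eq_single l]
      · simp [halfCoact]
      · intro m _ hm
        simp [hm]
      · simp
  refine ⟨a⁻¹ • g l, fun X => ?_, ?_⟩
  · simp [hg]
  · rw [Linear.smul_comp, key, smul_smul, inv_mul_cancel₀ ha0, one_smul]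

theorem simple_classObj [IsFusion k C] (hsph : IsSpherical k C) (hV : IsSimpleSystem V)
    (hS : (sMatrix k V).det ≠ 0) (l : ι) : Simple (classObj (V l)) where
  mono_isIso_iff_nonzero {Y} f _ := by
    constructor
    · rintro hf rfl
      have h1 : 𝟙 (classObj (V l)) = 0 := by
        rw [← IsIso.inv_hom_id (0 : Y ⟶ classObj (V l)), comp_zero]
      have h2 : 𝟙 (dual (V l) ⊗ V l) = 0 := congrArg Center.Hom.f h1
      have := hV.simple l
      apply ev_ne_zero k (V l)
      rw [← Category.id_comp (ev (V l)), h2, zero_comp]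
    · intro hf
      obtain ⟨g, hg, hgf⟩ := exists_comp_eq_smul_id (c := Y.2) (f := f.f) hsph hV hS f.comm
        (fun h => hf (Center.ext _ _ h))
      let g' : classObj (V l) ⟶ Y := ⟨g, hg⟩
      have : IsSplitEpi f := ⟨⟨⟨g', Center.ext _ _ hgf⟩⟩⟩
      exact isIso_of_mono_of_isSplitEpi f

end Simplicity

/-! ### The action of the adjoint algebra, central elements and integrals. -/

section AdjointAlgebra

set_option linter.unusedSectionVars false

variable {C : Type u} [Category.{v} C] [MonoidalCategory C] [RigidCategory C]
  {R : C ⥤ Center C} (adj : Center.forget C ⊣ R)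

theorem whiskerLeft_whiskerRight_unit {A B : C} (a : 𝟙_ C ⟶ B) (X : C) :
    (ρ_ A).inv ▷ X ≫ (A ◁ a) ▷ X ≫ (α_ A B X).hom = A ◁ ((λ_ X).inv ≫ a ▷ X) := by
  monoidal

theorem action_eq (X : C) :
    action adj X = halfAct (adjBraiding R) (counit adj) X ≫ (ρ_ X).hom := by
  rw [halfAct, Category.assoc]; rfl

theorem action_naturality {X Y : C} (f : X ⟶ Y) :
    adjAlg R ◁ f ≫ action adj Y = action adj X ≫ f := by
  rw [action_eq, action_eq, reassoc_of% (halfAct_naturality (adjBraiding R) (counit adj) f),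
    rightUnitor_naturality, Category.assoc]

theorem action_unit : action adj (𝟙_ C) = (ρ_ _).hom ≫ counit adj := by
  rw [action_eq, halfAct_unit, Category.assoc, Category.assoc, ← unitors_equal, Iso.inv_hom_id,
    Category.comp_id]

theorem whiskerRight_action {N : C} (c : HalfBraiding N) {f : N ⟶ adjAlg R}
    (hf : ∀ X, f ▷ X ≫ ((adjBraiding R).β X).hom = (c.β X).hom ≫ X ◁ f) (X : C) :
    f ▷ X ≫ action adj X = (c.β X).hom ≫ X ◁ (f ≫ counit adj) ≫ (ρ_ X).hom := by
  rw [action_eq, reassoc_of% (comp_halfAct (adjBraiding R) c hf (counit adj) X), halfAct,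
    Category.assoc]

theorem algUnit_counit : algUnit adj ≫ counit adj = 𝟙 (𝟙_ C) :=
  (adj.homEquiv_counit (X := 𝟙_ (Center C)) (g := adj.homEquiv (𝟙_ (Center C)) (𝟙_ C)
    (𝟙 (𝟙_ C)))).symm.trans (Equiv.symm_apply_apply _ _)

theorem algMul_counit : algMul adj ≫ counit adj =
    (counit adj ⊗ₘ counit adj) ≫ (λ_ (𝟙_ C)).hom :=
  (adj.homEquiv_counit (X := R.obj (𝟙_ C) ⊗ R.obj (𝟙_ C))
    (g := adj.homEquiv (R.obj (𝟙_ C) ⊗ R.obj (𝟙_ C)) (𝟙_ C)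
      ((counit adj ⊗ₘ counit adj) ≫ (λ_ (𝟙_ C)).hom))).symm.trans (Equiv.symm_apply_apply _ _)

/-- The half-braiding of the square of the adjoint algebra. -/
def adjBraidingSq (R : C ⥤ Center C) : HalfBraiding (adjAlg R ⊗ adjAlg R) :=
  (R.obj (𝟙_ C) ⊗ R.obj (𝟙_ C)).2

theorem adjBraidingSq_hom (X : C) : ((adjBraidingSq R).β X).hom =
    (α_ _ _ _).hom ≫ adjAlg R ◁ ((adjBraiding R).β X).hom ≫ (α_ _ _ _).inv ≫
      ((adjBraiding R).β X).hom ▷ adjAlg R ≫ (α_ _ _ _).hom := rfl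

theorem algMul_comm (X : C) : algMul adj ▷ X ≫ ((adjBraiding R).β X).hom =
    ((adjBraidingSq R).β X).hom ≫ X ◁ algMul adj :=
  (adj.homEquiv (R.obj (𝟙_ C) ⊗ R.obj (𝟙_ C)) (𝟙_ C)
    ((counit adj ⊗ₘ counit adj) ≫ (λ_ (𝟙_ C)).hom)).comm X

/-- The action of a half-braided morphism depends only on its composite with the counit, and the
product corresponds to `ε ⊗ ε`. So multiplication in `A` acts by composition. -/
theorem algMul_action (X : C) : algMul adj ▷ X ≫ action adj X =
    (α_ _ _ _).hom ≫ adjAlg R ◁ action adj X ≫ action adj X := by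
  rw [whiskerRight_action adj (adjBraidingSq R) (algMul_comm adj), algMul_counit,
    adjBraidingSq_hom, action_eq, halfAct]
  have h : X ◁ ((counit adj ⊗ₘ counit adj) ≫ (λ_ (𝟙_ C)).hom) ≫ (ρ_ X).hom =
      (α_ _ _ _).inv ≫ ((X ⊗ adjAlg R) ◁ counit adj) ≫ (ρ_ _).hom ≫ X ◁ counit adj ≫
        (ρ_ X).hom := by
    rw [MonoidalCategory.tensorHom_def']
    monoidal
  rw [h]
  generalize (adjBraiding R).β X = c
  generalize counit adj = e
  calc _ = 𝟙 _ ⊗≫ adjAlg R ◁ c.hom ⊗≫ (c.hom ▷ adjAlg R ≫ (X ⊗ adjAlg R) ◁ e) ⊗≫ X ◁ e ⊗≫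
        𝟙 _ := by monoidal
    _ = _ := by rw [← whisker_exchange]; monoidal

/-- The half-braiding of the unit object. -/
def unitHalfBraiding (C : Type u) [Category.{v} C] [MonoidalCategory C] : HalfBraiding (𝟙_ C) :=
  (𝟙_ (Center C)).2

theorem unitHalfBraiding_hom (X : C) :
    ((unitHalfBraiding C).β X).hom = (λ_ X).hom ≫ (ρ_ X).inv := rfl

theorem algUnit_action (X : C) : algUnit adj ▷ X ≫ action adj X = (λ_ X).hom := by
  have h := whiskerRight_action adj (unitHalfBraiding C) (f := algUnit adj)
    (adj.homEquiv (𝟙_ (Center C)) (𝟙_ C) (𝟙 (𝟙_ C))).comm X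
  rw [h, algUnit_counit, unitHalfBraiding_hom]
  simp

theorem centralToEnd_app (a : 𝟙_ C ⟶ adjAlg R) (X : C) :
    (centralToEnd adj a).app X = (λ_ X).inv ≫ a ▷ X ≫ action adj X := rfl

theorem centralToEnd_app_unit (a : 𝟙_ C ⟶ adjAlg R) :
    (centralToEnd adj a).app (𝟙_ C) = a ≫ counit adj := by
  rw [centralToEnd_app, action_unit, rightUnitor_naturality_assoc]
  simp [unitors_inv_equal]

variable (hA : IsUniversalAction (adjBraiding R) (counit adj))
include hA

theorem action_hom_ext {W : C} {f g : W ⟶ adjAlg R}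
    (h : ∀ X, f ▷ X ≫ action adj X = g ▷ X ≫ action adj X) : f = g :=
  hA.hom_ext fun X => by
    have := h X
    rw [action_eq, ← Category.assoc, ← Category.assoc] at this
    exact (cancel_mono _).1 this

theorem exists_action_eq {W : C} (φ : ∀ X, W ⊗ X ⟶ X)
    (hφ : ∀ {X Y : C} (f : X ⟶ Y), W ◁ f ≫ φ Y = φ X ≫ f) :
    ∃ f : W ⟶ adjAlg R, ∀ X, f ▷ X ≫ action adj X = φ X := by
  obtain ⟨f, hf, -⟩ := hA W (fun X => φ X ≫ (ρ_ X).inv) (by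
    intro X Y f
    rw [reassoc_of% (hφ f)]
    simp)
  refine ⟨f, fun X => ?_⟩
  rw [action_eq, reassoc_of% (hf X)]
  simp

/-- This is universality of the action for `W = 𝟙`. -/
theorem centralToEnd_bijective : Function.Bijective (centralToEnd adj) := by
  constructor
  · intro a a' h
    refine action_hom_ext adj hA fun X => ?_
    have := NatTrans.congr_app h X
    rwa [centralToEnd_app, centralToEnd_app, cancel_epi] at this
  · intro ξ
    obtain ⟨f, hf⟩ := exists_action_eq adj hA (W := 𝟙_ C) (fun X => (λ_ X).hom ≫ ξ.app X) (by
      intro X Y f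
      have := ξ.naturality f
      simp only [Functor.id_obj, Functor.id_map] at this
      rw [leftUnitor_naturality_assoc, this, Category.assoc])
    refine ⟨f, ?_⟩
    ext X
    rw [centralToEnd_app, hf]
    simp

theorem isNormalizedIntegral_iff (a : 𝟙_ C ⟶ adjAlg R) : IsNormalizedIntegral adj a ↔
    (∀ X, adjAlg R ◁ (centralToEnd adj a).app X ≫ action adj X =
      counit adj ▷ X ≫ (λ_ X).hom ≫ (centralToEnd adj a).app X) ∧
    (centralToEnd adj a).app (𝟙_ C) = 𝟙 _ := by
  have h1 : ∀ X, ((ρ_ _).inv ≫ adjAlg R ◁ a ≫ algMul adj) ▷ X ≫ action adj X =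
      adjAlg R ◁ (centralToEnd adj a).app X ≫ action adj X := by
    intro X
    rw [centralToEnd_app, comp_whiskerRight, comp_whiskerRight, Category.assoc, Category.assoc,
      algMul_action, reassoc_of% (whiskerLeft_whiskerRight_unit a X)]
    simp only [MonoidalCategory.whiskerLeft_comp, Category.assoc]
  have h2 : ∀ X, (counit adj ≫ a) ▷ X ≫ action adj X =
      counit adj ▷ X ≫ (λ_ X).hom ≫ (centralToEnd adj a).app X := by
    intro X
    rw [centralToEnd_app]
    simp
  rw [IsNormalizedIntegral, centralToEnd_app_unit]
  refine and_congr_left fun _ => ⟨fun h X => ?_, fun h => action_hom_ext adj hA fun X => ?_⟩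
  · rw [← h1, ← h2, h]
  · rw [h1, h2, h]

/-- Feeding `a'` into the integral equation of `a` shows that their composite is `a`; exchanging
roles it is `a'`. Natural endomorphisms of the identity commute. -/
theorem isNormalizedIntegral_unique {a a' : 𝟙_ C ⟶ adjAlg R} (h : IsNormalizedIntegral adj a)
    (h' : IsNormalizedIntegral adj a') : a = a' := by
  have key : ∀ {a a' : 𝟙_ C ⟶ adjAlg R}, IsNormalizedIntegral adj a →
      IsNormalizedIntegral adj a' →
      ∀ X, (centralToEnd adj a').app X ≫ (centralToEnd adj a).app X =
        (centralToEnd adj a).app X := by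
    intro a a' h h' X
    have h1 := ((isNormalizedIntegral_iff adj hA a).1 h).1 X
    have h2 := congrArg (fun f => (λ_ X).inv ≫ a' ▷ X ≫ f) h1
    rw [action_naturality, ← comp_whiskerRight_assoc, h'.2] at h2
    rw [centralToEnd_app adj a', Category.assoc, Category.assoc]
    refine h2.trans ?_
    simp
  apply (centralToEnd_bijective adj hA).1
  ext X
  have h3 := (centralToEnd adj a).naturality ((centralToEnd adj a').app X)
  simp only [Functor.id_obj, Functor.id_map] at h3
  rw [← key h h' X, h3, key h' h X]

end AdjointAlgebra

/-! ### Hopf links as actions. -/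

section HopfLinks

set_option linter.unusedSectionVars false

variable {C : Type u} [Category.{v} C] [MonoidalCategory C] [RigidCategory C]
  {R : C ⥤ Center C} (adj : Center.forget C ⊣ R)

theorem comp_univDinat {W : C} (f : W ⟶ adjAlg R) (X X' : C) [ExactPairing X X'] :
    f ≫ univDinat adj X X' =
      (ρ_ _).inv ≫ W ◁ η_ X X' ≫ (α_ _ _ _).inv ≫ (f ▷ X ≫ action adj X) ▷ X' := by
  rw [univDinat, rightUnitor_inv_naturality_assoc, ← whisker_exchange_assoc,
    associator_inv_naturality_left_assoc, ← comp_whiskerRight]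

theorem univDinat_hom_ext (hA : IsUniversalAction (adjBraiding R) (counit adj)) {W : C}
    {f g : W ⟶ adjAlg R}
    (h : ∀ X : C, f ≫ univDinat adj X (dual X) = g ≫ univDinat adj X (dual X)) : f = g := by
  refine action_hom_ext adj hA fun X => ?_
  have h1 := h X
  rw [comp_univDinat, comp_univDinat, cancel_epi] at h1
  apply (tensorRightHomEquiv W X (dual X) X).injective
  simpa [tensorRightHomEquiv] using h1

variable [BraidedCategory C]

/-- The action of `dual Y ⊗ Y` on `X` by the Hopf link. -/
def hopfAct (Y X : C) : (dual Y ⊗ Y) ⊗ X ⟶ X :=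
  encircle (𝟙 _) (ev Y) X ≫ (λ_ X).hom

theorem comp_hopfAct {W : C} (Y X : C) (f : W ⟶ dual Y ⊗ Y) :
    f ▷ X ≫ hopfAct Y X = encircle f (ev Y) X ≫ (λ_ X).hom := by
  simp [hopfAct, encircle]

theorem hopfAct_naturality (Y : C) {X X' : C} (f : X ⟶ X') :
    (dual Y ⊗ Y) ◁ f ≫ hopfAct Y X' = hopfAct Y X ≫ f := by
  rw [hopfAct, reassoc_of% (encircle_naturality (𝟙 (dual Y ⊗ Y)) (ev Y) f),
    leftUnitor_naturality, hopfAct, Category.assoc]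

theorem hopfLink_eq (X Y : C) : hopfLink X Y =
    (ρ_ _).inv ≫ (dual Y ⊗ Y) ◁ coev X ≫ (α_ _ _ _).inv ≫ hopfAct Y X ▷ dual X := by
  rw [hopfAct, encircle, clasp, hopfLink]
  monoidal

theorem hopfAct_dinatural {Y Y' : C} (f : Y ⟶ Y') (X : C) :
    (dual Y' ◁ f) ▷ X ≫ hopfAct Y' X = (dualMap f ▷ Y) ▷ X ≫ hopfAct Y X := by
  have h : dual Y' ◁ f ≫ ev Y' = dualMap f ▷ Y ≫ ev Y := (rightAdjointMate_comp_evaluation f).symm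
  rw [comp_hopfAct, comp_hopfAct, encircle, encircle]
  congr 1
  calc _ = 𝟙 _ ⊗≫ dual Y' ◁ (f ▷ X ≫ clasp Y' X) ⊗≫ ev Y' ▷ X := by monoidal
    _ = 𝟙 _ ⊗≫ dual Y' ◁ clasp Y X ⊗≫ (dual Y' ◁ f ≫ ev Y') ▷ X := by
      rw [clasp_naturality_left]; monoidal
    _ = 𝟙 _ ⊗≫ (dual Y' ◁ clasp Y X ≫ dualMap f ▷ (Y ⊗ X)) ⊗≫ ev Y ▷ X := by
      rw [h]; monoidal
    _ = _ := by rw [whisker_exchange]; monoidal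

variable [PivotalStructure C]

theorem hopfLink_evPiv (X Y : C) :
    hopfLink X Y ≫ evPiv X = dual Y ◁ (ring X).app Y ≫ ev Y := by
  dsimp only [ring, partialTrace, hopfLink, Functor.id_obj]
  calc _ = 𝟙 _ ⊗≫ (dual Y ⊗ Y) ◁ coev X ⊗≫ dual Y ◁ clasp Y X ▷ dual X ⊗≫
        (ev Y ▷ (X ⊗ dual X) ≫ 𝟙_ C ◁ evPiv X) ⊗≫ 𝟙 _ := by rw [clasp]; monoidal
    _ = _ := by rw [← whisker_exchange]; monoidal

theorem comp_hopfAct_eq_leftRing {Y : C} (q : 𝟙_ C ⟶ dual Y ⊗ Y) (X : C) :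
    (λ_ X).inv ≫ q ▷ X ≫ hopfAct Y X = (leftRing q).app X := by
  dsimp only [leftRing, leftPartialTrace, Functor.id_obj]
  rw [comp_hopfAct, encircle]
  monoidal

end HopfLinks

/-! ### Class functions, characters and the integral. -/

section ClassFunctions

set_option linter.unusedSectionVars false

variable {k : Type w} [Field k] [IsAlgClosed k] {C : Type u} [Category.{v} C] [Abelian C]
  [Linear k C] [MonoidalCategory C] [MonoidalPreadditive C] [MonoidalLinear k C]
  [RigidCategory C] [PivotalStructure C] [BraidedCategory C]
  {ι : Type*} [Fintype ι] [DecidableEq ι] {V : ι → C}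

section General

variable {A : C} {b : HalfBraiding A} {e : A ⟶ 𝟙_ C} (D : ClassDecomposition V b e)

/-- The class function which is the evaluation on the `l`-th summand. -/
def ClassDecomposition.classFun (l : ι) : A ⟶ 𝟙_ C := D.proj l ≫ ev (V l)

theorem ClassDecomposition.incl_sum_classFun (c : ι → k) (l : ι) :
    D.incl l ≫ ∑ m, c m • D.classFun m = c l • ev (V l) := by
  rw [Preadditive.comp_sum, Finset.sum_eq_single l]
  · rw [Linear.comp_smul, classFun, reassoc_of% (D.incl_proj_self l)]
  · intro m _ hm
    rw [Linear.comp_smul, classFun, reassoc_of% (D.incl_proj_ne l m hm.symm), zero_comp, smul_zero]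
  · simp

theorem ClassDecomposition.eq_sum_classFun_iff (f : A ⟶ 𝟙_ C) (c : ι → k) :
    f = ∑ m, c m • D.classFun m ↔ ∀ l, D.incl l ≫ f = c l • ev (V l) := by
  constructor
  · rintro rfl l
    exact D.incl_sum_classFun c l
  · intro h
    exact D.hom_ext' fun l => by rw [h, D.incl_sum_classFun]

variable (k) in
theorem ClassDecomposition.exists_eq_sum_classFun [IsFusion k C] (hV : IsSimpleSystem V)
    (f : A ⟶ 𝟙_ C) : ∃ c : ι → k, f = ∑ m, c m • D.classFun m := by
  have := hV.simple
  have h : ∀ l, ∃ c : k, D.incl l ≫ f = c • ev (V l) := by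
    intro l
    obtain ⟨g, hg⟩ := exists_whiskerLeft_comp_counit (X := V l) (X' := dual (V l)) (D.incl l ≫ f)
    obtain ⟨c, rfl⟩ := exists_smul_id k g
    exact ⟨c, by rw [← hg]; simp⟩
  choose c hc using h
  exact ⟨c, (D.eq_sum_classFun_iff f c).2 hc⟩

theorem ClassDecomposition.sum_classFun_injective [IsFusion k C] (hV : IsSimpleSystem V)
    {c c' : ι → k} (h : ∑ m, c m • D.classFun m = ∑ m, c' m • D.classFun m) : c = c' := by
  funext l
  have := hV.simple l
  have h1 := congrArg (D.incl l ≫ ·) h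
  simp only [D.incl_sum_classFun] at h1
  by_contra hne
  rw [← sub_eq_zero, ← sub_smul] at h1
  exact ev_ne_zero k (V l) ((smul_eq_zero_iff_right (sub_ne_zero.2 hne)).1 h1)

end General

variable {R : C ⥤ Center C} {adj : Center.forget C ⊣ R}
  (D : ClassDecomposition V (adjBraiding R) (counit adj))

theorem ClassDecomposition.incl_action (l : ι) (X : C) :
    D.incl l ▷ X ≫ action adj X = hopfAct (V l) X := by
  rw [whiskerRight_action adj _ (D.incl_comm l), D.incl_counit, hopfAct]
  have h := halfAct_mixedTensor_of_comp (ev (V l)) X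
  rw [halfAct] at h
  rw [reassoc_of% h, encircle]
  simp

theorem ClassDecomposition.incl_univDinat (l : ι) (X : C) :
    D.incl l ≫ univDinat adj X (dual X) = hopfLink X (V l) := by
  rw [comp_univDinat, D.incl_action, hopfLink_eq]

/-- Restricted to the `l`-th summand, the universal map of `V i` is a Hopf link; the pivotal
evaluation closes it to a loop `V i` around `V l`, which is a scalar. -/
theorem ClassDecomposition.character_eq [IsFusion k C] (hV : IsSimpleSystem V) (i : ι) :
    character adj (V i) = ∑ l, ringMatrix k V i l • D.classFun l := by
  rw [D.eq_sum_classFun_iff]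
  intro l
  have := hV.simple l
  rw [character, ← Category.assoc, D.incl_univDinat, hopfLink_evPiv]
  have h : (ring (V i)).app (V l) = ringMatrix k V i l • 𝟙 (V l) := natScalar_spec _ _
  rw [h]
  simp

variable (adj) in
-- The integral is the central element acting as `K`. Since `K` factors through copies of `𝟙`, on
-- which `A` acts by the counit, the integral equation holds.
theorem exists_isNormalizedIntegral [IsFusion k C] (hV : IsSimpleSystem V)
    (hS : (sMatrix k V).det ≠ 0) (hA : IsUniversalAction (adjBraiding R) (counit adj)) :
    ∃ a, IsNormalizedIntegral adj a ∧ IsUnitProjector (centralToEnd adj a) := by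
  obtain ⟨y, hy⟩ := exists_ring_combination (k := k) hV hS
  have hK := isUnitProjector_sum_ring hV hy
  obtain ⟨a, ha⟩ := (centralToEnd_bijective adj hA).2 (∑ i, y i • ring (V i))
  rw [← ha] at hK
  refine ⟨a, (isNormalizedIntegral_iff adj hA a).2 ⟨fun X => ?_, hK.app_unit⟩, hK⟩
  obtain ⟨n, p, q, hpq⟩ := hK.exists_eq_sum k X
  rw [hpq]
  simp only [whiskerLeft_sum, Preadditive.comp_sum, Preadditive.sum_comp]
  refine Finset.sum_congr rfl fun j _ => ?_
  have h := action_naturality adj (p j)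
  rw [action_unit] at h
  refine (action_naturality adj (p j ≫ q j)).trans ?_
  rw [← Category.assoc, ← h, Category.assoc, Category.assoc, ← leftUnitor_naturality_assoc,
    ← whisker_exchange_assoc, unitors_equal, rightUnitor_naturality_assoc]

end ClassFunctions

/-! ### Cointegrals and endomorphisms of `R(𝟙)`. -/

section Cointegrals

set_option linter.unusedSectionVars false

variable {k : Type w} [Field k] [IsAlgClosed k] {C : Type u} [Category.{v} C] [Abelian C]
  [Linear k C] [MonoidalCategory C] [MonoidalPreadditive C] [MonoidalLinear k C]
  [RigidCategory C] [PivotalStructure C] [BraidedCategory C]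
  {ι : Type*} [Fintype ι] [DecidableEq ι] {V : ι → C}
  {R : C ⥤ Center C} (adj : Center.forget C ⊣ R)

/-- The endomorphism of `A` which corresponds to a class function under `Hom(A, 𝟙) = End(R(𝟙))`. -/
def centralHat (f : adjAlg R ⟶ 𝟙_ C) : adjAlg R ⟶ adjAlg R :=
  comult adj ≫ (Center.forget C).map (R.map f)

theorem centralHat_eq {f : adjAlg R ⟶ 𝟙_ C} {g : adjAlg R ⟶ adjAlg R}
    (hg : ∀ X, g ▷ X ≫ ((adjBraiding R).β X).hom = ((adjBraiding R).β X).hom ≫ X ◁ g)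
    (h : g ≫ counit adj = f) : centralHat adj f = g := by
  let g' : R.obj (𝟙_ C) ⟶ R.obj (𝟙_ C) := ⟨g, hg⟩
  have h1 : g' = adj.homEquiv (R.obj (𝟙_ C)) (𝟙_ C) f := by
    rw [← Equiv.symm_apply_eq, adj.homEquiv_counit]
    exact h
  have h2 : (adj.homEquiv (R.obj (𝟙_ C)) (𝟙_ C) f).f = centralHat adj f := by
    rw [adj.homEquiv_unit, centralHat, comult]
    rfl
  rw [← h2, ← h1]

variable {adj} (D : ClassDecomposition V (adjBraiding R) (counit adj))

theorem ClassDecomposition.centralHat_sum (c : ι → k) :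
    centralHat adj (∑ l, c l • D.classFun l) = ∑ l, c l • (D.proj l ≫ D.incl l) := by
  refine centralHat_eq adj (fun X => ?_) ?_
  · simp only [sum_whiskerRight, whiskerLeft_sum, Preadditive.comp_sum, Preadditive.sum_comp,
      MonoidalLinear.smul_whiskerRight, MonoidalLinear.whiskerLeft_smul, Linear.comp_smul,
      Linear.smul_comp]
    refine Finset.sum_congr rfl fun l _ => ?_
    rw [comp_whiskerRight_assoc, D.incl_comm, reassoc_of% (D.proj_comm l X),
      ← MonoidalCategory.whiskerLeft_comp]
  · simp only [Preadditive.sum_comp, Linear.smul_comp, Category.assoc, D.incl_counit, classFun]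

theorem ClassDecomposition.centralHat_classFun (l : ι) :
    centralHat adj (D.classFun l) = D.proj l ≫ D.incl l := by
  refine centralHat_eq adj (fun X => ?_) ?_
  · rw [comp_whiskerRight_assoc, D.incl_comm, reassoc_of% (D.proj_comm l X),
      ← MonoidalCategory.whiskerLeft_comp]
  · rw [Category.assoc, D.incl_counit, classFun]

theorem centralHat_counit [IsFusion k C] (hV : IsSimpleSystem V)
    (D : ClassDecomposition V (adjBraiding R) (counit adj)) (f : adjAlg R ⟶ 𝟙_ C) :
    centralHat adj f ≫ counit adj = f := by
  obtain ⟨c, rfl⟩ := D.exists_eq_sum_classFun k hV f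
  rw [D.centralHat_sum]
  simp only [Preadditive.sum_comp, Linear.smul_comp, Category.assoc, D.incl_counit,
    ClassDecomposition.classFun]

theorem centralHat_comm [IsFusion k C] (hV : IsSimpleSystem V)
    (D : ClassDecomposition V (adjBraiding R) (counit adj)) (f g : adjAlg R ⟶ 𝟙_ C) :
    centralHat adj f ≫ centralHat adj g = centralHat adj g ≫ centralHat adj f := by
  obtain ⟨c, rfl⟩ := D.exists_eq_sum_classFun k hV f
  obtain ⟨c', rfl⟩ := D.exists_eq_sum_classFun k hV g
  have key : ∀ c c' : ι → k, (∑ l, c l • (D.proj l ≫ D.incl l)) ≫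
      (∑ l, c' l • (D.proj l ≫ D.incl l)) = ∑ l, (c l * c' l) • (D.proj l ≫ D.incl l) := by
    intro c c'
    rw [Preadditive.sum_comp]
    refine Finset.sum_congr rfl fun l _ => ?_
    rw [Preadditive.comp_sum, Finset.sum_eq_single l]
    · simp [reassoc_of% (D.incl_proj_self l), smul_smul, mul_comm]
    · intro m _ hm
      simp [reassoc_of% (D.incl_proj_ne l m hm.symm)]
    · simp
  rw [D.centralHat_sum, D.centralHat_sum, key, key]
  simp only [mul_comm]

/-- The double braiding with an object isomorphic to `𝟙` is trivial, so the Hopf link action of this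
summand is plain evaluation. -/
theorem ClassDecomposition.ev_algUnit (hA : IsUniversalAction (adjBraiding R) (counit adj))
    {o : ι} (e : 𝟙_ C ≅ V o) : ev (V o) ≫ algUnit adj = D.incl o := by
  refine action_hom_ext adj hA fun X => ?_
  have h : clasp (V o) X = 𝟙 _ := by
    rw [← cancel_epi (e.hom ▷ X), clasp_naturality_left, clasp_unit_left, Category.id_comp,
      Category.comp_id]
  rw [D.incl_action, comp_whiskerRight_assoc, algUnit_action, hopfAct, encircle, h]
  simp

variable (k) in
-- The endomorphism belonging to this class function is the projector onto the unit summand, which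
-- factors through the unit of `A` by `ev_algUnit`.
theorem ClassDecomposition.isNormalizedCointegral [IsFusion k C] (hV : IsSimpleSystem V)
    (hA : IsUniversalAction (adjBraiding R) (counit adj)) :
    IsNormalizedCointegral adj (D.classFun (unitIndex k hV)) := by
  have h := D.ev_algUnit hA (unitIndexIso k hV)
  have := hV.simple (unitIndex k hV)
  constructor
  · refine (D.centralHat_classFun _).trans ?_
    rw [classFun, Category.assoc, h]
  · obtain ⟨q, hq⟩ := exists_section_ev k (V (unitIndex k hV))
    rw [← Category.id_comp (algUnit adj ≫ _), ← hq, Category.assoc, ← Category.assoc (ev _), h,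
      classFun, reassoc_of% (D.incl_proj_self (unitIndex k hV))]

variable (k) in
-- Same pattern as for integrals: the composite of the two endomorphisms is the first of them, and
-- they commute because they are combinations of orthogonal projectors.
theorem isNormalizedCointegral_unique [IsFusion k C] (hV : IsSimpleSystem V)
    (D : ClassDecomposition V (adjBraiding R) (counit adj)) {l l' : adjAlg R ⟶ 𝟙_ C}
    (h : IsNormalizedCointegral adj l) (h' : IsNormalizedCointegral adj l') : l = l' := by
  have key : ∀ {l l' : adjAlg R ⟶ 𝟙_ C}, IsNormalizedCointegral adj l →
      IsNormalizedCointegral adj l' →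
      centralHat adj l ≫ centralHat adj l' = centralHat adj l := by
    intro l l' h h'
    have h1 : centralHat adj l = l ≫ algUnit adj := h.1
    have h2 : centralHat adj l' = l' ≫ algUnit adj := h'.1
    rw [h1, h2, Category.assoc, reassoc_of% h'.2]
  rw [← centralHat_counit (k := k) hV D l, ← centralHat_counit (k := k) hV D l', ← key h h',
    centralHat_comm (k := k) hV D, key h' h]

end Cointegrals

/-! ### Central elements acting on characters, and the antipode. -/

section Fourier

set_option linter.unusedSectionVars false

variable {k : Type w} [Field k] [IsAlgClosed k] {C : Type u} [Category.{v} C] [Abelian C]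
  [Linear k C] [MonoidalCategory C] [MonoidalPreadditive C] [MonoidalLinear k C]
  [RigidCategory C] [PivotalStructure C] [BraidedCategory C]
  {ι : Type*} [Fintype ι] [DecidableEq ι] {V : ι → C}
  {R : C ⥤ Center C} (adj : Center.forget C ⊣ R)

theorem actRight_character (X : C) (a : 𝟙_ C ⟶ adjAlg R) :
    actRight adj (character adj X) a = (ρ_ _).inv ≫ adjAlg R ◁ coev X ≫ (α_ _ _ _).inv ≫
      (action adj X ≫ (centralToEnd adj a).app X) ▷ dual X ≫ evPiv X := by
  rw [actRight, character, ← Category.assoc (algMul adj), comp_univDinat, algMul_action,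
    centralToEnd_app]
  generalize action adj X = t
  generalize adjAlg R = A at *
  calc _ = 𝟙 _ ⊗≫ (a ▷ (A ⊗ 𝟙_ C) ≫ A ◁ (A ◁ coev X)) ⊗≫ A ◁ t ▷ dual X ⊗≫ t ▷ dual X ⊗≫
        evPiv X := by monoidal
    _ = 𝟙 _ ⊗≫ A ◁ coev X ⊗≫ (a ▷ ((A ⊗ X) ⊗ dual X) ≫ A ◁ (t ▷ dual X)) ⊗≫ t ▷ dual X ⊗≫
        evPiv X := by rw [← whisker_exchange]; monoidal
    _ = _ := by rw [← whisker_exchange]; monoidal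

theorem actRight_sum {J : Type*} (s : Finset J) (c : J → k) (f : J → (adjAlg R ⟶ 𝟙_ C))
    (a : 𝟙_ C ⟶ adjAlg R) :
    actRight adj (∑ j ∈ s, c j • f j) a = ∑ j ∈ s, c j • actRight adj (f j) a := by
  simp only [actRight, Preadditive.comp_sum, Linear.comp_smul]

/-- Multiplication acts by composition, so the central element appears as an endomorphism inside the
trace over `X`, where it is a scalar. -/
theorem actRight_character_simple [IsFusion k C] (X : C) [Simple X] (a : 𝟙_ C ⟶ adjAlg R) :
    actRight adj (character adj X) a = natScalar k (centralToEnd adj a) X • character adj X := by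
  rw [actRight_character]
  have h : (centralToEnd adj a).app X = natScalar k (centralToEnd adj a) X • 𝟙 X :=
    natScalar_spec _ _
  rw [h, character, univDinat]
  simp only [Linear.comp_smul, smul_whiskerRight, Linear.smul_comp, Category.assoc]
  congr 4
  exact congrArg (fun t => t ▷ dual X ≫ evPiv X) (Category.comp_id _)

/-- The two duals of an object are isomorphic. -/
def predualIso (X : C) : (ᘁX : C) ≅ dual X :=
  PivotalStructure.piv (ᘁX : C) ≪≫
    dualIso (rightDualIso (X := (ᘁX : C)) (Y₁ := X) (Y₂ := dual (ᘁX : C)) inferInstance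
      inferInstance)

variable (k) in
theorem simple_predual [IsFusion k C] (X : C) [Simple X] : Simple (ᘁX : C) :=
  have := simple_dual k X
  Simple.of_iso (predualIso X)

variable (k) in
theorem natScalar_endDual [IsFusion k C] (hV : IsSimpleSystem V) (ξ : 𝟭 C ⟶ 𝟭 C) (i : ι) :
    natScalar k (endDual ξ) (V i) = natScalar k ξ (V (dualIndex k hV i)) := by
  have := hV.simple
  have := simple_predual k (V i)
  rw [← natScalar_congr ξ (predualIso (V i) ≪≫ dualIndexIso k hV i)]
  apply natScalar_eq
  have h : ξ.app (ᘁ(V i)) = natScalar k ξ (ᘁ(V i)) • 𝟙 (ᘁ(V i)) := natScalar_spec _ _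
  have h1 : (endDual ξ).app (V i) = transposePredual (ξ.app (ᘁ(V i))) := rfl
  have h2 : ∀ c : k, transposePredual (c • 𝟙 (ᘁ(V i))) = c • transposePredual (𝟙 (ᘁ(V i))) := by
    intro c
    simp [transposePredual, rightAdjointMate]
  have h3 : transposePredual (𝟙 (ᘁ(V i))) = 𝟙 (V i) := by
    rw [transposePredual]
    exact @rightAdjointMate_id C _ _ (ᘁ(V i)) hasRightDualLeftDual
  rw [h1, h, h2, h3]

variable (k) in
-- As `centralToEnd` is bijective, the `Function.invFun` in `antipode` is its true inverse, and
-- transposition reads scalars off the dual object.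
theorem natScalar_antipode [IsFusion k C] (hV : IsSimpleSystem V)
    (hA : IsUniversalAction (adjBraiding R) (counit adj)) (a : 𝟙_ C ⟶ adjAlg R) (i : ι) :
    natScalar k (centralToEnd adj (antipode adj a)) (V i) =
      natScalar k (centralToEnd adj a) (V (dualIndex k hV i)) := by
  rw [antipode, Function.rightInverse_invFun (centralToEnd_bijective adj hA).2,
    natScalar_endDual k hV]

end Fourier

/-! ### The Fourier transform in terms of characters. -/

section FourierTransform

set_option linter.unusedSectionVars false

variable {k : Type w} [Field k] [IsAlgClosed k] {C : Type u} [Category.{v} C] [Abelian C]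
  [Linear k C] [MonoidalCategory C] [MonoidalPreadditive C] [MonoidalLinear k C]
  [RigidCategory C] [PivotalStructure C] [BraidedCategory C]
  {ι : Type*} [Fintype ι] [DecidableEq ι] {V : ι → C}

/-- Loops span all functions on simple objects; the coefficients come from the orthogonality
relation. -/
theorem exists_natScalar_eq [IsFusion k C] (hsph : IsSpherical k C) (hV : IsSimpleSystem V)
    (hS : (sMatrix k V).det ≠ 0) (a : ι → k) :
    ∃ ξ : 𝟭 C ⟶ 𝟭 C, ∀ j, natScalar k ξ (V j) = a j := by
  obtain ⟨-, -, -, horth⟩ := globalDim_ne_zero hsph hV hS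
  refine ⟨∑ i, (∑ l, a l * (qdim k (V l) * qdim k (V l) / globalDim k V *
    ringMatrix k V i (dualIndex k hV l))) • ring (V i), fun j => ?_⟩
  have := hV.simple j
  rw [natScalar_sum]
  simp only [Finset.sum_mul]
  rw [Finset.sum_comm]
  calc _ = ∑ l, a l * (qdim k (V l) * qdim k (V l) / globalDim k V *
        ∑ i, ringMatrix k V i (dualIndex k hV l) * ringMatrix k V i j) := by
        refine Finset.sum_congr rfl fun l _ => ?_
        rw [Finset.mul_sum, Finset.mul_sum]
        refine Finset.sum_congr rfl fun i _ => ?_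
        rw [ringMatrix, Matrix.of_apply, Matrix.of_apply]
        ring
    _ = a j := by
        simp [horth]

theorem IsUnitProjector.natScalar_eq [IsFusion k C] (hV : IsSimpleSystem V) {K : 𝟭 C ⟶ 𝟭 C}
    (hK : IsUnitProjector K) (j : ι) :
    natScalar k K (V j) = if j = unitIndex k hV then 1 else 0 := by
  have := hV.simple
  have := simple_unit k C
  split_ifs with h
  · subst h
    rw [← natScalar_congr K (unitIndexIso k hV)]
    apply ModularFusion.natScalar_eq
    rw [hK.app_unit, one_smul]
  · apply ModularFusion.natScalar_eq
    rw [hK.app_simple _ (hV.simple j)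
      ⟨fun e => h (hV.eq_of_iso _ _ ⟨e ≪≫ unitIndexIso k hV⟩)⟩, zero_smul]

variable {R : C ⥤ Center C} {adj : Center.forget C ⊣ R}

theorem comp_character (a : 𝟙_ C ⟶ adjAlg R) (X : C) :
    a ≫ character adj X = pivTrace ((centralToEnd adj a).app X) := by
  rw [character, ← Category.assoc, comp_univDinat, centralToEnd_app, pivTrace]
  simp only [comp_whiskerRight, Category.assoc]
  generalize action adj X = t
  generalize adjAlg R = A at *
  monoidal

theorem pairing_character [IsFusion k C] (a : 𝟙_ C ⟶ adjAlg R) (X : C) [Simple X] :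
    pairing k (character adj X) a = natScalar k (centralToEnd adj a) X * qdim k X := by
  rw [pairing, comp_character, natScalar_spec (k := k) (centralToEnd adj a) X]
  exact pivTrace_smul_id _ _

theorem pairing_sum [IsFusion k C] {J : Type*} (s : Finset J) (c : J → k)
    (f : J → (adjAlg R ⟶ 𝟙_ C)) (a : 𝟙_ C ⟶ adjAlg R) :
    pairing k (∑ j ∈ s, c j • f j) a = ∑ j ∈ s, c j * pairing k (f j) a := by
  simp only [pairing, Preadditive.comp_sum, Linear.comp_smul, unitScalar_sum, unitScalar_smul]

variable (D : ClassDecomposition V (adjBraiding R) (counit adj))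

theorem ClassDecomposition.sum_character [IsFusion k C] (hV : IsSimpleSystem V) (t : ι → k) :
    ∑ i, t i • character adj (V i) = ∑ l, (∑ i, t i * ringMatrix k V i l) • D.classFun l := by
  simp only [D.character_eq (k := k) hV, Finset.smul_sum, smul_smul, Finset.sum_smul]
  exact Finset.sum_comm

theorem ClassDecomposition.classFun_unitIndex [IsFusion k C] (hsph : IsSpherical k C)
    (hV : IsSimpleSystem V) (hS : (sMatrix k V).det ≠ 0) : D.classFun (unitIndex k hV) =
      ∑ i, (qdim k (V i) / globalDim k V) • character adj (V i) := by
  obtain ⟨-, -, hy, -⟩ := globalDim_ne_zero hsph hV hS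
  rw [D.sum_character hV]
  simp [hy]

theorem ClassDecomposition.classFun_eq [IsFusion k C] (hsph : IsSpherical k C)
    (hV : IsSimpleSystem V) (hS : (sMatrix k V).det ≠ 0) (l : ι) : D.classFun l =
      ∑ i, (qdim k (V l) * qdim k (V l) / globalDim k V *
        ringMatrix k V i (dualIndex k hV l)) • character adj (V i) := by
  obtain ⟨-, -, -, horth⟩ := globalDim_ne_zero hsph hV hS
  rw [D.sum_character hV]
  simp only [mul_assoc, ← Finset.mul_sum]
  simp [horth]

theorem ClassDecomposition.fourier_eq [IsFusion k C] (hsph : IsSpherical k C)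
    (hV : IsSimpleSystem V) (hS : (sMatrix k V).det ≠ 0)
    (hA : IsUniversalAction (adjBraiding R) (counit adj)) (a : 𝟙_ C ⟶ adjAlg R) :
    fourier adj (D.classFun (unitIndex k hV)) a =
      ∑ j, (qdim k (V j) / globalDim k V *
        natScalar k (centralToEnd adj a) (V (dualIndex k hV j))) • character adj (V j) := by
  have := hV.simple
  rw [fourier, D.classFun_unitIndex hsph hV hS, actRight_sum]
  refine Finset.sum_congr rfl fun j _ => ?_
  rw [actRight_character_simple (k := k), natScalar_antipode k adj hV hA, smul_smul]

theorem ClassDecomposition.fourier_bijective [IsFusion k C] (hsph : IsSpherical k C)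
    (hV : IsSimpleSystem V) (hS : (sMatrix k V).det ≠ 0)
    (hA : IsUniversalAction (adjBraiding R) (counit adj)) :
    Function.Bijective (fourier adj (D.classFun (unitIndex k hV))) := by
  have h0 := (globalDim_ne_zero hsph hV hS).1
  have hd := qdim_ne_zero hsph hV hS
  have hy : ∀ j, qdim k (V j) / globalDim k V ≠ 0 := fun j => div_ne_zero (hd j) h0
  have := hV.simple
  constructor
  · intro a a' h
    rw [D.fourier_eq hsph hV hS hA, D.fourier_eq hsph hV hS hA, D.sum_character hV,
      D.sum_character hV] at h
    have h1 := D.sum_classFun_injective hV h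
    have h2 := Matrix.vecMul_injective_of_isUnit (A := ringMatrix k V)
      ((Matrix.isUnit_iff_isUnit_det _).2 (det_ringMatrix_ne_zero hV hS).isUnit) h1
    apply (centralToEnd_bijective adj hA).1
    refine natTrans_ext k hV fun i => ?_
    have h3 := mul_left_cancel₀ (hy _) (congrFun h2 (dualIndex k hV i))
    rw [dualIndex_dualIndex] at h3
    rw [natScalar_spec (k := k) (centralToEnd adj a), natScalar_spec (k := k) (centralToEnd adj a'),
      h3]
  · intro f
    obtain ⟨c, rfl⟩ := D.exists_eq_sum_classFun k hV f
    have h1 : ∃ t : ι → k, ∑ m, c m • D.classFun m = ∑ i, t i • character adj (V i) := by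
      refine ⟨Matrix.vecMul c (ringMatrix k V)⁻¹, ?_⟩
      rw [D.sum_character hV]
      refine Finset.sum_congr rfl fun l _ => ?_
      congr 1
      have h2 : Matrix.vecMul (Matrix.vecMul c (ringMatrix k V)⁻¹) (ringMatrix k V) = c := by
        rw [Matrix.vecMul_vecMul, Matrix.nonsing_inv_mul _ (det_ringMatrix_ne_zero hV hS).isUnit,
          Matrix.vecMul_one]
      exact (congrFun h2 l).symm
    obtain ⟨t, ht⟩ := h1
    obtain ⟨ξ, hξ⟩ := exists_natScalar_eq hsph hV hS (fun i => t (dualIndex k hV i) /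
      (qdim k (V (dualIndex k hV i)) / globalDim k V))
    obtain ⟨a, rfl⟩ := (centralToEnd_bijective adj hA).2 ξ
    refine ⟨a, ?_⟩
    rw [D.fourier_eq hsph hV hS hA, ht]
    refine Finset.sum_congr rfl fun j _ => ?_
    rw [hξ, dualIndex_dualIndex, mul_div_cancel₀ _ (hy j)]

/-- Comparing coefficients of characters leaves `d_i r_{i* j*} d_j = d_i² r_{j i}`, which follows
from the duality and the symmetry of the loop matrix. -/
theorem ClassDecomposition.fourier_eq_classFun [IsFusion k C] (hsph : IsSpherical k C)
    (hV : IsSimpleSystem V) (hS : (sMatrix k V).det ≠ 0)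
    (hA : IsUniversalAction (adjBraiding R) (counit adj)) {a : 𝟙_ C ⟶ adjAlg R} {i : ι}
    (ha : ∀ m, natScalar k (centralToEnd adj a) (V m) = ringMatrix k V (dualIndex k hV i) m) :
    qdim k (V i) • fourier adj (D.classFun (unitIndex k hV)) a =
      D.classFun (dualIndex k hV i) := by
  obtain ⟨-, hdual, -, -⟩ := globalDim_ne_zero hsph hV hS
  rw [D.fourier_eq hsph hV hS hA, D.classFun_eq hsph hV hS, Finset.smul_sum]
  refine Finset.sum_congr rfl fun j _ => ?_
  rw [smul_smul, ha, hdual, dualIndex_dualIndex, dualIndex_dualIndex, qdim_dualIndex hsph]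
  congr 1
  have := ringMatrix_symm (k := k) hV i j
  calc _ = qdim k (V i) / globalDim k V * (ringMatrix k V i j * qdim k (V j)) := by ring
    _ = _ := by rw [this]; ring

/-- The integral sees only the unit object, so only its character contributes when `F_l` is expanded
in characters. -/
theorem ClassDecomposition.pairing_classFun [IsFusion k C] (hsph : IsSpherical k C)
    (hV : IsSimpleSystem V) (hS : (sMatrix k V).det ≠ 0) {Λ : 𝟙_ C ⟶ adjAlg R}
    (hΛ : IsUnitProjector (centralToEnd adj Λ)) (l : ι) :
    pairing k (D.classFun l) Λ = qdim k (V l) * qdim k (V l) / globalDim k V := by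
  have := hV.simple
  rw [D.classFun_eq hsph hV hS, pairing_sum, Finset.sum_eq_single (unitIndex k hV)]
  · rw [pairing_character, hΛ.natScalar_eq hV, if_pos rfl, qdim_unitIndex hsph hV hS,
      ringMatrix_unit_left hsph hV hS]
    ring
  · intro j _ hj
    rw [pairing_character, hΛ.natScalar_eq hV, if_neg hj]
    ring
  · simp

end FourierTransform

/-! ### Transposes for chosen pairings, and dinaturality. -/

section Mates

variable {C : Type u} [Category.{v} C] [MonoidalCategory C]

/-- The transpose of a morphism with respect to chosen exact pairings. -/
def mate {X X' Y Y' : C} [ExactPairing X X'] [ExactPairing Y Y'] (f : X ⟶ Y) : Y' ⟶ X' :=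
  @rightAdjointMate C _ _ X Y ⟨X'⟩ ⟨Y'⟩ f

theorem mate_comp {X X' Y Y' Z Z' : C} [ExactPairing X X'] [ExactPairing Y Y']
    [ExactPairing Z Z'] (f : X ⟶ Y) (g : Y ⟶ Z) :
    (mate (f ≫ g) : Z' ⟶ X') = (mate g : Z' ⟶ Y') ≫ mate f :=
  @comp_rightAdjointMate C _ _ X Y Z ⟨X'⟩ ⟨Y'⟩ ⟨Z'⟩ f g

theorem mate_id {X X' : C} [ExactPairing X X'] : mate (𝟙 X) = 𝟙 X' :=
  @rightAdjointMate_id C _ _ X ⟨X'⟩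

theorem mate_evaluation {X X' Y Y' : C} [ExactPairing X X'] [ExactPairing Y Y'] (f : X ⟶ Y) :
    mate f ▷ X ≫ ε_ X X' = Y' ◁ f ≫ ε_ Y Y' :=
  @rightAdjointMate_comp_evaluation C _ _ X Y ⟨X'⟩ ⟨Y'⟩ f

theorem mate_sum [Preadditive C] [MonoidalPreadditive C] {X X' Y Y' : C} [ExactPairing X X']
    [ExactPairing Y Y'] {J : Type*} (s : Finset J) (f : J → (X ⟶ Y)) :
    (mate (∑ j ∈ s, f j) : Y' ⟶ X') = ∑ j ∈ s, mate (f j) := by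
  simp only [mate, rightAdjointMate, sum_whiskerRight, whiskerLeft_sum, Preadditive.comp_sum,
    Preadditive.sum_comp]

theorem mate_zero [Preadditive C] [MonoidalPreadditive C] {X X' Y Y' : C} [ExactPairing X X']
    [ExactPairing Y Y'] : (mate (0 : X ⟶ Y) : Y' ⟶ X') = 0 := by
  simp [mate, rightAdjointMate]

theorem mate_smul {k : Type w} [Field k] [Preadditive C] [Linear k C] [MonoidalPreadditive C]
    [MonoidalLinear k C] {X X' Y Y' : C} [ExactPairing X X'] [ExactPairing Y Y'] (c : k)
    (f : X ⟶ Y) : (mate (c • f) : Y' ⟶ X') = c • mate f := by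
  simp [mate, rightAdjointMate]

variable [RigidCategory C]

/-- The left dual of the rigid structure. -/
abbrev predual (X : C) : C := ᘁX

theorem predual_pairing_naturality {Y Y' : C} (f : Y ⟶ Y') :
    f ▷ predual Y' ≫ ε_ (predual Y') Y' = Y ◁ leftAdjointMate f ≫ ε_ (predual Y) Y :=
  (leftAdjointMate_comp_evaluation f).symm

variable {R : C ⥤ Center C} (adj : Center.forget C ⊣ R)

theorem univCodinat_eq (Y : C) : univCodinat adj Y = mate (X' := dual (adjAlg R))
    (Y' := dual Y ⊗ Y) (univDinat adj (predual Y) Y) := rfl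

theorem drinfeld_eq (Q : dual (adjAlg R) ⟶ adjAlg R) (f : adjAlg R ⟶ 𝟙_ C) :
    drinfeld Q f = mate (X' := dual (adjAlg R)) (Y' := 𝟙_ C) f ≫ Q := rfl

theorem univDinat_dinatural {X X' Y Y' : C} [ExactPairing X Y] [ExactPairing X' Y'] (g : X' ⟶ X)
    (f : Y ⟶ Y') (h : η_ X' Y' ≫ g ▷ Y' = η_ X Y ≫ X ◁ f) :
    univDinat adj X' Y' ≫ g ▷ Y' = univDinat adj X Y ≫ X ◁ f := by
  have h1 := action_naturality adj g
  rw [univDinat, univDinat]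
  generalize action adj X = t at *
  generalize action adj X' = t' at *
  generalize adjAlg R = A at *
  simp only [Category.assoc]
  rw [← comp_whiskerRight, ← h1, comp_whiskerRight, ← associator_inv_naturality_middle_assoc,
    ← whiskerLeft_comp_assoc, h, ← whisker_exchange]
  simp

theorem univCodinat_evaluation (Y : C) :
    univCodinat adj Y ▷ adjAlg R ≫ ev (adjAlg R) = (dual Y ⊗ Y) ◁ univDinat adj (predual Y) Y ≫
      (𝟙 _ ⊗≫ dual Y ◁ (ε_ (predual Y) Y ▷ Y) ⊗≫ ev Y) :=
  mate_evaluation (X' := dual (adjAlg R)) (Y' := dual Y ⊗ Y) (univDinat adj (predual Y) Y)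

end Mates

/-! ### Existence and uniqueness of the Drinfeld map. -/

section DrinfeldMap

set_option linter.unusedSectionVars false

variable {k : Type w} [Field k] [IsAlgClosed k] {C : Type u} [Category.{v} C] [Abelian C]
  [Linear k C] [MonoidalCategory C] [MonoidalPreadditive C] [MonoidalLinear k C]
  [RigidCategory C] {R : C ⥤ Center C} (adj : Center.forget C ⊣ R)

/-- Morphisms into `A*` are tested by pairing with `A`, where the claim becomes dinaturality of the
universal maps out of `A`. -/
theorem univCodinat_dinatural {Y Y' : C} (f : Y ⟶ Y') :
    dual Y' ◁ f ≫ univCodinat adj Y' = dualMap f ▷ Y ≫ univCodinat adj Y := by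
  apply whiskerRight_comp_counit_injective (X := adjAlg R)
  have h1 := univDinat_dinatural adj (leftAdjointMate f) f (coevaluation_comp_leftAdjointMate f)
  have h2 := predual_pairing_naturality f
  have h3 : dualMap f ▷ Y ≫ ev Y = dual Y' ◁ f ≫ ev Y' := rightAdjointMate_comp_evaluation f
  have e := univCodinat_evaluation adj Y
  have e' := univCodinat_evaluation adj Y'
  rw [comp_whiskerRight_assoc, comp_whiskerRight_assoc]
  refine (congrArg _ e').trans (Eq.trans ?_ (congrArg _ e).symm)
  clear e e'
  generalize univDinat adj (predual Y) Y = t at *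
  generalize univDinat adj (predual Y') Y' = t' at *
  generalize adjAlg R = A at *
  calc _ = (dual Y' ⊗ Y) ◁ t' ≫ 𝟙 _ ⊗≫ dual Y' ◁ (f ▷ predual Y' ≫ ε_ (predual Y') Y') ▷ Y' ⊗≫
        ev Y' := by
        rw [← whisker_exchange_assoc]; monoidal
    _ = (dual Y' ⊗ Y) ◁ (t' ≫ leftAdjointMate f ▷ Y') ≫ 𝟙 _ ⊗≫
        dual Y' ◁ (ε_ (predual Y) Y) ▷ Y' ⊗≫ ev Y' := by
        rw [h2]; monoidal
    _ = (dual Y' ⊗ Y) ◁ t ⊗≫ dual Y' ◁ ((Y ⊗ predual Y) ◁ f ≫ ε_ (predual Y) Y ▷ Y') ⊗≫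
        ev Y' := by
        rw [h1]; monoidal
    _ = (dual Y' ⊗ Y) ◁ t ⊗≫ dual Y' ◁ ε_ (predual Y) Y ▷ Y ⊗≫ (dual Y' ◁ f ≫ ev Y') := by
        rw [whisker_exchange]; monoidal
    _ = (dual Y' ⊗ Y) ◁ t ⊗≫ (dual Y' ◁ (ε_ (predual Y) Y ▷ Y) ≫ dualMap f ▷ _) ⊗≫ ev Y := by
        rw [← h3]; monoidal
    _ = ((dual Y' ⊗ Y) ◁ t ≫ (dualMap f ▷ Y) ▷ _) ⊗≫ dual Y ◁ (ε_ (predual Y) Y ▷ Y) ⊗≫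
        ev Y := by
        rw [whisker_exchange]; monoidal
    _ = _ := by rw [whisker_exchange]; monoidal

variable [BraidedCategory C]

variable {adj} in
/-- The map `Y* ⊗ Y ⟶ A` given by the Hopf links. -/
theorem exists_hopfIncl (hA : IsUniversalAction (adjBraiding R) (counit adj)) (Y : C) :
    ∃ f : dual Y ⊗ Y ⟶ adjAlg R, ∀ X, f ▷ X ≫ action adj X = hopfAct Y X :=
  exists_action_eq adj hA (hopfAct Y) (hopfAct_naturality Y)

variable {adj} in
/-- The map `Y* ⊗ Y ⟶ A` given by the Hopf links. -/
def hopfIncl (hA : IsUniversalAction (adjBraiding R) (counit adj)) (Y : C) :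
    dual Y ⊗ Y ⟶ adjAlg R := (exists_hopfIncl hA Y).choose

variable {adj} (hA : IsUniversalAction (adjBraiding R) (counit adj))

theorem hopfIncl_action (Y X : C) : hopfIncl hA Y ▷ X ≫ action adj X = hopfAct Y X :=
  (exists_hopfIncl hA Y).choose_spec X

theorem hopfIncl_dinatural {Y Y' : C} (f : Y ⟶ Y') :
    dual Y' ◁ f ≫ hopfIncl hA Y' = dualMap f ▷ Y ≫ hopfIncl hA Y := by
  refine action_hom_ext adj hA fun X => ?_
  rw [comp_whiskerRight_assoc, comp_whiskerRight_assoc, hopfIncl_action, hopfIncl_action,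
    hopfAct_dinatural]

/-- The universal maps `A ⟶ X ⊗ X*` are jointly monic, so the dependence on `X` drops out of the
defining condition. -/
theorem isDrinfeldMap_iff (Q : dual (adjAlg R) ⟶ adjAlg R) : IsDrinfeldMap adj Q ↔
    ∀ Y, univCodinat adj Y ≫ Q = hopfIncl hA Y := by
  have h : ∀ X Y, hopfIncl hA Y ≫ univDinat adj X (dual X) = hopfLink X Y := by
    intro X Y
    rw [comp_univDinat, hopfIncl_action, hopfLink_eq]
  constructor
  · intro hQ Y
    refine univDinat_hom_ext adj hA fun X => ?_
    rw [Category.assoc, hQ X Y, h]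
  · intro hQ X Y
    rw [← Category.assoc, hQ, h]

variable [PivotalStructure C] {ι : Type*} [Fintype ι] [DecidableEq ι] {V : ι → C}

variable (k) in
/-- Every simple object of a simple system is the dual of another one. -/
def isoDualDualIndex [IsFusion k C] (hV : IsSimpleSystem V) (i : ι) :
    V i ≅ dual (V (dualIndex k hV i)) :=
  PivotalStructure.piv (V i) ≪≫ (dualIso (dualIndexIso k hV i)).symm

variable (k) in
theorem dinatural_ext [IsFusion k C] (hV : IsSimpleSystem V) {T : C}
    {s t : ∀ Y : C, dual Y ⊗ Y ⟶ T}
    (hs : ∀ {Y Y' : C} (f : Y ⟶ Y'), dual Y' ◁ f ≫ s Y' = dualMap f ▷ Y ≫ s Y)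
    (ht : ∀ {Y Y' : C} (f : Y ⟶ Y'), dual Y' ◁ f ≫ t Y' = dualMap f ▷ Y ≫ t Y)
    (h : ∀ i, s (dual (V i)) = t (dual (V i))) (Y : C) : s Y = t Y := by
  obtain ⟨n, i, p, q, hpq⟩ := exists_sum_comp_eq_id k hV Y
  rw [← Category.id_comp (s Y), ← Category.id_comp (t Y), ← MonoidalCategory.whiskerLeft_id,
    ← hpq, whiskerLeft_sum, Preadditive.sum_comp, Preadditive.sum_comp]
  refine Finset.sum_congr rfl fun a _ => ?_
  have h1 : p a ≫ q a = (p a ≫ (isoDualDualIndex k hV (i a)).hom) ≫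
      ((isoDualDualIndex k hV (i a)).inv ≫ q a) := by simp
  rw [h1, MonoidalCategory.whiskerLeft_comp, Category.assoc, Category.assoc, hs, ht, h]

/-- The isomorphism `*(X*) ≅ X`. -/
def predualDualIso (X : C) : predual (dual X) ≅ X :=
  leftDualIso (X₁ := predual (dual X)) (X₂ := X) (Y := dual X) inferInstance inferInstance

theorem coevaluation_predualDualIso (X : C) :
    η_ (predual (dual X)) (dual X) ≫ (predualDualIso X).hom ▷ dual X = coev X := by
  have := @coevaluation_comp_leftAdjointMate C _ _ (dual X) (dual X) ⟨X⟩ ⟨predual (dual X)⟩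
    (𝟙 (dual X))
  exact this.trans (by simp)

variable (adj) in
theorem univDinat_predual (X : C) :
    univDinat adj (predual (dual X)) (dual X) ≫ (predualDualIso X).hom ▷ dual X =
      univDinat adj X (dual X) := by
  rw [univDinat_dinatural adj (X := X) (Y := dual X) (predualDualIso X).hom (𝟙 (dual X))
    (by rw [coevaluation_predualDualIso]; simp)]
  simp

theorem comp_univDinat_eq_tensorRightHomEquiv {W : C} (f : W ⟶ adjAlg R) (X X' : C)
    [ExactPairing X X'] :
    f ≫ univDinat adj X X' = tensorRightHomEquiv W X X' X (f ▷ X ≫ action adj X) :=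
  comp_univDinat adj f X X'

variable (k) in
theorem predual_univDinat_hom_ext [IsFusion k C] (hA : IsUniversalAction (adjBraiding R) (counit adj))
    (hV : IsSimpleSystem V) {W : C} {f g : W ⟶ adjAlg R}
    (h : ∀ i, f ≫ univDinat adj (predual (dual (V i))) (dual (V i)) =
      g ≫ univDinat adj (predual (dual (V i))) (dual (V i))) : f = g := by
  refine action_hom_ext adj hA fun X => ?_
  have hn : ∀ (f : W ⟶ adjAlg R) {X Y : C} (u : X ⟶ Y),
      W ◁ u ≫ (f ▷ Y ≫ action adj Y ≫ (λ_ Y).inv) =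
        (f ▷ X ≫ action adj X ≫ (λ_ X).inv) ≫ 𝟙_ C ◁ u := by
    intro f X Y u
    rw [whisker_exchange_assoc, reassoc_of% (action_naturality adj u)]
    simp only [Category.assoc]
    rw [leftUnitor_inv_naturality u]
  have h1 := natural_family_ext k hV (hn f) (hn g) (fun i => ?_) X
  · rw [← Category.assoc, ← Category.assoc] at h1
    exact (cancel_mono _).1 h1
  · have h2 := h i
    simp only [comp_univDinat_eq_tensorRightHomEquiv] at h2
    have h3 := (tensorRightHomEquiv _ _ _ _).injective h2
    have h4 := action_naturality adj (predualDualIso (V i)).hom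
    rw [← cancel_epi (W ◁ (predualDualIso (V i)).hom), hn, hn]
    rw [← Category.assoc (f ▷ _), h3, Category.assoc (g ▷ _)]

theorem exists_comp_predual_univDinat [IsFusion k C] (hsph : IsSpherical k C)
    (hV : IsSimpleSystem V) (hS : (sMatrix k V).det ≠ 0)
    (D : ClassDecomposition V (adjBraiding R) (counit adj)) {W : C}
    (φ : ∀ i, W ⟶ predual (dual (V i)) ⊗ dual (V i)) :
    ∃ f : W ⟶ adjAlg R, ∀ i, f ≫ univDinat adj (predual (dual (V i))) (dual (V i)) = φ i := by
  obtain ⟨g, hg⟩ := exists_sum_encircle_ev_simple hsph hV hS fun i =>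
    W ◁ (predualDualIso (V i)).inv ≫ (tensorRightHomEquiv _ _ _ _).symm (φ i) ≫
      (predualDualIso (V i)).hom ≫ (λ_ _).inv
  have hcomp : ∀ l, (∑ j, g j ≫ D.incl j) ≫ D.proj l = g l := by
    intro l
    rw [Preadditive.sum_comp, Finset.sum_eq_single l]
    · simp [D.incl_proj_self]
    · intro j _ hj
      simp [D.incl_proj_ne j l hj]
    · simp
  refine ⟨∑ l, g l ≫ D.incl l, fun i => ?_⟩
  rw [comp_univDinat_eq_tensorRightHomEquiv, ← Equiv.eq_symm_apply]
  have h1 := action_naturality adj (predualDualIso (V i)).hom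
  have h2 := D.comp_halfAct_eq (∑ l, g l ≫ D.incl l) (V i)
  simp only [hcomp] at h2
  rw [hg] at h2
  rw [← cancel_mono (predualDualIso (V i)).hom, Category.assoc, ← h1, ← whisker_exchange_assoc,
    action_eq, reassoc_of% h2]
  simp

/-- The universal maps indexed by the duals of simple objects exhibit `A` as a direct sum;
transposing exhibits `A*` as the direct sum of the `Y_i* ⊗ Y_i` with `Y_i = V_i*`. So `Q` is freely
prescribed on these summands. -/
theorem existsUnique_isDrinfeldMap [IsFusion k C] (hsph : IsSpherical k C)
    (hV : IsSimpleSystem V) (hS : (sMatrix k V).det ≠ 0)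
    (hA : IsUniversalAction (adjBraiding R) (counit adj))
    (D : ClassDecomposition V (adjBraiding R) (counit adj)) : ∃! Q, IsDrinfeldMap adj Q := by
  let X : ι → C := fun i => predual (dual (V i))
  let Y : ι → C := fun i => dual (V i)
  let π : ∀ i, adjAlg R ⟶ X i ⊗ Y i := fun i => univDinat adj (X i) (Y i)
  have : ∀ i, ∃ j : X i ⊗ Y i ⟶ adjAlg R, j ≫ π i = 𝟙 _ ∧ ∀ m, m ≠ i → j ≫ π m = 0 := by
    intro i
    obtain ⟨f, hf⟩ := exists_comp_predual_univDinat hsph hV hS D (W := X i ⊗ Y i)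
      (fun m => if h : i = m then eqToHom (by rw [h]) else 0)
    refine ⟨f, (hf i).trans (by simp), fun m hm => (hf m).trans (by simp [hm.symm])⟩
  choose j hj hj' using this
  have htotal : ∑ i, π i ≫ j i = 𝟙 _ := by
    refine predual_univDinat_hom_ext k hA hV fun m => ?_
    rw [Preadditive.sum_comp, Finset.sum_eq_single m]
    · exact (Category.assoc _ _ _).trans ((congrArg _ (hj m)).trans (by simp [π, X, Y]))
    · intro i _ hi
      exact (Category.assoc _ _ _).trans ((congrArg _ (hj' i m hi.symm)).trans comp_zero)
    · simp
  let c : ∀ i, dual (Y i) ⊗ Y i ⟶ dual (adjAlg R) := fun i => univCodinat adj (Y i)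
  have hc : ∀ i, c i = mate (π i) := fun i => rfl
  let r : ∀ i, dual (adjAlg R) ⟶ dual (Y i) ⊗ Y i := fun i => mate (j i)
  have hr : ∑ i, r i ≫ c i = 𝟙 _ := by
    have : ∀ i, r i ≫ c i = mate (π i ≫ j i) := fun i => (mate_comp (π i) (j i)).symm
    simp only [this]
    rw [← mate_sum, htotal, mate_id]
  have hcr : ∀ i, c i ≫ r i = 𝟙 _ := by
    intro i
    have h1 : c i ≫ r i = mate (j i ≫ π i) := (mate_comp (j i) (π i)).symm
    rw [h1, hj, mate_id]
  have hcr' : ∀ i m, m ≠ i → c m ≫ r i = 0 := by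
    intro i m hm
    have h1 : c m ≫ r i = mate (j i ≫ π m) := (mate_comp (j i) (π m)).symm
    rw [h1, hj' i m hm, mate_zero]
  have hiff : ∀ Q, IsDrinfeldMap adj Q ↔ ∀ i, c i ≫ Q = hopfIncl hA (Y i) := by
    intro Q
    rw [isDrinfeldMap_iff hA]
    -- Dinaturality on both sides extends the condition from the objects `Y i` to all objects.
    refine ⟨fun h i => h _, fun h => dinatural_ext k hV (s := fun Y => univCodinat adj Y ≫ Q)
      (fun f => ?_) (fun f => hopfIncl_dinatural hA f) h⟩
    simp only [← Category.assoc, univCodinat_dinatural]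
  refine ⟨∑ i, r i ≫ hopfIncl hA (Y i), (hiff _).2 fun i => ?_, fun Q hQ => ?_⟩
  · rw [Preadditive.comp_sum, Finset.sum_eq_single i]
    · rw [reassoc_of% (hcr i)]
    · intro m _ hm
      rw [reassoc_of% (hcr' m i hm.symm), zero_comp]
    · simp
  · rw [← Category.id_comp Q, ← hr, Preadditive.sum_comp]
    simp only [Category.assoc, (hiff Q).1 hQ]

end DrinfeldMap

/-! ### Values of the Drinfeld map on characters and class functions. -/

section DrinfeldValues

set_option linter.unusedSectionVars false

variable {k : Type w} [Field k] [IsAlgClosed k] {C : Type u} [Category.{v} C] [Abelian C]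
  [Linear k C] [MonoidalCategory C] [MonoidalPreadditive C] [MonoidalLinear k C]
  [RigidCategory C] [PivotalStructure C] [BraidedCategory C]
  {ι : Type*} [Fintype ι] [DecidableEq ι] {V : ι → C}

theorem mate_comp_ev {Y : C} (f : predual Y ⊗ Y ⟶ 𝟙_ C) :
    (mate f : 𝟙_ C ⟶ dual Y ⊗ Y) ≫ ev Y = η_ (predual Y) Y ≫ f := by
  have h1 := mate_evaluation (X' := dual Y ⊗ Y) (Y' := 𝟙_ C) f
  have h2 : (dual Y ⊗ Y) ◁ η_ (predual Y) Y ≫ ε_ (predual Y ⊗ Y) (dual Y ⊗ Y) =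
      (ρ_ _).hom ≫ ev Y := by
    rw [ExactPairing.tensor_evaluation]
    calc _ = (α_ _ _ _).hom ≫ dual Y ◁ (Y ◁ η_ (predual Y) Y ≫ (α_ _ _ _).inv ≫
          ε_ (predual Y) Y ▷ Y) ≫ dual Y ◁ (λ_ Y).hom ≫ ev Y := by monoidal
      _ = _ := by rw [ExactPairing.coevaluation_evaluation]; monoidal
  have h3 := congrArg (fun t => 𝟙_ C ◁ η_ (predual Y) Y ≫ t) h1
  rw [whisker_exchange_assoc, h2, ← whiskerLeft_comp_assoc] at h3
  have h4 : ε_ (𝟙_ C) (𝟙_ C) = (ρ_ (𝟙_ C)).hom := rfl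
  rw [h4, rightUnitor_naturality_assoc] at h3
  rw [← cancel_epi (ρ_ (𝟙_ C)).hom, h3, ← unitors_equal, leftUnitor_naturality]

variable {R : C ⥤ Center C} {adj : Center.forget C ⊣ R}
  (hA : IsUniversalAction (adjBraiding R) (counit adj))

include hA in
-- The transpose of the character factors through the universal map of `X*`, where `Q` is the Hopf
-- link. So the image acts as a loop `X*` closed on the left, and sphericity gives this closure the
-- dimension of `X*`.
theorem centralToEnd_drinfeld_character [IsFusion k C] (hsph : IsSpherical k C)
    (hV : IsSimpleSystem V) (hS : (sMatrix k V).det ≠ 0) {Q : dual (adjAlg R) ⟶ adjAlg R}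
    (hQ : IsDrinfeldMap adj Q) (X : C) [Simple X] :
    centralToEnd adj (drinfeld Q (character adj X)) = ring (dual X) := by
  have := simple_dual k X
  set w := (predualDualIso X).hom ▷ dual X ≫ evPiv X with hw
  let q : 𝟙_ C ⟶ dual (dual X) ⊗ dual X := mate w
  have h1 : drinfeld Q (character adj X) = q ≫ hopfIncl hA (dual X) := by
    rw [← (isDrinfeldMap_iff hA Q).1 hQ, univCodinat_eq, ← Category.assoc, drinfeld_eq,
      character, ← univDinat_predual, Category.assoc, ← hw]
    congr 1
    exact mate_comp _ _
  have h2 : q ≫ ev (dual X) = qdim k (dual X) • 𝟙 _ := by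
    rw [← hsph, qdim, unitScalar_smul_id]
    refine (mate_comp_ev w).trans ?_
    rw [hw, ← Category.assoc, coevaluation_predualDualIso, pivTrace]
    simp
  rw [← leftRing_eq_ring hV (qdim_ne_zero hsph hV hS) h2]
  ext Z
  rw [centralToEnd_app, h1, comp_whiskerRight_assoc, hopfIncl_action, comp_hopfAct_eq_leftRing]

theorem drinfeld_sum {J : Type*} (s : Finset J) (c : J → k) (f : J → (adjAlg R ⟶ 𝟙_ C))
    (Q : dual (adjAlg R) ⟶ adjAlg R) :
    drinfeld Q (∑ j ∈ s, c j • f j) = ∑ j ∈ s, c j • drinfeld Q (f j) := by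
  simp only [drinfeld_eq, mate_sum, mate_smul, Preadditive.sum_comp, Linear.smul_comp]

theorem centralToEnd_sum {J : Type*} (s : Finset J) (c : J → k) (a : J → (𝟙_ C ⟶ adjAlg R)) :
    centralToEnd adj (∑ j ∈ s, c j • a j) = ∑ j ∈ s, c j • centralToEnd adj (a j) := by
  ext X
  rw [NatTrans.app_sum, centralToEnd_app]
  simp only [NatTrans.app_smul, centralToEnd_app, sum_whiskerRight, Preadditive.comp_sum,
    Preadditive.sum_comp, smul_whiskerRight, Linear.comp_smul, Linear.smul_comp]

include hA in
theorem natScalar_drinfeld_character [IsFusion k C] (hsph : IsSpherical k C)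
    (hV : IsSimpleSystem V) (hS : (sMatrix k V).det ≠ 0) {Q : dual (adjAlg R) ⟶ adjAlg R}
    (hQ : IsDrinfeldMap adj Q) (i m : ι) :
    natScalar k (centralToEnd adj (drinfeld Q (character adj (V i)))) (V m) =
      ringMatrix k V (dualIndex k hV i) m := by
  have := hV.simple
  have := simple_dual k (V i)
  rw [centralToEnd_drinfeld_character hA hsph hV hS hQ]
  exact ringScalar_congr hsph hV hS (dualIndexIso k hV i) m

include hA in
-- Expanding the class function in characters gives the orthogonality relation at the dual indices.
-- The dual index on the left is what determines the labelling of the classes.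
theorem ClassDecomposition.natScalar_drinfeld_classFun [IsFusion k C] (hsph : IsSpherical k C)
    (hV : IsSimpleSystem V) (hS : (sMatrix k V).det ≠ 0) {Q : dual (adjAlg R) ⟶ adjAlg R}
    (hQ : IsDrinfeldMap adj Q) (D : ClassDecomposition V (adjBraiding R) (counit adj)) (l m : ι) :
    natScalar k (centralToEnd adj (drinfeld Q (D.classFun (dualIndex k hV l)))) (V m) =
      if l = m then 1 else 0 := by
  have := hV.simple
  obtain ⟨-, hdual, -, horth⟩ := globalDim_ne_zero hsph hV hS
  rw [D.classFun_eq hsph hV hS, drinfeld_sum, centralToEnd_sum, natScalar_sum]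
  have h1 := horth (dualIndex k hV l) (dualIndex k hV m)
  rw [Finset.mul_sum] at h1
  have h2 : (dualIndex k hV l = dualIndex k hV m) = (l = m) :=
    propext (Function.Involutive.injective (dualIndex_dualIndex k hV)).eq_iff
  simp only [h2] at h1
  refine Eq.trans (Finset.sum_congr rfl fun i _ => ?_) h1
  rw [natScalar_drinfeld_character hA hsph hV hS hQ, hdual, mul_assoc]

theorem isSimpleIdempotent_iff [IsFusion k C] (hV : IsSimpleSystem V) (i : ι)
    (e : 𝟙_ C ⟶ adjAlg R) : IsSimpleIdempotent adj V i e ↔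
      ∀ m, natScalar k (centralToEnd adj e) (V m) = if i = m then 1 else 0 := by
  have := hV.simple
  constructor
  · rintro ⟨h1, h2⟩ m
    apply natScalar_eq
    split_ifs with h
    · subst h
      rw [h1, one_smul]
    · rw [h2 m (Ne.symm h), zero_smul]
  · intro h
    refine ⟨?_, fun j hj => ?_⟩
    · refine (natScalar_spec (k := k) _ _).trans ?_
      rw [h, if_pos rfl, one_smul]
    · refine (natScalar_spec (k := k) _ _).trans ?_
      rw [h, if_neg hj.symm, zero_smul]

end DrinfeldValues

/-! ### Comparison with an arbitrary decomposition of `R(𝟙)`. -/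

section Decompositions

set_option linter.unusedSectionVars false

variable {k : Type w} [Field k] [IsAlgClosed k] {C : Type u} [Category.{v} C] [Abelian C]
  [Linear k C] [MonoidalCategory C] [MonoidalPreadditive C] [MonoidalLinear k C]
  [RigidCategory C] [PivotalStructure C] [BraidedCategory C]
  {ι : Type*} [Fintype ι] [DecidableEq ι] {V : ι → C}

theorem center_sum_f {X Y : Center C} {J : Type*} (s : Finset J) (f : J → (X ⟶ Y)) :
    (∑ j ∈ s, f j).f = ∑ j ∈ s, (f j).f :=
  map_sum (AddMonoidHom.mk' (fun f : X ⟶ Y => f.f) fun _ _ => rfl) f s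

variable {R : C ⥤ Center C} {adj : Center.forget C ⊣ R}

/-- The decomposition of `R(𝟙)` into simple objects given by a class decomposition. -/
def ClassDecomposition.simpleDecomposition [IsFusion k C] (hsph : IsSpherical k C)
    (hV : IsSimpleSystem V) (hS : (sMatrix k V).det ≠ 0)
    (D : ClassDecomposition V (adjBraiding R) (counit adj)) {n : ℕ} (e : Fin n ≃ ι) :
    SimpleDecomposition (R.obj (𝟙_ C)) (Fin n) where
  obj j := classObj (V (e j))
  simple j := simple_classObj hsph hV hS (e j)
  incl j := ⟨D.incl (e j), D.incl_comm (e j)⟩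
  proj j := ⟨D.proj (e j), D.proj_comm (e j)⟩
  incl_proj_self j := Center.ext _ _ (D.incl_proj_self (e j))
  incl_proj_ne i j hij := Center.ext _ _ (D.incl_proj_ne (e i) (e j) fun h => hij (e.injective h))
  sum_proj_incl := by
    refine Center.ext _ _ ?_
    rw [center_sum_f]
    exact (e.sum_comp fun l => D.proj l ≫ D.incl l).trans D.sum_proj_incl

/-- Extended by zero, `f` is an endomorphism of `R(𝟙)`. Such endomorphisms correspond to class
functions, hence are combinations of the projectors and have no off-diagonal part. -/
theorem ClassDecomposition.hom_eq_zero [IsFusion k C] (hV : IsSimpleSystem V)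
    (D : ClassDecomposition V (adjBraiding R) (counit adj)) {l m : ι} (hlm : l ≠ m)
    {f : dual (V l) ⊗ V l ⟶ dual (V m) ⊗ V m}
    (hf : ∀ X, f ▷ X ≫ ((mixedTensor (dual (V m)) (V m)).β X).hom =
      ((mixedTensor (dual (V l)) (V l)).β X).hom ≫ X ◁ f) : f = 0 := by
  have h1 : D.incl l ≫ (D.proj l ≫ f ≫ D.incl m) ≫ D.proj m = f := by
    simp only [Category.assoc, D.incl_proj_self, Category.comp_id]
    rw [reassoc_of% (D.incl_proj_self l)]
  obtain ⟨c, hc⟩ := D.exists_eq_sum_classFun k hV ((D.proj l ≫ f ≫ D.incl m) ≫ counit adj)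
  have h2 : centralHat adj ((D.proj l ≫ f ≫ D.incl m) ≫ counit adj) =
      D.proj l ≫ f ≫ D.incl m := by
    refine centralHat_eq adj (fun X => ?_) rfl
    simp only [comp_whiskerRight, Category.assoc, MonoidalCategory.whiskerLeft_comp]
    rw [D.incl_comm, reassoc_of% (hf X), reassoc_of% (D.proj_comm l X)]
  rw [← h1, ← h2, hc, D.centralHat_sum, Preadditive.sum_comp, Preadditive.comp_sum]
  refine Finset.sum_eq_zero fun j _ => ?_
  simp only [Linear.smul_comp, Linear.comp_smul, Category.assoc]
  by_cases hj : l = j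
  · subst hj
    rw [D.incl_proj_ne _ _ hlm]
    simp
  · rw [reassoc_of% (D.incl_proj_ne _ _ hj), zero_comp, smul_zero]

/-- The object of the center defined by a half-braiding. -/
def centerObj {N : C} (c : HalfBraiding N) : Center C := ⟨N, c⟩

/-- The decomposition is multiplicity free: a simple summand maps isomorphically to one `V_l* ⊗ V_l`
and has no morphisms to or from the others, so its projector, and not only its isomorphism class, is
determined. -/
theorem ClassDecomposition.exists_summand [IsFusion k C] (hsph : IsSpherical k C)
    (hV : IsSimpleSystem V) (hS : (sMatrix k V).det ≠ 0)
    (D : ClassDecomposition V (adjBraiding R) (counit adj)) {N : C} {c : HalfBraiding N}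
    (hN : Simple (centerObj c)) {I : N ⟶ adjAlg R} {P : adjAlg R ⟶ N}
    (hI : ∀ X, I ▷ X ≫ ((adjBraiding R).β X).hom = (c.β X).hom ≫ X ◁ I)
    (hP : ∀ X, P ▷ X ≫ (c.β X).hom = ((adjBraiding R).β X).hom ≫ X ◁ P)
    (hIP : I ≫ P = 𝟙 N) :
    ∃ l, P ≫ I = D.proj l ≫ D.incl l ∧ Nonempty (N ≅ dual (V l) ⊗ V l) := by
  have hIl : ∀ l X, (I ≫ D.proj l) ▷ X ≫ ((mixedTensor (dual (V l)) (V l)).β X).hom =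
      (c.β X).hom ≫ X ◁ (I ≫ D.proj l) := by
    intro l X
    rw [comp_whiskerRight_assoc, D.proj_comm, reassoc_of% (hI X),
      ← MonoidalCategory.whiskerLeft_comp]
  have hlP : ∀ l X, (D.incl l ≫ P) ▷ X ≫ (c.β X).hom =
      ((mixedTensor (dual (V l)) (V l)).β X).hom ≫ X ◁ (D.incl l ≫ P) := by
    intro l X
    rw [comp_whiskerRight_assoc, hP, reassoc_of% (D.incl_comm l X),
      ← MonoidalCategory.whiskerLeft_comp]
  have hcomp : ∀ {l m : ι} {f : dual (V l) ⊗ V l ⟶ N} {g : N ⟶ dual (V m) ⊗ V m},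
      (∀ X, f ▷ X ≫ (c.β X).hom = ((mixedTensor (dual (V l)) (V l)).β X).hom ≫ X ◁ f) →
      (∀ X, g ▷ X ≫ ((mixedTensor (dual (V m)) (V m)).β X).hom = (c.β X).hom ≫ X ◁ g) →
      l ≠ m → f ≫ g = 0 := by
    intro l m f g hf hg hlm
    refine D.hom_eq_zero (k := k) hV hlm fun X => ?_
    rw [comp_whiskerRight_assoc, hg, reassoc_of% (hf X), ← MonoidalCategory.whiskerLeft_comp]
  have h1 : ∃ l, I ≫ D.proj l ≠ 0 := by
    by_contra! h
    have hI0 : I = 0 := D.hom_ext fun l => by rw [h, zero_comp]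
    have h2 : 𝟙 N = 0 := by rw [← hIP, hI0, zero_comp]
    exact id_nonzero (centerObj c) (Center.ext _ _ h2)
  obtain ⟨l, hl⟩ := h1
  obtain ⟨g, hg, hgf⟩ := exists_comp_eq_smul_id hsph hV hS (hIl l) hl
  -- The section `g` is a nonzero monomorphism into the simple object `N`, hence an isomorphism.
  have hfg : (I ≫ D.proj l) ≫ g = 𝟙 N := by
    let f' : (centerObj c) ⟶ classObj (V l) := ⟨I ≫ D.proj l, hIl l⟩
    let g' : classObj (V l) ⟶ (centerObj c) := ⟨g, hg⟩
    have hgf' : g' ≫ f' = 𝟙 _ := Center.ext _ _ hgf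
    have : IsSplitMono g' := ⟨⟨⟨f', hgf'⟩⟩⟩
    have hg0 : g' ≠ 0 := by
      intro h0
      have := simple_classObj hsph hV hS l
      apply id_nonzero (classObj (V l))
      rw [← hgf', h0, zero_comp]
    have := (Simple.mono_isIso_iff_nonzero g').2 hg0
    have h3 : f' ≫ g' = 𝟙 _ := by
      rw [← cancel_epi g', reassoc_of% hgf', Category.comp_id]
    exact congrArg Center.Hom.f h3
  have hI' : I = (I ≫ D.proj l) ≫ D.incl l := by
    refine D.hom_ext fun m => ?_
    by_cases hm : l = m
    · subst hm
      simp only [Category.assoc, D.incl_proj_self, Category.comp_id]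
    · simp only [Category.assoc, D.incl_proj_ne _ _ hm, comp_zero]
      have h4 := hcomp hg (hIl m) hm
      calc I ≫ D.proj m = ((I ≫ D.proj l) ≫ g) ≫ I ≫ D.proj m := by rw [hfg, Category.id_comp]
        _ = 0 := by rw [Category.assoc, h4, comp_zero]
  have hP' : P = D.proj l ≫ D.incl l ≫ P := by
    refine D.hom_ext' fun m => ?_
    by_cases hm : m = l
    · subst hm
      rw [reassoc_of% (D.incl_proj_self m)]
    · rw [reassoc_of% (D.incl_proj_ne _ _ hm), zero_comp]
      have h4 := hcomp (hlP m) (hIl l) hm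
      calc D.incl m ≫ P = (D.incl m ≫ P) ≫ (I ≫ D.proj l) ≫ g := by rw [hfg, Category.comp_id]
        _ = 0 := by rw [← Category.assoc, h4, zero_comp]
  have hg' : D.incl l ≫ P = g := by
    have h5 : (I ≫ D.proj l) ≫ D.incl l ≫ P = 𝟙 N := by
      rw [← Category.assoc, ← hI', hIP]
    calc D.incl l ≫ P = (g ≫ I ≫ D.proj l) ≫ D.incl l ≫ P := by rw [hgf, Category.id_comp]
      _ = g := by rw [Category.assoc, h5, Category.comp_id]
  refine ⟨l, ?_, ⟨⟨I ≫ D.proj l, g, hfg, hgf⟩⟩⟩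
  calc P ≫ I = (D.proj l ≫ D.incl l ≫ P) ≫ (I ≫ D.proj l) ≫ D.incl l := by rw [← hI', ← hP']
    _ = D.proj l ≫ (g ≫ I ≫ D.proj l) ≫ D.incl l := by rw [hg']; simp only [Category.assoc]
    _ = _ := by rw [hgf, Category.id_comp]

/-- Orthogonality of the given projectors makes the assignment of summands injective; their sum
being the identity makes it surjective. -/
theorem ClassDecomposition.exists_equiv [IsFusion k C] (hsph : IsSpherical k C)
    (hV : IsSimpleSystem V) (hS : (sMatrix k V).det ≠ 0)
    (D : ClassDecomposition V (adjBraiding R) (counit adj)) {n : ℕ}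
    (E : SimpleDecomposition (R.obj (𝟙_ C)) (Fin n)) : ∃ θ : Fin n ≃ ι,
      (∀ j, classIdempotent adj E j = D.classFun (θ j)) ∧
      ∀ j, classSize k E j = qdim k (V (θ j)) * qdim k (V (θ j)) := by
  have h1 : ∀ j, ∃ l, (E.proj j ≫ E.incl j).f = D.proj l ≫ D.incl l ∧
      Nonempty ((Center.forget C).obj (E.obj j) ≅ dual (V l) ⊗ V l) := fun j =>
    D.exists_summand hsph hV hS (c := (E.obj j).2) (E.simple j) (I := (E.incl j).f)
      (P := (E.proj j).f) (E.incl j).comm (E.proj j).comm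
      (congrArg Center.Hom.f (E.incl_proj_self j))
  choose θ hθ hiso using h1
  have hinj : Function.Injective θ := by
    intro i j hij
    by_contra hne
    have h2 : E.proj i ≫ E.incl i = E.proj j ≫ E.incl j :=
      Center.ext _ _ (by rw [hθ, hθ, hij])
    have := E.simple i
    apply id_nonzero (E.obj i)
    have h3 : E.incl i ≫ (E.proj i ≫ E.incl i) ≫ E.proj i = 𝟙 _ := by
      rw [Category.assoc, E.incl_proj_self, Category.comp_id, E.incl_proj_self]
    rw [← h3, h2, Category.assoc, reassoc_of% (E.incl_proj_ne i j hne), zero_comp]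
  have hsurj : Function.Surjective θ := by
    intro l
    by_contra! hl
    have h2 : ∑ j, D.proj (θ j) ≫ D.incl (θ j) = 𝟙 (adjAlg R) := by
      have h3 := congrArg Center.Hom.f E.sum_proj_incl
      rw [center_sum_f] at h3
      simp only [hθ] at h3
      exact h3
    have := hV.simple l
    apply ev_ne_zero k (V l)
    rw [← D.incl_counit, ← Category.comp_id (D.incl l), ← h2, Preadditive.comp_sum]
    rw [Finset.sum_eq_zero, zero_comp]
    intro j _
    rw [reassoc_of% (D.incl_proj_ne l (θ j) (hl j).symm), zero_comp]
  refine ⟨Equiv.ofBijective θ ⟨hinj, hsurj⟩, fun j => ?_, fun j => ?_⟩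
  · have h2 : (Center.forget C).map (E.proj j ≫ E.incl j) = D.proj (θ j) ≫ D.incl (θ j) := hθ j
    rw [classIdempotent, h2, Category.assoc, D.incl_counit]
    rfl
  · rw [classSize, qdim_congr (hiso j).some, qdim_tensor, ← hsph]
    rfl

end Decompositions

/-! ### Conjugacy class sums and the theorem. -/

section ClassSums

set_option linter.unusedSectionVars false

variable {k : Type w} [Field k] [IsAlgClosed k] {C : Type u} [Category.{v} C] [Abelian C]
  [Linear k C] [MonoidalCategory C] [MonoidalPreadditive C] [MonoidalLinear k C]
  [RigidCategory C] [PivotalStructure C] [BraidedCategory C]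
  {ι : Type*} [Fintype ι] [DecidableEq ι] {V : ι → C}
  {R : C ⥤ Center C} {adj : Center.forget C ⊣ R}

theorem ClassDecomposition.fourier_smul [IsFusion k C] (hsph : IsSpherical k C)
    (hV : IsSimpleSystem V) (hS : (sMatrix k V).det ≠ 0)
    (hA : IsUniversalAction (adjBraiding R) (counit adj))
    (D : ClassDecomposition V (adjBraiding R) (counit adj)) (c : k) (a : 𝟙_ C ⟶ adjAlg R) :
    fourier adj (D.classFun (unitIndex k hV)) (c • a) =
      c • fourier adj (D.classFun (unitIndex k hV)) a := by
  have := hV.simple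
  rw [D.fourier_eq hsph hV hS hA, D.fourier_eq hsph hV hS hA, Finset.smul_sum]
  refine Finset.sum_congr rfl fun j _ => ?_
  have h : natScalar k (centralToEnd adj (c • a)) (V (dualIndex k hV j)) =
      c * natScalar k (centralToEnd adj a) (V (dualIndex k hV j)) := by
    apply natScalar_eq
    rw [mul_smul, ← natScalar_spec, centralToEnd_app, centralToEnd_app, smul_whiskerRight]
    simp only [Linear.comp_smul, Linear.smul_comp]
  rw [h, smul_smul]
  ring_nf

/-- The element `f_Q(χ_i)` has the scalars `r_{i* m}` required by `fourier_eq_classFun`, and the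
Fourier transform is linear and bijective. -/
theorem ClassDecomposition.invFun_fourier [IsFusion k C] (hsph : IsSpherical k C)
    (hV : IsSimpleSystem V) (hS : (sMatrix k V).det ≠ 0)
    (hA : IsUniversalAction (adjBraiding R) (counit adj))
    (D : ClassDecomposition V (adjBraiding R) (counit adj)) {Q : dual (adjAlg R) ⟶ adjAlg R}
    (hQ : IsDrinfeldMap adj Q) (i : ι) :
    Function.invFun (fourier adj (D.classFun (unitIndex k hV))) (D.classFun (dualIndex k hV i)) =
      qdim k (V i) • drinfeld Q (character adj (V i)) := by
  rw [← D.fourier_eq_classFun hsph hV hS hA (natScalar_drinfeld_character hA hsph hV hS hQ i),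
    ← D.fourier_smul hsph hV hS hA]
  exact Function.leftInverse_invFun (D.fourier_bijective hsph hV hS hA).1 _

end ClassSums
end
end ModularFusion

open ModularFusion in
theorem theorem6p5
    {k : Type w} [Field k] [IsAlgClosed k]
    {C : Type u} [Category.{v} C] [Abelian C] [Linear k C]
    [MonoidalCategory C] [MonoidalPreadditive C] [MonoidalLinear k C]
    [RigidCategory C] [BraidedCategory C] [IsFusion k C] [PivotalStructure C]
    (hspherical : IsSpherical k C)
    {ι : Type*} [Fintype ι] [DecidableEq ι] (V : ι → C) (hV : IsSimpleSystem V)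
    (hmodular : (sMatrix k V).det ≠ 0) :
    (Center.forget C).IsLeftAdjoint ∧
    ∀ (R : C ⥤ Center C) (adj : Center.forget C ⊣ R),
      -- the objects in the formula exist and are well defined
      Function.Bijective (centralToEnd adj) ∧
      (∃! Q, IsDrinfeldMap adj Q) ∧
      (∃! Λ, IsNormalizedIntegral adj Λ) ∧
      (∃! l, IsNormalizedCointegral adj l) ∧
      (∀ l, IsNormalizedCointegral adj l → Function.Bijective (fourier adj l)) ∧
      (∃ n : ℕ, Nonempty (SimpleDecomposition (R.obj (𝟙_ C)) (Fin n))) ∧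
      -- the formula
      ∀ (Q : dual (adjAlg R) ⟶ adjAlg R) (Λ : 𝟙_ C ⟶ adjAlg R) (l : adjAlg R ⟶ 𝟙_ C),
        IsDrinfeldMap adj Q → IsNormalizedIntegral adj Λ → IsNormalizedCointegral adj l →
        ∀ (n : ℕ) (D : SimpleDecomposition (R.obj (𝟙_ C)) (Fin n)),
          ∃ σ : ι ≃ Fin n,
            (∀ i, IsSimpleIdempotent adj V i (drinfeld Q (classIdempotent adj D (σ i)))) ∧
            (∀ τ : ι ≃ Fin n,
              (∀ i, IsSimpleIdempotent adj V i (drinfeld Q (classIdempotent adj D (τ i)))) →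
                τ = σ) ∧
            globalDim k V ≠ 0 ∧
            ∀ i,
              pairing k (classIdempotent adj D (σ i)) Λ ≠ 0 ∧
              classSize k D (σ i) ≠ 0 ∧
              drinfeld Q (character adj (V i)) =
                (qdim k (V i) * classNumber k adj D Λ (σ i) / globalDim k V) •
                  classSum adj D l (σ i) ∧
              drinfeld Q (character adj (V i)) =
                (qdim k (V i) / classSize k D (σ i)) • classSum adj D l (σ i) := by
  refine ⟨forget_isLeftAdjoint_of_isFusion hspherical hV hmodular, fun R adj => ?_⟩
  obtain ⟨D⟩ := exists_classDecomposition_adjAlg hspherical hV hmodular adj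
  have hA := D.isUniversalAction hspherical hV hmodular
  obtain ⟨Λ₀, hΛ₀, hproj⟩ := exists_isNormalizedIntegral adj hV hmodular hA
  have hl₀ := D.isNormalizedCointegral k hV hA
  have hΛ : ∀ Λ, IsNormalizedIntegral adj Λ → Λ = Λ₀ := fun Λ h =>
    isNormalizedIntegral_unique adj hA h hΛ₀
  have hl : ∀ l, IsNormalizedCointegral adj l → l = D.classFun (unitIndex k hV) := fun l h =>
    isNormalizedCointegral_unique k hV D h hl₀
  refine ⟨centralToEnd_bijective adj hA, existsUnique_isDrinfeldMap hspherical hV hmodular hA D,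
    ⟨Λ₀, hΛ₀, hΛ⟩, ⟨_, hl₀, hl⟩, ?_, ⟨Fintype.card ι, ⟨D.simpleDecomposition hspherical hV
      hmodular (Fintype.equivFin ι).symm⟩⟩, ?_⟩
  · intro l h
    rw [hl l h]
    exact D.fourier_bijective hspherical hV hmodular hA
  intro Q Λ l hQ hΛ' hl' n E
  obtain rfl := hΛ Λ hΛ'
  obtain rfl := hl l hl'
  obtain ⟨θ, hθ, hsize⟩ := D.exists_equiv hspherical hV hmodular E
  have hinv : Function.Involutive (dualIndex k hV) := dualIndex_dualIndex k hV
  -- The class labelled `i` is the summand `V_{i*}* ⊗ V_{i*}`, because the Drinfeld map sends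
  -- `F_{i*}` to `E_i`.
  let σ : ι ≃ Fin n := hinv.toPerm.trans θ.symm
  have hσ : ∀ i, θ (σ i) = dualIndex k hV i := fun i => θ.apply_symm_apply _
  have hN := (globalDim_ne_zero hspherical hV hmodular).1
  have hd := qdim_ne_zero hspherical hV hmodular
  refine ⟨σ, fun i => ?_, fun τ hτ => ?_, hN, fun i => ?_⟩
  · rw [isSimpleIdempotent_iff (k := k) hV, hθ, hσ]
    exact D.natScalar_drinfeld_classFun hA hspherical hV hmodular hQ i
  · ext i
    congr 1
    apply θ.injective
    rw [hσ]
    -- Evaluating at `V i` suffices: the image of the class function at `θ (τ i)` acts on `V i` as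
    -- `1` only if `i` is dual to `θ (τ i)`.
    have h1 := (isSimpleIdempotent_iff (k := k) hV i _).1 (hτ i) i
    rw [hθ, ← hinv (θ (τ i)), D.natScalar_drinfeld_classFun hA hspherical hV hmodular hQ,
      if_pos rfl] at h1
    have h2 : dualIndex k hV (θ (τ i)) = i := by
      by_contra h
      rw [if_neg h] at h1
      exact zero_ne_one h1
    exact (hinv _).symm.trans (congrArg _ h2)
  · have hpair : pairing k (classIdempotent adj E (σ i)) Λ =
        qdim k (V i) * qdim k (V i) / globalDim k V := by
      rw [hθ, hσ, D.pairing_classFun hspherical hV hmodular hproj, qdim_dualIndex hspherical]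
    have hcs : classSize k E (σ i) = qdim k (V i) * qdim k (V i) := by
      rw [hsize, hσ, qdim_dualIndex hspherical]
    have hsum : classSum adj E (D.classFun (unitIndex k hV)) (σ i) =
        qdim k (V i) • drinfeld Q (character adj (V i)) := by
      rw [classSum, hθ, hσ, D.invFun_fourier hspherical hV hmodular hA hQ]
    have hdi := hd i
    refine ⟨?_, ?_, ?_, ?_⟩
    · rw [hpair]
      exact div_ne_zero (mul_ne_zero hdi hdi) hN
    · rw [hcs]
      exact mul_ne_zero hdi hdi
    · have h : qdim k (V i) * classNumber k adj E Λ (σ i) / globalDim k V * qdim k (V i) = 1 := by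
        rw [classNumber, hpair]
        field_simp
      rw [hsum, smul_smul, h, one_smul]
    · have h : qdim k (V i) / classSize k E (σ i) * qdim k (V i) = 1 := by
        rw [hcs]
        field_simp
      rw [hsum, smul_smul, h, one_smul]
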